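/- Let $d\in\mathbb{N}$, and let $a:\mathbb{R}^d\times\mathbb{R}^d\to\mathbb{R}$ be a real symbol of class $S^0_{0,0}$, i.e. $a$ is $C^\infty$ and all its derivatives (including $a$ itself) are bounded. Let $F:\mathbb{R}^d\to\mathbb{R}^d$ be $C^\infty$ with all derivatives of order $\geq 1$ bounded. For $\delta\in\mathbb{R}$ let $K_\delta$ be the Weyl quantization on $L^2(\mathbb{R}^d)$ of the symbol $a_{\delta}(x,\xi)=a(x+F(\delta x),\xi)$, i.e. the bounded operator determined by $$\langle \psi,K_\delta\phi\rangle=(2\pi)^{-d}\int_{\mathbb{R}^d}d\xi\int_{\mathbb{R}^{2d}}dx'\,dx\;e^{i\xi\cdot(x-x')}\,a_\delta\big(\tfrac{x+x'}{2},\xi\big)\,\overline{\psi(x)}\,\phi(x'),\qquad \psi,\phi\in\mathscr{S}(\mathbb{R}^d).$$ Then such a bounded operator $K_\delta$ exists for every $\delta\in\mathbb{R}$ and is self-adjoint, and there is a constant $C>0$, depending only on $d$, $a$ and $F$, with the following properties. (i) The Hausdorff distance between the spectra satisfies $d_h(\sigma(K_\delta),\sigma(K_0))\leq C\sqrt{|\delta|}$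 for all $|\delta|\leq 1$. (ii) With the same $C$, for every open spectral gap of $K_0$, i.e. for all real $\lambda_0<\mu_0$ with $\lambda_0,\mu_0\in\sigma(K_0)$ and $(\lambda_0,\mu_0)\cap\sigma(K_0)=\emptyset$, and for every $\delta\in\mathbb{R}$ with $|\delta|<(\mu_0-\lambda_0)^2/(4C^2)$: the interval $[\lambda_0+C\sqrt{|\delta|},\,\mu_0-C\sqrt{|\delta|}]$ is non-empty and, if $\delta\neq 0$, is contained in the resolvent set of $K_\delta$; moreover, both $[\lambda_0-C\sqrt{|\delta|},\,\lambda_0+C\sqrt{|\delta|}]$ and $[\mu_0-C\sqrt{|\delta|},\,\mu_0+C\sqrt{|\delta|}]$ have a non-empty intersection with $\sigma(K_\delta)$. -/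

import Mathlib

open MeasureTheory Set
open scoped ContDiff SchwartzMap ComplexConjugate

noncomputable section

/-- The configuration space `ℝ^d` with its Euclidean structure. -/
abbrev Rd (d : ℕ) : Type := EuclideanSpace ℝ (Fin d)

/-- The Hilbert space `L²(ℝ^d)` of complex-valued square integrable functions
(its inner product is antilinear in the first variable). -/
abbrev L2Rd (d : ℕ) : Type := Lp ℂ 2 (volume : Measure (Rd d))

/-- Real Hörmander symbols of class `S^0_{0,0}(ℝ^d × ℝ^d)`: smooth real functions of `(x, ξ)`
all of whose derivatives, of every order `n ≥ 0`, are bounded. -/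
structure IsSymbolS00 {d : ℕ} (a : Rd d × Rd d → ℝ) : Prop where
  smooth : ContDiff ℝ ∞ a
  bounded : ∀ n : ℕ, ∃ M : ℝ, ∀ p : Rd d × Rd d, ‖iteratedFDeriv ℝ n a p‖ ≤ M

/-- Smooth vector fields on `ℝ^d` all of whose derivatives, of every order `n ≥ 1`, are bounded
(the field itself may grow linearly). -/
structure IsAdmissibleField {d : ℕ} (F : Rd d → Rd d) : Prop where
  smooth : ContDiff ℝ ∞ F
  bounded : ∀ n : ℕ, 1 ≤ n → ∃ M : ℝ, ∀ x : Rd d, ‖iteratedFDeriv ℝ n F x‖ ≤ M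

/-- The perturbed symbol `(x, ξ) ↦ a (x + F (δ x), ξ)`. -/
def perturbedSymbol {d : ℕ} (a : Rd d × Rd d → ℝ) (F : Rd d → Rd d) (δ : ℝ) :
    Rd d × Rd d → ℝ :=
  fun p => a (p.1 + F (δ • p.1), p.2)

/-- The Weyl form
`(2π)^{-d} ∫ dξ ∫∫ dx' dx e^{i ξ·(x - x')} a((x + x')/2, ξ) conj(ψ x) φ(x')`
on Schwartz functions, with `p = (x', x)`. For a symbol of class `S^0_{0,0}` the inner integral
converges absolutely and, as a function of `ξ`, decays rapidly. -/
def weylForm {d : ℕ} (a : Rd d × Rd d → ℝ) (ψ φ : 𝓢(Rd d, ℂ)) : ℂ :=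
  (((2 * Real.pi) ^ d)⁻¹ : ℝ) *
    ∫ ξ : Rd d, ∫ p : Rd d × Rd d,
      Complex.exp (Complex.I * ((inner ℝ ξ (p.2 - p.1) : ℝ) : ℂ)) *
        ((a ((1 / 2 : ℝ) • (p.2 + p.1), ξ) : ℝ) : ℂ) * conj (ψ p.2) * φ p.1

/-- The bounded operator `T` on `L²(ℝ^d)` is the Weyl quantization of `a`: its matrix elements
between Schwartz functions are given by the Weyl form. -/
def IsWeylQuantization {d : ℕ} (a : Rd d × Rd d → ℝ) (T : L2Rd d →L[ℂ] L2Rd d) : Prop :=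
  ∀ ψ φ : 𝓢(Rd d, ℂ), inner ℂ (ψ.toLp 2 volume) (T (φ.toLp 2 volume)) = weylForm a ψ φ

/-- A symbol has at most one bounded Weyl quantization. -/
theorem IsWeylQuantization.unique {d : ℕ} {a : Rd d × Rd d → ℝ} {S T : L2Rd d →L[ℂ] L2Rd d}
    (hS : IsWeylQuantization a S) (hT : IsWeylQuantization a T) : S = T := by
  have hd : DenseRange (fun f : 𝓢(Rd d, ℂ) => (f.toLp 2 volume : L2Rd d)) :=
    SchwartzMap.denseRange_toLpCLM (by simp)
  ext1 f
  refine congrFun (hd.equalizer S.continuous T.continuous ?_) f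
  funext φ
  refine ext_inner_left ℂ fun g => ?_
  refine congrFun (hd.equalizer (g := fun g : L2Rd d => inner ℂ g (S (φ.toLp 2 volume)))
    (h := fun g : L2Rd d => inner ℂ g (T (φ.toLp 2 volume)))
    (by fun_prop) (by fun_prop) ?_) g
  funext ψ
  exact (hS ψ φ).trans (hT ψ φ).symm

open Classical in
/-- `Op^w(a)`: the bounded operator on `L²(ℝ^d)` generated by the Weyl quantization of `a`
(and `0` if the Weyl form of `a` does not come from a bounded operator). -/
def weylOp {d : ℕ} (a : Rd d × Rd d → ℝ) : L2Rd d →L[ℂ] L2Rd d :=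
  if h : ∃ T : L2Rd d →L[ℂ] L2Rd d, IsWeylQuantization a T then h.choose else 0

/-- `Op^w(a)` is equal to every bounded Weyl quantization of `a`. -/
theorem IsWeylQuantization.weylOp_eq {d : ℕ} {a : Rd d × Rd d → ℝ} {T : L2Rd d →L[ℂ] L2Rd d}
    (hT : IsWeylQuantization a T) : weylOp a = T := by
  have h : ∃ T : L2Rd d →L[ℂ] L2Rd d, IsWeylQuantization a T := ⟨T, hT⟩
  rw [weylOp, dif_pos h]
  exact h.choose_spec.unique hT

/-- `K_δ = Op^w(a(x + F(δ x), ξ))`. -/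
def perturbedOp {d : ℕ} (a : Rd d × Rd d → ℝ) (F : Rd d → Rd d) (δ : ℝ) :
    L2Rd d →L[ℂ] L2Rd d :=
  weylOp (perturbedSymbol a F δ)

end

open scoped FourierTransform ENNReal

noncomputable section

/-! On a ball of radius `1/s` around `y`, the slowly varying displacement `F(δx)` differs from the
constant `F(δy)` by at most a multiple of `|δ|/s`. There `K_δ` is therefore close to a translate of
`K_0`, hence to an operator unitarily equivalent to `K_0`. Cutting off at scale `1/s` costs a
commutator of order `s`. The two errors balance at `s = √|δ|`, which is where the square root comes
from.

Both spectral inclusions follow from transferring lower bounds `r‖f‖ ≤ ‖(K - z)f‖`. If every local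
model has such a bound with `r` at least a large multiple of `s`, apply it to `χ_y ψ` for a cutoff
`χ_y` centred at `y`, write `(S_y - z)χ_y ψ = χ_y(T - z)ψ + [T, χ_y]ψ + (S_y - T)χ_y ψ`, square and
integrate over all centres `y`. Every term acquires the same factor `s^{-d}`, which cancels, and the
errors, of size `s²‖ψ‖²`, are absorbed on the left (`exists_cutoff_lower_bound`,
`exists_lower_bound_of_local`). In one direction the model at `y` is `K_0` translated by `F(δy) -
F(0)`. In the other it is `K_δ` translated by `-v`, where `v` solves the fixed point equation of
`exists_translation`, so that its symbol agrees with that of `K_0` at `x = y`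
(`exists_lower_bound_stability`). For self-adjoint operators, lower bounds and distance to the
spectrum are equivalent, which gives `exists_spectrum_stability`.

The estimates on Weyl forms all come from one representation. The symbol is localised by Gaussians
around the points of phase space and each piece is expanded by Fourier inversion. The Gaussian
integrals then factor the form into windowed Fourier transforms of the two functions
(`integral_weylInner_eq`). Smoothness makes the coefficients decay rapidly in the dual variable `ζ`,
and Plancherel bounds the rest (`exists_lintegral_osc_mul_le`). Because the two functions in that
estimate may depend on the window centre, it yields the Calderón–Vaillancourt bound, its weighted
version `exists_enorm_weylForm_le`, and the commutator bound `exists_enorm_weylForm_commutator_le`.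
-/

theorem one_add_pow_mul_exp_neg_sq_le {c : ℝ} (hc : 0 < c) (N : ℕ) {r : ℝ} (hr : 0 ≤ r) :
    (1 + r) ^ N * Real.exp (-c * r ^ 2) ≤ 2 ^ N * (N.factorial * c⁻¹ ^ N * Real.exp c) := by
  have h1 : (1 + r) ^ N ≤ 2 ^ N * (1 + r ^ 2) ^ N := by
    rw [← mul_pow]
    exact pow_le_pow_left₀ (by positivity) (by nlinarith [sq_nonneg (r - 1)]) N
  have h2 : (1 + r ^ 2) ^ N ≤ N.factorial * c⁻¹ ^ N * Real.exp (c * (1 + r ^ 2)) := by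
    have h := Real.pow_div_factorial_le_exp (c * (1 + r ^ 2)) (by positivity) N
    rw [div_le_iff₀ (by positivity), mul_pow] at h
    calc (1 + r ^ 2) ^ N = c⁻¹ ^ N * (c ^ N * (1 + r ^ 2) ^ N) := by
          rw [← mul_assoc, ← mul_pow, inv_mul_cancel₀ hc.ne', one_pow, one_mul]
      _ ≤ c⁻¹ ^ N * (Real.exp (c * (1 + r ^ 2)) * N.factorial) := by gcongr
      _ = _ := by ring
  calc (1 + r) ^ N * Real.exp (-c * r ^ 2)
      ≤ 2 ^ N * (N.factorial * c⁻¹ ^ N * Real.exp (c * (1 + r ^ 2))) * Real.exp (-c * r ^ 2) := by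
        gcongr
        exact h1.trans (by gcongr)
    _ = 2 ^ N * (N.factorial * c⁻¹ ^ N * Real.exp c) := by
        have : Real.exp c = Real.exp (c * (1 + r ^ 2)) * Real.exp (-c * r ^ 2) := by
          rw [← Real.exp_add]; ring_nf
        rw [this]; ring

/-! ### Gaussians as Schwartz functions. -/

section Gaussian

variable {W : Type*} [NormedAddCommGroup W] [InnerProductSpace ℝ W]

theorem norm_iteratedFDeriv_exp_neg_mul (c : ℝ) (n : ℕ) (t : ℝ) :
    ‖iteratedFDeriv ℝ n (fun t : ℝ => Real.exp (-c * t)) t‖ = |c| ^ n * Real.exp (-c * t) := by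
  rw [norm_iteratedFDeriv_eq_norm_iteratedDeriv, iteratedDeriv_exp_const_mul]
  simp

/-- Faà di Bruno for `exp ∘ ‖·‖²`: derivatives of the exponential reproduce the Gaussian, and those
of `‖·‖²` grow polynomially. The base `(1 + C)(1 + ‖x‖)^k` is at least 1, so it is bounded by each
of its positive powers, as the composition bound requires. -/
theorem exists_norm_iteratedFDeriv_gaussian_le {c : ℝ} (hc : 0 < c) (n : ℕ) :
    ∃ (k : ℕ) (C : ℝ), 0 ≤ C ∧ ∀ x : W, ‖iteratedFDeriv ℝ n (fun x : W => Real.exp (-c * ‖x‖ ^ 2)) x‖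
      ≤ C * (1 + ‖x‖) ^ k * Real.exp (-c * ‖x‖ ^ 2) := by
  obtain ⟨k, C, hC, h⟩ :=
    (Function.hasTemperateGrowth_norm_sq W).norm_iteratedFDeriv_le_uniform n
  refine ⟨k * n, n.factorial * (1 + c) ^ n * (1 + C) ^ n, by positivity, fun x => ?_⟩
  have hx : 1 ≤ (1 + C) * (1 + ‖x‖) ^ k :=
    one_le_mul_of_one_le_of_one_le (by linarith) (one_le_pow₀ (by linarith [norm_nonneg x]))
  have := norm_iteratedFDeriv_comp_le (𝕜 := ℝ) (g := fun t : ℝ => Real.exp (-c * t))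
    (f := fun x : W => ‖x‖ ^ 2) (n := n) (N := ∞) (by fun_prop) (contDiff_norm_sq ℝ)
    (by exact_mod_cast le_top) x (C := (1 + c) ^ n * Real.exp (-c * ‖x‖ ^ 2))
    (D := (1 + C) * (1 + ‖x‖) ^ k) (fun i hi => ?_) (fun i h1 hi => ?_)
  · refine this.trans (le_of_eq ?_)
    rw [mul_pow, ← pow_mul]; ring
  · rw [norm_iteratedFDeriv_exp_neg_mul]
    gcongr
    rw [abs_of_pos hc]
    calc c ^ i ≤ (1 + c) ^ i := pow_le_pow_left₀ hc.le (by linarith) i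
      _ ≤ _ := pow_le_pow_right₀ (by linarith) hi
  · calc _ ≤ C * (1 + ‖x‖) ^ k := h i hi x
      _ ≤ (1 + C) * (1 + ‖x‖) ^ k := by gcongr; linarith
      _ ≤ _ := le_self_pow₀ hx (by omega)

/-- The Gaussian `exp (-c ‖x‖²)` as a Schwartz function. -/
def gaussianSchwartz (c : ℝ) (hc : 0 < c) : 𝓢(W, ℝ) where
  toFun x := Real.exp (-c * ‖x‖ ^ 2)
  smooth' := by
    have := contDiff_norm_sq ℝ (E := W) (n := ∞)
    fun_prop
  decay' k n := by
    obtain ⟨m, C, hC, h⟩ := exists_norm_iteratedFDeriv_gaussian_le (W := W) hc n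
    refine ⟨C * (2 ^ (k + m) * ((k + m).factorial * c⁻¹ ^ (k + m) * Real.exp c)), fun x => ?_⟩
    calc _ ≤ (1 + ‖x‖) ^ k * (C * (1 + ‖x‖) ^ m * Real.exp (-c * ‖x‖ ^ 2)) := by
          gcongr
          · linarith
          · exact h x
      _ = C * ((1 + ‖x‖) ^ (k + m) * Real.exp (-c * ‖x‖ ^ 2)) := by rw [pow_add]; ring
      _ ≤ _ := by
          exact mul_le_mul_of_nonneg_left
            (one_add_pow_mul_exp_neg_sq_le hc _ (norm_nonneg x)) hC

@[simp] theorem gaussianSchwartz_apply (c : ℝ) (hc : 0 < c) (x : W) :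
    gaussianSchwartz c hc x = Real.exp (-c * ‖x‖ ^ 2) := rfl

end Gaussian

/-- The phase space `ℝ^d × ℝ^d` with its Euclidean structure. -/
abbrev Phase (d : ℕ) : Type := WithLp 2 (Rd d × Rd d)

/-- The localisation of the symbol `a` by a Gaussian around the point `w` of phase space,
translated to the origin. -/
def localSymbol {d : ℕ} (a : Rd d × Rd d → ℝ) (w : Rd d × Rd d) (v : Phase d) : ℂ :=
  ((a (v.fst + w.1, v.snd + w.2) * Real.exp (-1 * ‖v‖ ^ 2) : ℝ) : ℂ)

/-- The linear weight `1 + s ‖x - c‖`. -/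
def weight {d : ℕ} (s : ℝ) (c x : Rd d) : ℝ := 1 + s * ‖x - c‖

theorem weight_pos {d : ℕ} {s : ℝ} (hs : 0 ≤ s) (c x : Rd d) : 0 < weight s c x := by
  unfold weight; positivity

theorem one_le_weight {d : ℕ} {s : ℝ} (hs : 0 ≤ s) (c x : Rd d) : 1 ≤ weight s c x := by
  unfold weight; nlinarith [norm_nonneg (x - c)]

/-- Slow variation of the weight, uniform in `s ≤ 1`. It allows the weight to be frozen at a window
centre; the polynomial loss in `x - y` is absorbed by Gaussians. -/
theorem weight_le_mul {d : ℕ} {s : ℝ} (hs : 0 ≤ s) (hs1 : s ≤ 1) (c x y : Rd d) :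
    weight s c x ≤ weight s c y * (1 + ‖x - y‖) := by
  have h1 : ‖x - c‖ ≤ ‖x - y‖ + ‖y - c‖ := norm_sub_le_norm_sub_add_norm_sub x y c
  unfold weight
  have := norm_nonneg (x - y)
  have := norm_nonneg (y - c)
  have h2 : s * ‖x - c‖ ≤ s * ‖x - y‖ + s * ‖y - c‖ := by nlinarith
  have h3 : s * ‖x - y‖ ≤ ‖x - y‖ := by nlinarith
  have h4 : 0 ≤ s * ‖y - c‖ * ‖x - y‖ := by positivity
  nlinarith

/-- The derivatives of `a` up to the order `L` are bounded by `B (1 + s ‖x - c‖)`. -/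
def SymbolBound {d : ℕ} (a : Rd d × Rd d → ℝ) (L : ℕ) (B s : ℝ) (c : Rd d) : Prop :=
  ∀ j ≤ L, ∀ p : Rd d × Rd d, ‖iteratedFDeriv ℝ j a p‖ ≤ B * weight s c p.1

/-! ### Decay of the local Fourier coefficients of a symbol. -/

section LocalSymbol

variable {d : ℕ}

theorem contDiff_localSymbol {a : Rd d × Rd d → ℝ} (ha : ContDiff ℝ ∞ a) (w : Rd d × Rd d) :
    ContDiff ℝ ∞ (localSymbol a w) := by
  unfold localSymbol
  have h0 := (gaussianSchwartz (W := Phase d) 1 one_pos).smooth'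
  have h1 : ContDiff ℝ ∞ (fun v : Phase d => a (v.fst + w.1, v.snd + w.2)) := by
    have : ContDiff ℝ ∞ (fun v : Phase d => WithLp.ofLp v + w) :=
      (WithLp.prodContinuousLinearEquiv 2 ℝ (Rd d) (Rd d)).contDiff.add contDiff_const
    exact ha.comp this
  exact Complex.ofRealCLM.contDiff.comp (h1.mul h0)

/-- The operator norm of the identification appears because derivatives of `a` are measured in the
sup norm of the product and those on `Phase d` in the Euclidean norm. -/
theorem norm_iteratedFDeriv_shift_le {a : Rd d × Rd d → ℝ} (ha : ContDiff ℝ ∞ a)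
    (w : Rd d × Rd d) (j : ℕ) (v : Phase d) :
    ‖iteratedFDeriv ℝ j (fun v : Phase d => a (v.fst + w.1, v.snd + w.2)) v‖ ≤
      ‖((WithLp.prodContinuousLinearEquiv 2 ℝ (Rd d) (Rd d)) : Phase d →L[ℝ] Rd d × Rd d)‖ ^ j *
        ‖iteratedFDeriv ℝ j a (v.fst + w.1, v.snd + w.2)‖ := by
  set e := ((WithLp.prodContinuousLinearEquiv 2 ℝ (Rd d) (Rd d)) : Phase d →L[ℝ] Rd d × Rd d)
  have h1 : (fun v : Phase d => a (v.fst + w.1, v.snd + w.2)) = (fun p => a (p + w)) ∘ e := rfl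
  have hc : ContDiff ℝ ∞ (fun p => a (p + w)) := ha.comp (contDiff_id.add contDiff_const)
  rw [h1, e.iteratedFDeriv_comp_right hc v (i := j) (by exact_mod_cast le_top),
    iteratedFDeriv_comp_add_right]
  refine (ContinuousMultilinearMap.norm_compContinuousLinearMap_le _ _).trans ?_
  rw [Finset.prod_const, Finset.card_univ, Fintype.card_fin, mul_comm]
  rfl

/-- Integrable bounds for the derivatives of Gaussian localisations. -/
theorem exists_norm_iteratedFDeriv_localSymbol_le (d L : ℕ) :
    ∃ D : Phase d → ℝ, Integrable D ∧ ∀ (a : Rd d × Rd d → ℝ), ContDiff ℝ ∞ a →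
      ∀ (B s : ℝ) (c : Rd d), 0 ≤ s → s ≤ 1 → SymbolBound a L B s c →
      ∀ j ≤ L, ∀ (w : Rd d × Rd d) (v : Phase d),
        ‖iteratedFDeriv ℝ j (localSymbol a w) v‖ ≤ B * weight s c w.1 * D v := by
  set e := ((WithLp.prodContinuousLinearEquiv 2 ℝ (Rd d) (Rd d)) : Phase d →L[ℝ] Rd d × Rd d)
  set G : 𝓢(Phase d, ℝ) := gaussianSchwartz 1 one_pos
  -- These are the Leibniz bounds summed over all orders. The second summand, with `‖v‖ ^ 1`, pays
  -- for replacing the weight at `v + w` by the weight at `w`.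
  refine ⟨fun v => ∑ j ∈ Finset.range (L + 1), ∑ i ∈ Finset.range (j + 1),
    (j.choose i : ℝ) * ‖e‖ ^ i *
      (‖iteratedFDeriv ℝ (j - i) G v‖ + ‖v‖ ^ 1 * ‖iteratedFDeriv ℝ (j - i) G v‖), ?_, ?_⟩
  · refine integrable_finsetSum _ fun j _ => integrable_finsetSum _ fun i _ => ?_
    refine Integrable.const_mul (Integrable.add ?_ ?_) _
    · simpa using G.integrable_pow_mul_iteratedFDeriv volume 0 (j - i)
    · exact G.integrable_pow_mul_iteratedFDeriv volume 1 (j - i)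
  · intro a ha B s c hs hs1 hB j hj w v
    have h1 : ContDiff ℝ ∞ (fun v : Phase d => a (v.fst + w.1, v.snd + w.2)) :=
      ha.comp ((WithLp.prodContinuousLinearEquiv 2 ℝ (Rd d) (Rd d)).contDiff.add contDiff_const)
    have hB0 : 0 ≤ B * weight s c w.1 := (norm_nonneg _).trans (hB 0 (Nat.zero_le _) w)
    have hBB : 0 ≤ B := nonneg_of_mul_nonneg_left hB0 (weight_pos hs _ _)
    have h2 : ‖iteratedFDeriv ℝ j (localSymbol a w) v‖ ≤ ‖iteratedFDeriv ℝ j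
        (fun v : Phase d => a (v.fst + w.1, v.snd + w.2) * G v) v‖ := by
      have := Complex.ofRealCLM.norm_iteratedFDeriv_comp_left (n := j)
        (f := fun v : Phase d => a (v.fst + w.1, v.snd + w.2) * G v) (x := v)
        ((h1.mul G.smooth').contDiffAt) (by exact_mod_cast le_top)
      rw [Complex.ofRealCLM_norm, one_mul] at this
      exact this
    refine h2.trans ((norm_iteratedFDeriv_mul_le h1 G.smooth' v
      (by exact_mod_cast le_top)).trans ?_)
    rw [Finset.mul_sum]
    refine le_trans ?_ (Finset.single_le_sum (f := fun j => B * weight s c w.1 *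
      ∑ i ∈ Finset.range (j + 1), (j.choose i : ℝ) * ‖e‖ ^ i *
      (‖iteratedFDeriv ℝ (j - i) G v‖ + ‖v‖ ^ 1 * ‖iteratedFDeriv ℝ (j - i) G v‖))
      (fun i _ => by positivity) (Finset.mem_range.2 (Nat.lt_succ_of_le hj)))
    rw [Finset.mul_sum]
    refine Finset.sum_le_sum fun i hi => ?_
    have hi' : i ≤ L := by have := Finset.mem_range.1 hi; omega
    have h3 := norm_iteratedFDeriv_shift_le ha w i v
    have h4 : ‖iteratedFDeriv ℝ i a (v.fst + w.1, v.snd + w.2)‖ ≤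
        B * weight s c w.1 * (1 + ‖v‖) := by
      refine (hB i hi' _).trans ?_
      rw [mul_assoc]
      gcongr
      refine (weight_le_mul hs hs1 c _ w.1).trans ?_
      have : ‖v.fst + w.1 - w.1‖ ≤ ‖v‖ := by
        rw [add_sub_cancel_right]; exact WithLp.norm_fst_le _ v
      gcongr
      exact (weight_pos hs _ _).le
    calc (j.choose i : ℝ) * ‖iteratedFDeriv ℝ i (fun v : Phase d =>
            a (v.fst + w.1, v.snd + w.2)) v‖ * ‖iteratedFDeriv ℝ (j - i) G v‖
        ≤ (j.choose i : ℝ) * (‖e‖ ^ i * (B * weight s c w.1 * (1 + ‖v‖))) *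
          ‖iteratedFDeriv ℝ (j - i) G v‖ := by
          gcongr
          exact h3.trans (by gcongr)
      _ = _ := by ring

/-- Decay of the Fourier transform of a function with integrable derivatives. -/
theorem one_add_pow_mul_norm_fourier_le {W : Type*} [NormedAddCommGroup W] [InnerProductSpace ℝ W]
    [FiniteDimensional ℝ W] [MeasurableSpace W] [BorelSpace W] {f : W → ℂ} (hf : ContDiff ℝ ∞ f)
    {L : ℕ} (hint : ∀ j ≤ L, Integrable (fun v => ‖iteratedFDeriv ℝ j f v‖)) (ζ : W) :
    (1 + ‖ζ‖) ^ L * ‖𝓕 f ζ‖ ≤ 2 ^ L * (2 * (2 ^ L *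
      ∑ j ∈ Finset.range (L + 1), ∫ v, ‖iteratedFDeriv ℝ j f v‖)) := by
  set S := ∑ j ∈ Finset.range (L + 1), ∫ v, ‖iteratedFDeriv ℝ j f v‖
  have key : ∀ n ≤ L, ‖ζ‖ ^ n * ‖𝓕 f ζ‖ ≤ 2 ^ L * S := by
    intro n hn
    have := Real.pow_mul_norm_iteratedFDeriv_fourier_le (f := f) (K := 0) (N := L)
      (hf.of_le (by exact_mod_cast le_top)) (fun k n hk hn => by
        have hk0 : k = 0 := by exact_mod_cast nonpos_iff_eq_zero.1 hk
        subst hk0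
        simpa using hint n (by exact_mod_cast hn)) (k := 0) (n := n) le_rfl
        (by exact_mod_cast hn) ζ
    simp only [norm_iteratedFDeriv_zero, pow_zero, one_mul, Nat.cast_zero, mul_zero, zero_add,
      Finset.sum_product, Finset.range_one, Finset.sum_singleton] at this
    refine this.trans (mul_le_mul (pow_le_pow_right₀ one_le_two hn) ?_
      (Finset.sum_nonneg fun j _ => integral_nonneg fun v => norm_nonneg _) (by positivity))
    exact Finset.sum_le_sum_of_subset_of_nonneg (Finset.range_mono (by omega))
      fun j _ _ => integral_nonneg fun v => norm_nonneg _
  have h0 := key 0 (Nat.zero_le _)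
  have hL := key L le_rfl
  have hpow : (1 + ‖ζ‖) ^ L ≤ 2 ^ L * (1 + ‖ζ‖ ^ L) := by
    rcases le_total ‖ζ‖ 1 with h1 | h1
    · calc (1 + ‖ζ‖) ^ L ≤ (2 : ℝ) ^ L := by gcongr; linarith
        _ ≤ _ := le_mul_of_one_le_right (by positivity) (by linarith [pow_nonneg (norm_nonneg ζ) L])
    · calc (1 + ‖ζ‖) ^ L ≤ (2 * ‖ζ‖) ^ L := by gcongr; linarith
        _ ≤ _ := by rw [mul_pow]; gcongr; linarith
  rw [pow_zero, one_mul] at h0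
  calc (1 + ‖ζ‖) ^ L * ‖𝓕 f ζ‖
      ≤ 2 ^ L * (1 + ‖ζ‖ ^ L) * ‖𝓕 f ζ‖ := by gcongr
    _ = 2 ^ L * (‖𝓕 f ζ‖ + ‖ζ‖ ^ L * ‖𝓕 f ζ‖) := by ring
    _ ≤ 2 ^ L * (2 ^ L * S + 2 ^ L * S) := by gcongr
    _ = _ := by ring

/-- Rapid decay of the local Fourier coefficients of a symbol. -/
theorem exists_norm_fourier_localSymbol_le (d L : ℕ) :
    ∃ C : ℝ, 0 ≤ C ∧ ∀ (a : Rd d × Rd d → ℝ), ContDiff ℝ ∞ a →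
      ∀ (B s : ℝ) (c : Rd d), 0 ≤ s → s ≤ 1 → SymbolBound a L B s c →
      ∀ (w : Rd d × Rd d) (ζ : Phase d),
        (1 + ‖ζ‖) ^ L * ‖𝓕 (localSymbol a w) ζ‖ ≤ C * (B * weight s c w.1) := by
  obtain ⟨D, hD, h⟩ := exists_norm_iteratedFDeriv_localSymbol_le d L
  refine ⟨2 ^ L * (2 * (2 ^ L * ((L + 1) * |∫ v, D v|))), by positivity, ?_⟩
  intro a ha B s c hs hs1 hB w ζ
  have hB0 : 0 ≤ B * weight s c w.1 := (norm_nonneg _).trans (hB 0 (Nat.zero_le _) w)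
  have hint : ∀ j ≤ L, Integrable (fun v => ‖iteratedFDeriv ℝ j (localSymbol a w) v‖) := by
    intro j hj
    refine (hD.const_mul (B * weight s c w.1)).mono' ?_ (Filter.Eventually.of_forall fun v => ?_)
    · exact ((contDiff_localSymbol ha w).continuous_iteratedFDeriv
        (m := j) (by exact_mod_cast le_top)).norm.aestronglyMeasurable
    · rw [norm_norm]; exact h a ha B s c hs hs1 hB j hj w v
  have hle : ∀ j ≤ L, ∫ v, ‖iteratedFDeriv ℝ j (localSymbol a w) v‖ ≤
      B * weight s c w.1 * |∫ v, D v| := by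
    intro j hj
    refine (integral_mono (hint j hj) (hD.const_mul (B * weight s c w.1))
      (fun v => h a ha B s c hs hs1 hB j hj w v)).trans ?_
    rw [integral_const_mul]
    gcongr
    exact le_abs_self _
  refine (one_add_pow_mul_norm_fourier_le (contDiff_localSymbol ha w) hint ζ).trans ?_
  calc _ ≤ 2 ^ L * (2 * (2 ^ L *
        ∑ j ∈ Finset.range (L + 1), B * weight s c w.1 * |∫ v, D v|)) := by
        gcongr with j hj
        exact hle j (by have := Finset.mem_range.1 hj; omega)
    _ = _ := by
        rw [Finset.sum_const, Finset.card_range, nsmul_eq_mul]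
        push_cast
        ring

end LocalSymbol

/-! ### Windowed Fourier transforms and the bilinear estimate. -/

section Osc

variable {d : ℕ}

/-- The oscillatory integral `∫ exp(i ⟨η, x⟩) f x dx`. -/
def osc (f : Rd d → ℂ) (η : Rd d) : ℂ :=
  ∫ x : Rd d, Complex.exp (Complex.I * ((inner ℝ η x : ℝ) : ℂ)) * f x

theorem norm_cexp_I_mul_ofReal (t : ℝ) : ‖Complex.exp (Complex.I * (t : ℂ))‖ = 1 := by
  rw [mul_comm]; exact Complex.norm_exp_ofReal_mul_I t

theorem osc_eq_fourier (f : Rd d → ℂ) (η : Rd d) :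
    osc f η = 𝓕 f (-(2 * Real.pi)⁻¹ • η) := by
  rw [Real.fourier_eq']
  unfold osc
  congr 1
  ext x
  rw [smul_eq_mul, inner_smul_right, real_inner_comm]
  congr 2
  push_cast
  have : (Real.pi : ℂ) ≠ 0 := by exact_mod_cast Real.pi_ne_zero
  field_simp

/-- Plancherel. The constant is the Jacobian of `η ↦ -η/(2π)`, which relates `osc` to the
normalisation of `𝓕`. -/
theorem lintegral_osc_sq (f : 𝓢(Rd d, ℂ)) :
    ∫⁻ η, ‖osc f η‖ₑ ^ 2 = ENNReal.ofReal ((2 * Real.pi) ^ d) * ∫⁻ x, ‖f x‖ₑ ^ 2 := by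
  have key : ∀ g : 𝓢(Rd d, ℂ), ∫⁻ x, ‖g x‖ₑ ^ 2 = ENNReal.ofReal (∫ x, ‖g x‖ ^ 2) := by
    intro g
    rw [ofReal_integral_eq_lintegral_ofReal]
    · refine lintegral_congr fun x => ?_
      rw [ENNReal.ofReal_pow (norm_nonneg _), ofReal_norm]
    · exact (g.memLp 2 volume).integrable_norm_pow two_ne_zero
    · exact Filter.Eventually.of_forall fun x => by positivity
  have h1 : ∀ η, osc f η = (𝓕 f) (-(2 * Real.pi)⁻¹ • η) := fun η => by
    rw [osc_eq_fourier, SchwartzMap.fourier_coe]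
  simp_rw [h1]
  have h2 : ∫⁻ η : Rd d, ‖(𝓕 f) (-(2 * Real.pi)⁻¹ • η)‖ₑ ^ 2 =
      ENNReal.ofReal (∫ η : Rd d, ‖(𝓕 f) (-(2 * Real.pi)⁻¹ • η)‖ ^ 2) := by
    rw [ofReal_integral_eq_lintegral_ofReal]
    · refine lintegral_congr fun x => ?_
      rw [ENNReal.ofReal_pow (norm_nonneg _), ofReal_norm]
    · exact (((𝓕 f).memLp 2 volume).integrable_norm_pow two_ne_zero).comp_smul
        (R := -(2 * Real.pi)⁻¹) (by simp [Real.pi_ne_zero])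
    · exact Filter.Eventually.of_forall fun x => by positivity
  have h3 := Measure.integral_comp_smul volume (fun x => ‖(𝓕 f) x‖ ^ 2) (-(2 * Real.pi)⁻¹)
  rw [h2, h3, SchwartzMap.integral_norm_sq_fourier, key f, smul_eq_mul, ENNReal.ofReal_mul (by positivity)]
  congr 2
  rw [finrank_euclideanSpace_fin, neg_pow, inv_pow, mul_inv, inv_inv, abs_mul, abs_inv]
  simp [abs_of_pos Real.pi_pos]

/-- The Gaussian window centred at `z`. -/
def window (z x : Rd d) : ℝ := Real.exp (-(1 / 2) * ‖x - z‖ ^ 2)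

theorem window_hasTemperateGrowth (z : Rd d) :
    (fun x : Rd d => ((window z x : ℝ) : ℂ)).HasTemperateGrowth := by
  have h := (SchwartzMap.compSubConstCLM ℝ z
    (gaussianSchwartz (W := Rd d) (1 / 2) (by norm_num))).hasTemperateGrowth
  have := Function.HasTemperateGrowth.comp Function.Complex.hasTemperateGrowth_ofReal h
  refine cast (congrArg _ (funext fun x => ?_)) this
  simp [window]

/-- The product of a Schwartz function with the Gaussian window centred at `z`. -/
def windowed (z : Rd d) (f : 𝓢(Rd d, ℂ)) : 𝓢(Rd d, ℂ) :=
  SchwartzMap.smulLeftCLM ℂ (fun x : Rd d => ((window z x : ℝ) : ℂ)) f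

@[simp] theorem windowed_apply (z : Rd d) (f : 𝓢(Rd d, ℂ)) (x : Rd d) :
    windowed z f x = window z x * f x := by
  rw [windowed, SchwartzMap.smulLeftCLM_apply_apply (window_hasTemperateGrowth z), smul_eq_mul]

theorem continuous_window : Continuous (fun p : Rd d × Rd d => window p.1 p.2) := by
  unfold window; fun_prop

/-- The Schwartz function may vary with the parameter, because weights and cutoffs will be frozen at
the window centre and attached to it. -/
theorem measurable_osc_windowed {T : Type*} [TopologicalSpace T] [MeasurableSpace T]
    [BorelSpace T] [SecondCountableTopology T]
    (P : Rd d → 𝓢(Rd d, ℂ)) (hP : Continuous fun p : Rd d × Rd d => P p.1 p.2)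
    {ζ y η : T → Rd d} (hζ : Continuous ζ) (hy : Continuous y) (hη : Continuous η) :
    StronglyMeasurable fun τ => osc (windowed (y τ) (P (ζ τ))) (η τ) := by
  have h1 : Continuous fun p : T × Rd d => P (ζ p.1) p.2 :=
    Continuous.comp (g := fun p : Rd d × Rd d => P p.1 p.2)
      (f := fun p : T × Rd d => (ζ p.1, p.2)) hP (by fun_prop)
  have h2 : Continuous fun p : T × Rd d => window (y p.1) p.2 :=
    Continuous.comp (g := fun p : Rd d × Rd d => window p.1 p.2)
      (f := fun p : T × Rd d => (y p.1, p.2)) continuous_window (by fun_prop)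
  have h3 : Continuous fun p : T × Rd d => (inner ℝ (η p.1) p.2 : ℝ) :=
    (hη.comp continuous_fst).inner continuous_snd
  have h4 : Continuous fun p : T × Rd d => Complex.exp (Complex.I * ((inner ℝ (η p.1) p.2 : ℝ) : ℂ)) *
      ((window (y p.1) p.2 : ℂ) * P (ζ p.1) p.2) := by fun_prop
  have h5 := h4.stronglyMeasurable.integral_prod_right' (ν := (volume : Measure (Rd d)))
  simpa only [osc, windowed_apply] using h5

/-- The moments of the Gaussian. -/
def gaussMoment (d K : ℕ) : ℝ≥0∞ :=
  ∫⁻ y : Rd d, ENNReal.ofReal ((1 + ‖y‖) ^ (2 * K) * Real.exp (-1 * ‖y‖ ^ 2))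

theorem gaussMoment_ne_top (d K : ℕ) : gaussMoment d K ≠ ⊤ := by
  set c := (2 : ℝ) ^ (2 * K) * ((2 * K).factorial * (1 / 2 : ℝ)⁻¹ ^ (2 * K) * Real.exp (1 / 2))
  have hg : Integrable (fun y : Rd d => c * Real.exp (-(1 / 2) * ‖y‖ ^ 2)) :=
    ((gaussianSchwartz (W := Rd d) (1 / 2) (by norm_num)).integrable).const_mul c
  refine ne_top_of_le_ne_top hg.lintegral_lt_top.ne (lintegral_mono fun y => ?_)
  refine ENNReal.ofReal_le_ofReal ?_
  have h := one_add_pow_mul_exp_neg_sq_le (c := 1 / 2) (by norm_num) (2 * K) (norm_nonneg y)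
  calc (1 + ‖y‖) ^ (2 * K) * Real.exp (-1 * ‖y‖ ^ 2)
      = (1 + ‖y‖) ^ (2 * K) * Real.exp (-(1 / 2) * ‖y‖ ^ 2) * Real.exp (-(1 / 2) * ‖y‖ ^ 2) := by
        rw [mul_assoc, ← Real.exp_add]; ring_nf
    _ ≤ _ := by gcongr

/-- The growth is centred at `z` but the window at `z + q`; recentring by `1 + ‖x - z‖ ≤ (1 + ‖q‖)(1
+ ‖x - q - z‖)` gives the factor in `q`. -/
theorem lintegral_window_moment_le (K : ℕ) (q x : Rd d) :
    ∫⁻ z, (ENNReal.ofReal ((1 + ‖x - z‖) ^ K) * ENNReal.ofReal (window (z + q) x)) ^ 2 ≤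
      ENNReal.ofReal ((1 + ‖q‖) ^ (2 * K)) * gaussMoment d K := by
  have h : ∀ z, (ENNReal.ofReal ((1 + ‖x - z‖) ^ K) * ENNReal.ofReal (window (z + q) x)) ^ 2 ≤
      ENNReal.ofReal ((1 + ‖q‖) ^ (2 * K)) * ENNReal.ofReal ((1 + ‖(x - q) - z‖) ^ (2 * K) *
        Real.exp (-1 * ‖(x - q) - z‖ ^ 2)) := by
    intro z
    rw [← ENNReal.ofReal_mul (by positivity), ← ENNReal.ofReal_pow (by unfold window; positivity),
      ← ENNReal.ofReal_mul (by positivity)]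
    refine ENNReal.ofReal_le_ofReal ?_
    have h1 : 1 + ‖x - z‖ ≤ (1 + ‖q‖) * (1 + ‖(x - q) - z‖) := by
      have : ‖x - z‖ ≤ ‖q‖ + ‖(x - q) - z‖ := by
        have := norm_add_le q ((x - q) - z)
        rwa [show q + ((x - q) - z) = x - z by abel] at this
      nlinarith [mul_nonneg (norm_nonneg q) (norm_nonneg ((x - q) - z))]
    have h2 : window (z + q) x ^ 2 = Real.exp (-1 * ‖(x - q) - z‖ ^ 2) := by
      unfold window
      rw [← Real.exp_nat_mul, show x - (z + q) = (x - q) - z by abel]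
      congr 1; push_cast; ring
    rw [mul_pow, h2, ← mul_assoc, ← mul_pow, ← pow_mul, mul_comm K 2]
    gcongr
  refine (lintegral_mono h).trans ?_
  rw [lintegral_const_mul' _ _ ENNReal.ofReal_ne_top]
  gcongr
  rw [lintegral_sub_left_eq_self (fun y : Rd d => ENNReal.ofReal ((1 + ‖y‖) ^ (2 * K) *
        Real.exp (-1 * ‖y‖ ^ 2))) (x - q)]
  rfl

/-- The majorant `u` does not depend on `z`, so by Tonelli the `z`-integral is done first and is
only a Gaussian moment. -/
theorem lintegral_windowed_sq_le (K : ℕ) (P : Rd d → 𝓢(Rd d, ℂ))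
    {u : Rd d → ℝ≥0∞} (hu : Measurable u)
    (hPu : ∀ z x, ‖P z x‖ₑ ≤ ENNReal.ofReal ((1 + ‖x - z‖) ^ K) * u x) (q : Rd d) :
    ∫⁻ z, ∫⁻ x, ‖windowed (z + q) (P z) x‖ₑ ^ 2 ≤
      ENNReal.ofReal ((1 + ‖q‖) ^ (2 * K)) * gaussMoment d K * ∫⁻ x, u x ^ 2 := by
  have h : ∀ z x, ‖windowed (z + q) (P z) x‖ₑ ^ 2 ≤
      (ENNReal.ofReal ((1 + ‖x - z‖) ^ K) * ENNReal.ofReal (window (z + q) x)) ^ 2 * u x ^ 2 := by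
    intro z x
    rw [windowed_apply, enorm_mul, ← mul_pow]
    refine pow_le_pow_left₀ zero_le ?_ 2
    have : ‖((window (z + q) x : ℝ) : ℂ)‖ₑ = ENNReal.ofReal (window (z + q) x) := by
      rw [← ofReal_norm, Complex.norm_real, Real.norm_of_nonneg (by unfold window; positivity)]
    rw [this]
    calc _ ≤ ENNReal.ofReal (window (z + q) x) *
          (ENNReal.ofReal ((1 + ‖x - z‖) ^ K) * u x) := by gcongr; exact hPu z x
      _ = _ := by ring
  calc ∫⁻ z, ∫⁻ x, ‖windowed (z + q) (P z) x‖ₑ ^ 2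
      ≤ ∫⁻ z, ∫⁻ x, (ENNReal.ofReal ((1 + ‖x - z‖) ^ K) *
          ENNReal.ofReal (window (z + q) x)) ^ 2 * u x ^ 2 :=
        lintegral_mono fun z => lintegral_mono fun x => h z x
    _ = ∫⁻ x, ∫⁻ z, (ENNReal.ofReal ((1 + ‖x - z‖) ^ K) *
          ENNReal.ofReal (window (z + q) x)) ^ 2 * u x ^ 2 := by
        refine lintegral_lintegral_swap (Measurable.aemeasurable ?_)
        have h1 : Measurable fun p : Rd d × Rd d => window (p.1 + q) p.2 :=
          (continuous_window.comp ((continuous_fst.add continuous_const).prodMk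
            continuous_snd)).measurable
        have h2 : Measurable fun p : Rd d × Rd d => u p.2 := hu.comp measurable_snd
        simp only [Function.uncurry_def]
        fun_prop
    _ ≤ ∫⁻ x, (ENNReal.ofReal ((1 + ‖q‖) ^ (2 * K)) * gaussMoment d K) * u x ^ 2 := by
        refine lintegral_mono fun x => ?_
        dsimp only
        rw [lintegral_mul_const]
        · gcongr
          exact lintegral_window_moment_le K q x
        · have h1 : Measurable fun z : Rd d => window (z + q) x :=
            (continuous_window.comp ((continuous_id.add continuous_const).prodMk
              continuous_const)).measurable
          fun_prop
    _ = _ := lintegral_const_mul _ (by fun_prop)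

/-- Stands in for Cauchy–Schwarz. Keeping `t` free lets all estimates remain additive in `ℝ≥0∞`,
with the choice of `t` postponed to the end. -/
theorem enorm_mul_le_sq_add_sq (x y : ℂ) {t : ℝ} (ht : 0 < t) :
    ‖x * y‖ₑ ≤ ENNReal.ofReal t * ‖x‖ₑ ^ 2 + ENNReal.ofReal t⁻¹ * ‖y‖ₑ ^ 2 := by
  rw [← ofReal_norm, ← ofReal_norm, ← ofReal_norm,
    ← ENNReal.ofReal_pow (norm_nonneg _), ← ENNReal.ofReal_pow (norm_nonneg _),
    ← ENNReal.ofReal_mul ht.le, ← ENNReal.ofReal_mul (by positivity),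
    ← ENNReal.ofReal_add (by positivity) (by positivity)]
  refine ENNReal.ofReal_le_ofReal ?_
  rw [norm_mul]
  have h1 : t * (‖x‖ - t⁻¹ * ‖y‖) ^ 2 = t * ‖x‖ ^ 2 - 2 * (‖x‖ * ‖y‖) + t⁻¹ * ‖y‖ ^ 2 := by
    field_simp
    ring
  have h2 : 0 ≤ t * (‖x‖ - t⁻¹ * ‖y‖) ^ 2 := by positivity
  nlinarith [mul_nonneg (norm_nonneg x) (norm_nonneg y)]

/-- The left coherent factor at `τ = (η, z, (p, q))`. -/
def oscL (P : Rd d → 𝓢(Rd d, ℂ)) (τ : Rd d × Rd d × Phase d) : ℂ :=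
  osc (windowed (τ.2.1 + -(Real.pi • τ.2.2.snd)) (P τ.2.1)) (τ.1 + Real.pi • τ.2.2.fst)

/-- The right coherent factor at `τ = (η, z, (p, q))`. -/
def oscR (R : Rd d → 𝓢(Rd d, ℂ)) (τ : Rd d × Rd d × Phase d) : ℂ :=
  osc (windowed (τ.2.1 + Real.pi • τ.2.2.snd) (R τ.2.1)) (Real.pi • τ.2.2.fst - τ.1)

theorem continuous_phase_fst : Continuous fun ζ : Phase d => ζ.fst :=
  (WithLp.prodContinuousLinearEquiv 2 ℝ (Rd d) (Rd d)).continuous.fst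

theorem continuous_phase_snd : Continuous fun ζ : Phase d => ζ.snd :=
  (WithLp.prodContinuousLinearEquiv 2 ℝ (Rd d) (Rd d)).continuous.snd

theorem stronglyMeasurable_oscL (P : Rd d → 𝓢(Rd d, ℂ))
    (hP : Continuous fun p : Rd d × Rd d => P p.1 p.2) : StronglyMeasurable (oscL P) := by
  have h1 : Continuous fun τ : Rd d × Rd d × Phase d => τ.2.2.snd :=
    continuous_phase_snd.comp (continuous_snd.comp continuous_snd)
  have h2 : Continuous fun τ : Rd d × Rd d × Phase d => τ.2.2.fst :=
    continuous_phase_fst.comp (continuous_snd.comp continuous_snd)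
  exact measurable_osc_windowed P hP (by fun_prop) (by fun_prop) (by fun_prop)

theorem stronglyMeasurable_oscR (P : Rd d → 𝓢(Rd d, ℂ))
    (hP : Continuous fun p : Rd d × Rd d => P p.1 p.2) : StronglyMeasurable (oscR P) := by
  have h1 : Continuous fun τ : Rd d × Rd d × Phase d => τ.2.2.snd :=
    continuous_phase_snd.comp (continuous_snd.comp continuous_snd)
  have h2 : Continuous fun τ : Rd d × Rd d × Phase d => τ.2.2.fst :=
    continuous_phase_fst.comp (continuous_snd.comp continuous_snd)
  exact measurable_osc_windowed P hP (by fun_prop) (by fun_prop) (by fun_prop)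

theorem ofReal_one_add_pi_mul_pow_le (K : ℕ) (ζ : Phase d) {q : Rd d}
    (hq : ‖q‖ = Real.pi * ‖ζ.snd‖) :
    ENNReal.ofReal ((1 + ‖q‖) ^ (2 * K)) ≤ ENNReal.ofReal (4 ^ (2 * K) * (1 + ‖ζ‖) ^ (2 * K)) := by
  refine ENNReal.ofReal_le_ofReal ?_
  rw [← mul_pow]
  have h : ‖ζ.snd‖ ≤ ‖ζ‖ := WithLp.norm_snd_le _ ζ
  have := Real.pi_lt_four
  gcongr
  rw [hq]
  nlinarith [norm_nonneg ζ.snd, Real.pi_pos]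

/-- The frequency shift by `ζ.fst` disappears by translation invariance and Plancherel in `η`; the
position shift by `ζ.snd` costs only a polynomial factor in `ζ`. -/
theorem lintegral_oscL_sq_le (K : ℕ) (P : Rd d → 𝓢(Rd d, ℂ))
    {u : Rd d → ℝ≥0∞} (hu : Measurable u)
    (hPu : ∀ z x, ‖P z x‖ₑ ≤ ENNReal.ofReal ((1 + ‖x - z‖) ^ K) * u x) (ζ : Phase d) :
    ∫⁻ z, ∫⁻ η, ‖oscL P (η, z, ζ)‖ₑ ^ 2 ≤ ENNReal.ofReal ((2 * Real.pi) ^ d) *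
      (ENNReal.ofReal (4 ^ (2 * K) * (1 + ‖ζ‖) ^ (2 * K)) * gaussMoment d K *
        ∫⁻ x, u x ^ 2) := by
  have h : ∀ z, ∫⁻ η, ‖oscL P (η, z, ζ)‖ₑ ^ 2 = ENNReal.ofReal ((2 * Real.pi) ^ d) *
      ∫⁻ x, ‖windowed (z + -(Real.pi • ζ.snd)) (P z) x‖ₑ ^ 2 := by
    intro z
    rw [← lintegral_osc_sq]
    exact lintegral_add_right_eq_self
      (fun η => ‖osc (windowed (z + -(Real.pi • ζ.snd)) (P z)) η‖ₑ ^ 2) (Real.pi • ζ.fst)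
  simp_rw [h]
  rw [lintegral_const_mul' _ _ ENNReal.ofReal_ne_top]
  gcongr
  refine (lintegral_windowed_sq_le K P hu hPu _).trans ?_
  gcongr ?_ * _ * _
  exact ofReal_one_add_pi_mul_pow_le K ζ (by
    rw [norm_neg, norm_smul, Real.norm_of_nonneg Real.pi_pos.le])

theorem lintegral_oscR_sq_le (K : ℕ) (P : Rd d → 𝓢(Rd d, ℂ))
    {u : Rd d → ℝ≥0∞} (hu : Measurable u)
    (hPu : ∀ z x, ‖P z x‖ₑ ≤ ENNReal.ofReal ((1 + ‖x - z‖) ^ K) * u x) (ζ : Phase d) :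
    ∫⁻ z, ∫⁻ η, ‖oscR P (η, z, ζ)‖ₑ ^ 2 ≤ ENNReal.ofReal ((2 * Real.pi) ^ d) *
      (ENNReal.ofReal (4 ^ (2 * K) * (1 + ‖ζ‖) ^ (2 * K)) * gaussMoment d K *
        ∫⁻ x, u x ^ 2) := by
  have h : ∀ z, ∫⁻ η, ‖oscR P (η, z, ζ)‖ₑ ^ 2 = ENNReal.ofReal ((2 * Real.pi) ^ d) *
      ∫⁻ x, ‖windowed (z + Real.pi • ζ.snd) (P z) x‖ₑ ^ 2 := by
    intro z
    rw [← lintegral_osc_sq]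
    exact lintegral_sub_left_eq_self
      (fun η => ‖osc (windowed (z + Real.pi • ζ.snd) (P z)) η‖ₑ ^ 2) (Real.pi • ζ.fst)
  simp_rw [h]
  rw [lintegral_const_mul' _ _ ENNReal.ofReal_ne_top]
  gcongr
  refine (lintegral_windowed_sq_le K P hu hPu _).trans ?_
  gcongr ?_ * _ * _
  exact ofReal_one_add_pi_mul_pow_le K ζ (by
    rw [norm_smul, Real.norm_of_nonneg Real.pi_pos.le])

theorem lintegral_triple (f : Rd d × Rd d × Phase d → ℝ≥0∞) (hf : Measurable f) :
    ∫⁻ τ, f τ = ∫⁻ ζ, ∫⁻ z, ∫⁻ η, f (η, z, ζ) := by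
  rw [Measure.volume_eq_prod, lintegral_prod_symm _ hf.aemeasurable, Measure.volume_eq_prod,
    lintegral_prod_symm]
  exact (hf.comp measurable_swap).lintegral_prod_right'.aemeasurable

/-- The order of derivatives needed in the bilinear estimate with growth exponent `K`. -/
def symbolOrder (d K : ℕ) : ℕ := 2 * K + (2 * d + 1)

/-- The basic estimate. At fixed `ζ`, the weighted arithmetic–geometric inequality reduces the `(z,
η)`-integral to the two square integrals, each growing like `(1 + ‖ζ‖)^(2K)`. The decay of order `2K
+ 2d + 1` of the coefficient then leaves `(1 + ‖ζ‖)^{-(2d+1)}`, integrable in dimension `2d`. -/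
theorem exists_lintegral_osc_mul_le (d K : ℕ) :
    ∃ C : ℝ≥0∞, C ≠ ⊤ ∧ ∀ (P R : Rd d → 𝓢(Rd d, ℂ)),
      (Continuous fun p : Rd d × Rd d => P p.1 p.2) →
      (Continuous fun p : Rd d × Rd d => R p.1 p.2) →
      ∀ u v : Rd d → ℝ≥0∞, Measurable u → Measurable v →
      (∀ z x, ‖P z x‖ₑ ≤ ENNReal.ofReal ((1 + ‖x - z‖) ^ K) * u x) →
      (∀ z x, ‖R z x‖ₑ ≤ ENNReal.ofReal ((1 + ‖x - z‖) ^ K) * v x) →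
      ∀ (B : ℝ) (b : Rd d × Rd d × Phase d → ℂ),
      (∀ τ, (1 + ‖τ.2.2‖) ^ symbolOrder d K * ‖b τ‖ ≤ B) → ∀ t : ℝ, 0 < t →
      ∫⁻ τ, ‖b τ * (oscL P τ * oscR R τ)‖ₑ ≤ C * ENNReal.ofReal B *
        (ENNReal.ofReal t * (∫⁻ x, u x ^ 2) + ENNReal.ofReal t⁻¹ * ∫⁻ x, v x ^ 2) := by
  set c0 : ℝ≥0∞ := ∫⁻ ζ : Phase d, ENNReal.ofReal ((1 + ‖ζ‖) ^ (-((2 * d + 1 : ℕ) : ℝ)))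
  have hc0 : c0 ≠ ⊤ := by
    refine (Integrable.lintegral_lt_top (integrable_one_add_norm ?_)).ne
    have : Module.finrank ℝ (Phase d) = d + d := by
      rw [(WithLp.prodContinuousLinearEquiv 2 ℝ (Rd d) (Rd d)).toLinearEquiv.finrank_eq]
      simp
    rw [this]
    exact_mod_cast (by omega : d + d < 2 * d + 1)
  set c1 : ℝ≥0∞ := ENNReal.ofReal ((2 * Real.pi) ^ d) *
    (ENNReal.ofReal (4 ^ (2 * K)) * gaussMoment d K)
  have hc1 : c1 ≠ ⊤ := ENNReal.mul_ne_top ENNReal.ofReal_ne_top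
    (ENNReal.mul_ne_top ENNReal.ofReal_ne_top (gaussMoment_ne_top d K))
  refine ⟨c0 * c1, ENNReal.mul_ne_top hc0 hc1, ?_⟩
  intro P R hP hR u v hu hv hPu hRv B b hb t ht
  have hmL := (stronglyMeasurable_oscL P hP).measurable
  have hmR := (stronglyMeasurable_oscR R hR).measurable
  set S := ENNReal.ofReal t * (∫⁻ x, u x ^ 2) + ENNReal.ofReal t⁻¹ * ∫⁻ x, v x ^ 2
  have hbd : ∀ τ : Rd d × Rd d × Phase d, ‖b τ‖ₑ ≤
      ENNReal.ofReal (B * ((1 + ‖τ.2.2‖) ^ symbolOrder d K)⁻¹) := by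
    intro τ
    rw [← ofReal_norm]
    refine ENNReal.ofReal_le_ofReal ?_
    rw [← div_eq_mul_inv, le_div_iff₀ (by positivity), mul_comm]
    exact hb τ
  calc ∫⁻ τ, ‖b τ * (oscL P τ * oscR R τ)‖ₑ
      ≤ ∫⁻ τ : Rd d × Rd d × Phase d, ENNReal.ofReal (B * ((1 + ‖τ.2.2‖) ^ symbolOrder d K)⁻¹) *
          (ENNReal.ofReal t * ‖oscL P τ‖ₑ ^ 2 + ENNReal.ofReal t⁻¹ * ‖oscR R τ‖ₑ ^ 2) := by
        refine lintegral_mono fun τ => ?_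
        rw [enorm_mul]
        gcongr
        · exact hbd τ
        · exact enorm_mul_le_sq_add_sq _ _ ht
    _ = ∫⁻ ζ : Phase d, ENNReal.ofReal (B * ((1 + ‖ζ‖) ^ symbolOrder d K)⁻¹) *
          (ENNReal.ofReal t * (∫⁻ z, ∫⁻ η, ‖oscL P (η, z, ζ)‖ₑ ^ 2) +
            ENNReal.ofReal t⁻¹ * ∫⁻ z, ∫⁻ η, ‖oscR R (η, z, ζ)‖ₑ ^ 2) := by
        rw [lintegral_triple _ (by fun_prop)]
        refine lintegral_congr fun ζ => ?_
        have e1 : ∀ z, Measurable fun η => ‖oscL P (η, z, ζ)‖ₑ ^ 2 := fun z =>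
          (hmL.comp (by fun_prop : Measurable fun η : Rd d => (η, z, ζ))).enorm.pow_const 2
        have e2 : ∀ z, Measurable fun η => ‖oscR R (η, z, ζ)‖ₑ ^ 2 := fun z =>
          (hmR.comp (by fun_prop : Measurable fun η : Rd d => (η, z, ζ))).enorm.pow_const 2
        have e3 : Measurable fun z => ∫⁻ η, ‖oscL P (η, z, ζ)‖ₑ ^ 2 :=
          Measurable.lintegral_prod_right' (f := fun p : Rd d × Rd d => ‖oscL P (p.2, p.1, ζ)‖ₑ ^ 2)
            ((hmL.comp (by fun_prop : Measurable fun p : Rd d × Rd d => (p.2, p.1, ζ))).enorm.pow_const 2)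
        rw [← lintegral_const_mul' _ _ ENNReal.ofReal_ne_top,
          ← lintegral_const_mul' _ _ ENNReal.ofReal_ne_top,
          ← lintegral_add_left (e3.const_mul _),
          ← lintegral_const_mul' _ _ ENNReal.ofReal_ne_top]
        refine lintegral_congr fun z => ?_
        dsimp only
        rw [lintegral_const_mul' _ _ ENNReal.ofReal_ne_top, lintegral_add_left ((e1 z).const_mul _),
          lintegral_const_mul' _ _ ENNReal.ofReal_ne_top,
          lintegral_const_mul' _ _ ENNReal.ofReal_ne_top]
    _ ≤ ∫⁻ ζ : Phase d, ENNReal.ofReal ((1 + ‖ζ‖) ^ (-((2 * d + 1 : ℕ) : ℝ))) *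
          (ENNReal.ofReal B * (c1 * S)) := by
        refine lintegral_mono fun ζ => ?_
        have h1 := lintegral_oscL_sq_le K P hu hPu ζ
        have h2 := lintegral_oscR_sq_le K R hv hRv ζ
        rw [ENNReal.ofReal_mul (by positivity)] at h1 h2
        have h3 : ENNReal.ofReal (B * ((1 + ‖ζ‖) ^ symbolOrder d K)⁻¹) *
            ENNReal.ofReal ((1 + ‖ζ‖) ^ (2 * K)) =
            ENNReal.ofReal ((1 + ‖ζ‖) ^ (-((2 * d + 1 : ℕ) : ℝ))) * ENNReal.ofReal B := by
          rw [← ENNReal.ofReal_mul' (by positivity), ← ENNReal.ofReal_mul (by positivity)]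
          congr 1
          rw [Real.rpow_neg (by positivity), Real.rpow_natCast, symbolOrder, pow_add]
          field_simp
        calc _ ≤ ENNReal.ofReal (B * ((1 + ‖ζ‖) ^ symbolOrder d K)⁻¹) *
              (ENNReal.ofReal t * (ENNReal.ofReal ((2 * Real.pi) ^ d) * (ENNReal.ofReal (4 ^ (2 * K)) *
                ENNReal.ofReal ((1 + ‖ζ‖) ^ (2 * K)) * gaussMoment d K * ∫⁻ x, u x ^ 2)) +
              ENNReal.ofReal t⁻¹ * (ENNReal.ofReal ((2 * Real.pi) ^ d) * (ENNReal.ofReal (4 ^ (2 * K)) *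
                ENNReal.ofReal ((1 + ‖ζ‖) ^ (2 * K)) * gaussMoment d K * ∫⁻ x, v x ^ 2))) := by
                gcongr
          _ = (ENNReal.ofReal (B * ((1 + ‖ζ‖) ^ symbolOrder d K)⁻¹) *
            ENNReal.ofReal ((1 + ‖ζ‖) ^ (2 * K))) * (c1 * S) := by simp only [c1, S]; ring
          _ = _ := by rw [h3]; ring
    _ = _ := by
        rw [lintegral_mul_const _ (by fun_prop)]
        ring

end Osc

/-! ### Absolute convergence of the Weyl form. -/

section WeylInner

variable {d : ℕ}

/-- The complex conjugate of a Schwartz function. -/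
def conjSchwartz (ψ : 𝓢(Rd d, ℂ)) : 𝓢(Rd d, ℂ) :=
  SchwartzMap.postcompCLM (Complex.conjCLE : ℂ →L[ℝ] ℂ) ψ

@[simp] theorem conjSchwartz_apply (ψ : 𝓢(Rd d, ℂ)) (x : Rd d) :
    conjSchwartz ψ x = conj (ψ x) := rfl

/-- The inner integral of the Weyl form. -/
def weylInner (a : Rd d × Rd d → ℝ) (f g : 𝓢(Rd d, ℂ)) (ξ : Rd d) : ℂ :=
  ∫ p : Rd d × Rd d, Complex.exp (Complex.I * ((inner ℝ ξ (p.2 - p.1) : ℝ) : ℂ)) *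
    ((a ((1 / 2 : ℝ) • (p.2 + p.1), ξ) : ℝ) : ℂ) * f p.2 * g p.1

theorem weylForm_eq_integral_weylInner (a : Rd d × Rd d → ℝ) (ψ φ : 𝓢(Rd d, ℂ)) :
    weylForm a ψ φ = (((2 * Real.pi) ^ d)⁻¹ : ℝ) * ∫ ξ, weylInner a (conjSchwartz ψ) φ ξ := rfl

theorem integrable_schwartz_mul (f g : 𝓢(Rd d, ℂ)) :
    Integrable fun p : Rd d × Rd d => f p.2 * g p.1 := by
  have := (g.integrable (μ := volume)).mul_prod (f.integrable (μ := volume))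
  exact this.congr (Filter.Eventually.of_forall fun p => mul_comm _ _)

theorem continuous_weyl_integrand {a : Rd d × Rd d → ℝ} (ha : Continuous a) (f g : 𝓢(Rd d, ℂ)) :
    Continuous fun q : Rd d × Rd d × Rd d =>
      Complex.exp (Complex.I * ((inner ℝ q.1 (q.2.2 - q.2.1) : ℝ) : ℂ)) *
    ((a ((1 / 2 : ℝ) • (q.2.2 + q.2.1), q.1) : ℝ) : ℂ) * f q.2.2 * g q.2.1 := by
  fun_prop

theorem integrable_weyl_integrand {a : Rd d × Rd d → ℝ} (ha : Continuous a) {M : ℝ}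
    (hM : ∀ p, |a p| ≤ M) (f g : 𝓢(Rd d, ℂ)) (ξ : Rd d) :
    Integrable fun p : Rd d × Rd d =>
      Complex.exp (Complex.I * ((inner ℝ ξ (p.2 - p.1) : ℝ) : ℂ)) *
    ((a ((1 / 2 : ℝ) • (p.2 + p.1), ξ) : ℝ) : ℂ) * f p.2 * g p.1 := by
  refine ((integrable_schwartz_mul f g).norm.const_mul M).mono' ?_
    (Filter.Eventually.of_forall fun p => ?_)
  · exact ((continuous_weyl_integrand ha f g).comp
      (by fun_prop : Continuous fun p : Rd d × Rd d => (ξ, p))).aestronglyMeasurable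
  · rw [mul_assoc, norm_mul, norm_mul, norm_cexp_I_mul_ofReal, one_mul, Complex.norm_real]
    gcongr
    exact hM _

theorem stronglyMeasurable_weylInner {a : Rd d × Rd d → ℝ} (ha : Continuous a)
    (f g : 𝓢(Rd d, ℂ)) : StronglyMeasurable (weylInner a f g) :=
  (continuous_weyl_integrand ha f g).stronglyMeasurable.integral_prod_right'
    (ν := (volume : Measure (Rd d × Rd d)))

/-- Midpoint and difference coordinates: `(m, t) ↦ (m - t/2, m + t/2)`. -/
def midpointMap (p : Rd d × Rd d) : Rd d × Rd d :=
  (p.1 - (1 / 2 : ℝ) • p.2, p.1 + (1 / 2 : ℝ) • p.2)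

/-- The map is a product of two shears, `(m, t) ↦ (m - t/2, t)` and `(x', t) ↦ (x', x' + t)`. -/
theorem measurePreserving_midpointMap :
    MeasurePreserving (midpointMap (d := d)) volume volume := by
  have h1 : MeasurePreserving (fun p : Rd d × Rd d => (p.1, p.2 - (1 / 2 : ℝ) • p.1))
      (volume.prod volume) (volume.prod volume) :=
    (MeasurePreserving.id volume).skew_product (g := fun t m => m - (1 / 2 : ℝ) • t)
      (by fun_prop) (Filter.Eventually.of_forall fun t =>
        (measurePreserving_sub_right volume ((1 / 2 : ℝ) • t)).map_eq)
  have h2 := (Measure.measurePreserving_swap (μ := (volume : Measure (Rd d)))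
    (ν := (volume : Measure (Rd d)))).comp
      (h1.comp (Measure.measurePreserving_swap (μ := (volume : Measure (Rd d)))
        (ν := (volume : Measure (Rd d)))))
  have h3 := (measurePreserving_prod_add (volume : Measure (Rd d)) (volume : Measure (Rd d))).comp h2
  have h4 : midpointMap (d := d) = (fun z : Rd d × Rd d => (z.1, z.1 + z.2)) ∘ Prod.swap ∘
      (fun p : Rd d × Rd d => (p.1, p.2 - (1 / 2 : ℝ) • p.1)) ∘ Prod.swap := by
    funext p
    refine Prod.ext rfl ?_
    simp only [midpointMap, Function.comp, Prod.swap]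
    module
  rw [h4]
  exact h3

/-- The slice `t ↦ f (m + t/2) g (m - t/2)`. -/
def slice (f g : 𝓢(Rd d, ℂ)) (m t : Rd d) : ℂ :=
  f (m + (1 / 2 : ℝ) • t) * g (m - (1 / 2 : ℝ) • t)

theorem contDiff_slice (f g : 𝓢(Rd d, ℂ)) (m : Rd d) : ContDiff ℝ ∞ (slice f g m) := by
  have h1 := f.smooth'
  have h2 := g.smooth'
  exact (h1.comp (by fun_prop)).mul (h2.comp (by fun_prop))

theorem norm_iteratedFDeriv_affine_le (f : 𝓢(Rd d, ℂ)) (m : Rd d) {c : ℝ} (hc : |c| ≤ 1) (i : ℕ)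
    (t : Rd d) : ‖iteratedFDeriv ℝ i (fun t => f (m + c • t)) t‖ ≤
      ‖iteratedFDeriv ℝ i f (m + c • t)‖ := by
  have h1 : (fun t => f (m + c • t)) =
      (fun y => f (y + m)) ∘ (c • ContinuousLinearMap.id ℝ (Rd d)) := by
    ext t; simp [add_comm]
  have hs : ContDiff ℝ ∞ fun y => f (y + m) := f.smooth'.comp (by fun_prop)
  rw [h1, ContinuousLinearMap.iteratedFDeriv_comp_right _ hs t (i := i) (by exact_mod_cast le_top),
    iteratedFDeriv_comp_add_right]
  refine (ContinuousMultilinearMap.norm_compContinuousLinearMap_le _ _).trans ?_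
  rw [Finset.prod_const, Finset.card_univ, Fintype.card_fin]
  have h2 : ‖c • ContinuousLinearMap.id ℝ (Rd d)‖ ≤ 1 := by
    rw [norm_smul]
    exact mul_le_one₀ hc (norm_nonneg _) ContinuousLinearMap.norm_id_le
  refine (mul_le_of_le_one_right (norm_nonneg _) (pow_le_one₀ (norm_nonneg _) h2)).trans ?_
  simp [add_comm]

/-- A bound for the derivatives of the slices, in the original coordinates. -/
def sliceBound (f g : 𝓢(Rd d, ℂ)) (j : ℕ) (p : Rd d × Rd d) : ℝ :=
  ∑ i ∈ Finset.range (j + 1), (j.choose i : ℝ) *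
    (‖iteratedFDeriv ℝ (j - i) g p.1‖ * ‖iteratedFDeriv ℝ i f p.2‖)

theorem norm_iteratedFDeriv_slice_le (f g : 𝓢(Rd d, ℂ)) (j : ℕ) (m t : Rd d) :
    ‖iteratedFDeriv ℝ j (slice f g m) t‖ ≤ sliceBound f g j (midpointMap (m, t)) := by
  have h1 : ContDiff ℝ ∞ fun t : Rd d => f (m + (1 / 2 : ℝ) • t) := f.smooth'.comp (by fun_prop)
  have h2 : ContDiff ℝ ∞ fun t : Rd d => g (m + (-(1 / 2) : ℝ) • t) := g.smooth'.comp (by fun_prop)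
  have h3 : slice f g m = fun t => f (m + (1 / 2 : ℝ) • t) * g (m + (-(1 / 2) : ℝ) • t) := by
    ext t; simp [slice, sub_eq_add_neg]
  rw [h3]
  refine (norm_iteratedFDeriv_mul_le h1 h2 t (by exact_mod_cast le_top)).trans ?_
  refine Finset.sum_le_sum fun i _ => ?_
  have h4 := norm_iteratedFDeriv_affine_le f m (c := 1 / 2) (by norm_num [abs_of_pos]) i t
  have h5 := norm_iteratedFDeriv_affine_le g m (c := -(1 / 2)) (by norm_num [abs_of_pos]) (j - i) t
  rw [mul_assoc, mul_comm (‖iteratedFDeriv ℝ (j - i) g _‖)]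
  gcongr
  · exact h4
  · simpa [midpointMap, sub_eq_add_neg] using h5

theorem integrable_sliceBound (f g : 𝓢(Rd d, ℂ)) (j : ℕ) : Integrable (sliceBound f g j) := by
  refine integrable_finsetSum _ fun i _ => Integrable.const_mul ?_ _
  have h1 := g.integrable_pow_mul_iteratedFDeriv volume 0 (j - i)
  have h2 := f.integrable_pow_mul_iteratedFDeriv volume 0 i
  simp only [pow_zero, one_mul] at h1 h2
  exact h1.mul_prod h2

/-- In midpoint and difference coordinates the symbol `a(m, ξ)` is constant in `t`, so the
`t`-integral is the Fourier transform of a slice of the Schwartz product. Decay in `ξ` comes from `d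
+ 1` derivatives of the slice; only the supremum of `a` enters. -/
theorem integrable_weylInner {a : Rd d × Rd d → ℝ} (ha : Continuous a) {M : ℝ}
    (hM : ∀ p, |a p| ≤ M) (f g : 𝓢(Rd d, ℂ)) : Integrable (weylInner a f g) := by
  set n := d + 1
  have hM0 : 0 ≤ M := (abs_nonneg _).trans (hM 0)
  have hsl : ∀ j, Integrable fun p => sliceBound f g j (midpointMap p) := fun j =>
    measurePreserving_midpointMap.integrable_comp_of_integrable (integrable_sliceBound f g j)
  have hslm : ∀ᵐ m : Rd d, ∀ j ≤ n, Integrable fun t => sliceBound f g j (midpointMap (m, t)) := by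
    rw [ae_all_iff]
    intro j
    filter_upwards [(hsl j).prod_right_ae] with m hm _
    exact hm
  set S : ℝ := ∑ j ∈ Finset.range (n + 1), ∫ p, sliceBound f g j (midpointMap p)
  set c : ℝ := 2 ^ n * (2 * 2 ^ n)
  have hbound : ∀ ξ, ‖weylInner a f g ξ‖ ≤
      M * (c * S) * (1 + ‖-(2 * Real.pi)⁻¹ • ξ‖) ^ (-(n : ℝ)) := by
    intro ξ
    have hI := integrable_weyl_integrand ha hM f g ξ
    have e1 : weylInner a f g ξ = ∫ m, ∫ t, (Complex.exp (Complex.I * ((inner ℝ ξ t : ℝ) : ℂ)) *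
        ((a (m, ξ) : ℝ) : ℂ) * f (m + (1 / 2 : ℝ) • t) * g (m - (1 / 2 : ℝ) • t)) := by
      have hI' := measurePreserving_midpointMap.integrable_comp_of_integrable hI
      unfold weylInner
      rw [← measurePreserving_midpointMap.map_eq, integral_map
        measurePreserving_midpointMap.measurable.aemeasurable
        (by rw [measurePreserving_midpointMap.map_eq]; exact hI.aestronglyMeasurable)]
      rw [Measure.volume_eq_prod] at hI' ⊢
      have := integral_prod _ hI'
      refine this.trans ?_
      congr 1; ext m; congr 1; ext t
      have h1 : m + (1 / 2 : ℝ) • t - (m - (1 / 2 : ℝ) • t) = t := by module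
      have h2 : (1 / 2 : ℝ) • (m + (1 / 2 : ℝ) • t + (m - (1 / 2 : ℝ) • t)) = m := by module
      simp only [Function.comp, midpointMap, h1, h2]
    have e2 : weylInner a f g ξ = ∫ m, ((a (m, ξ) : ℝ) : ℂ) * osc (slice f g m) ξ := by
      rw [e1]
      congr 1; ext m
      rw [osc, ← integral_const_mul]
      congr 1; ext t
      rw [slice]; ring
    rw [e2]
    have hpw : ∀ᵐ m : Rd d, ‖((a (m, ξ) : ℝ) : ℂ) * osc (slice f g m) ξ‖ ≤
        M * (1 + ‖-(2 * Real.pi)⁻¹ • ξ‖) ^ (-(n : ℝ)) * (c * ∑ j ∈ Finset.range (n + 1),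
          ∫ t, sliceBound f g j (midpointMap (m, t))) := by
      filter_upwards [hslm] with m hm
      have hint : ∀ j ≤ n, Integrable fun t => ‖iteratedFDeriv ℝ j (slice f g m) t‖ := by
        intro j hj
        refine (hm j hj).mono' ((contDiff_slice f g m).continuous_iteratedFDeriv
          (m := j) (by exact_mod_cast le_top)).norm.aestronglyMeasurable
          (Filter.Eventually.of_forall fun t => ?_)
        rw [norm_norm]; exact norm_iteratedFDeriv_slice_le f g j m t
      have h1 := one_add_pow_mul_norm_fourier_le (contDiff_slice f g m) hint
        (-(2 * Real.pi)⁻¹ • ξ)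
      rw [← osc_eq_fourier] at h1
      have h2 : ∑ j ∈ Finset.range (n + 1), ∫ t, ‖iteratedFDeriv ℝ j (slice f g m) t‖ ≤
          ∑ j ∈ Finset.range (n + 1), ∫ t, sliceBound f g j (midpointMap (m, t)) :=
        Finset.sum_le_sum fun j hj => by
          have hj' : j ≤ n := by have := Finset.mem_range.1 hj; omega
          exact integral_mono (hint j hj') (hm j hj')
            fun t => norm_iteratedFDeriv_slice_le f g j m t
      rw [norm_mul, Complex.norm_real, mul_assoc]
      refine mul_le_mul (hM _) ?_ (norm_nonneg _) hM0
      rw [Real.rpow_neg (by positivity), Real.rpow_natCast, inv_mul_eq_div,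
        le_div_iff₀ (by positivity), mul_comm]
      refine h1.trans ?_
      calc _ ≤ 2 ^ n * (2 * (2 ^ n * ∑ j ∈ Finset.range (n + 1),
            ∫ t, sliceBound f g j (midpointMap (m, t)))) := by gcongr
        _ = _ := by simp only [c]; ring
    refine (norm_integral_le_of_norm_le ?_ hpw).trans (le_of_eq ?_)
    · refine Integrable.const_mul (Integrable.const_mul ?_ _) _
      exact integrable_finsetSum _ fun j _ => (hsl j).integral_prod_left
    · rw [integral_const_mul, integral_const_mul, integral_finsetSum _
        fun j _ => (hsl j).integral_prod_left]
      have : ∀ j, ∫ m, ∫ t, sliceBound f g j (midpointMap (m, t)) =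
          ∫ p, sliceBound f g j (midpointMap p) := fun j => (integral_prod _ (hsl j)).symm
      simp_rw [this]
      ring
  refine Integrable.mono' ?_ (stronglyMeasurable_weylInner ha f g).aestronglyMeasurable
    (Filter.Eventually.of_forall hbound)
  refine Integrable.const_mul (Integrable.comp_smul (f := fun ξ : Rd d => (1 + ‖ξ‖) ^ (-(n : ℝ)))
    (integrable_one_add_norm ?_) (by simp [Real.pi_ne_zero])) _
  simp [n]

end WeylInner

/-! ### The coherent state representation of the Weyl form. -/

section Representation

variable {d : ℕ}

theorem weight_zero (c x : Rd d) : weight 0 c x = 1 := by simp [weight]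

theorem IsSymbolS00.exists_symbolBound {a : Rd d × Rd d → ℝ} (ha : IsSymbolS00 a) (L : ℕ) :
    ∃ B : ℝ, 0 ≤ B ∧ SymbolBound a L B 0 0 := by
  choose M hM using ha.bounded
  have hM0 : ∀ n, 0 ≤ M n := fun n => (norm_nonneg _).trans (hM n 0)
  refine ⟨∑ j ∈ Finset.range (L + 1), M j, Finset.sum_nonneg fun j _ => hM0 j, ?_⟩
  intro j hj p
  rw [weight_zero, mul_one]
  exact (hM j p).trans (Finset.single_le_sum (f := M) (fun i _ => hM0 i)
    (Finset.mem_range.2 (Nat.lt_succ_of_le hj)))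

theorem IsSymbolS00.exists_abs_le {a : Rd d × Rd d → ℝ} (ha : IsSymbolS00 a) :
    ∃ M : ℝ, ∀ p, |a p| ≤ M := by
  obtain ⟨M, hM⟩ := ha.bounded 0
  exact ⟨M, fun p => by simpa using hM p⟩

/-- The coefficient of the coherent state representation at `τ = (η, z, (p, q))`. -/
def symbolCoeff (a : Rd d × Rd d → ℝ) (τ : Rd d × Rd d × Phase d) : ℂ :=
  Complex.exp (Complex.I * ((-(2 * Real.pi * inner ℝ τ.2.2.fst τ.2.1) : ℝ) : ℂ)) *
    𝓕 (localSymbol a (τ.2.1, τ.1)) τ.2.2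

theorem norm_symbolCoeff (a : Rd d × Rd d → ℝ) (τ : Rd d × Rd d × Phase d) :
    ‖symbolCoeff a τ‖ = ‖𝓕 (localSymbol a (τ.2.1, τ.1)) τ.2.2‖ := by
  rw [symbolCoeff, norm_mul, norm_cexp_I_mul_ofReal, one_mul]

theorem continuous_localSymbol_uncurry {a : Rd d × Rd d → ℝ} (ha : Continuous a) :
    Continuous fun q : (Rd d × Rd d × Phase d) × Phase d => localSymbol a (q.1.2.1, q.1.1) q.2 := by
  have h1 : Continuous fun q : (Rd d × Rd d × Phase d) × Phase d => q.2.fst :=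
    continuous_phase_fst.comp continuous_snd
  have h2 : Continuous fun q : (Rd d × Rd d × Phase d) × Phase d => q.2.snd :=
    continuous_phase_snd.comp continuous_snd
  unfold localSymbol
  fun_prop

theorem stronglyMeasurable_fourier_localSymbol {a : Rd d × Rd d → ℝ} (ha : Continuous a) :
    StronglyMeasurable fun τ : Rd d × Rd d × Phase d => 𝓕 (localSymbol a (τ.2.1, τ.1)) τ.2.2 := by
  have h1 := continuous_localSymbol_uncurry ha
  have h2 : Continuous fun q : (Rd d × Rd d × Phase d) × Phase d =>
      Complex.exp (((-2 * Real.pi * inner ℝ q.2 q.1.2.2 : ℝ) : ℂ) * Complex.I) •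
        localSymbol a (q.1.2.1, q.1.1) q.2 := by
    have h3 : Continuous fun q : (Rd d × Rd d × Phase d) × Phase d =>
      (inner ℝ q.2 q.1.2.2 : ℝ) := Continuous.inner (by fun_prop) (by fun_prop)
    fun_prop
  simp_rw [Real.fourier_eq']
  exact h2.stronglyMeasurable.integral_prod_right' (ν := (volume : Measure (Phase d)))

theorem stronglyMeasurable_symbolCoeff {a : Rd d × Rd d → ℝ} (ha : Continuous a) :
    StronglyMeasurable (symbolCoeff a) := by
  have h1 : Continuous fun τ : Rd d × Rd d × Phase d => τ.2.2.fst :=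
    continuous_phase_fst.comp (by fun_prop)
  have h3 : Continuous fun τ : Rd d × Rd d × Phase d => (inner ℝ τ.2.2.fst τ.2.1 : ℝ) :=
    h1.inner (by fun_prop)
  exact (by fun_prop : Continuous fun τ : Rd d × Rd d × Phase d =>
    Complex.exp (Complex.I * ((-(2 * Real.pi * inner ℝ τ.2.2.fst τ.2.1) : ℝ) :
      ℂ))).stronglyMeasurable.mul (stronglyMeasurable_fourier_localSymbol ha)

theorem integrable_symbolCoeff_mul_osc {a : Rd d × Rd d → ℝ} (ha : IsSymbolS00 a)
    (f g : 𝓢(Rd d, ℂ)) :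
    Integrable fun τ => symbolCoeff a τ * (oscL (fun _ => f) τ * oscR (fun _ => g) τ) := by
  have hf : Continuous fun p : Rd d × Rd d => f p.2 := by fun_prop
  have hg : Continuous fun p : Rd d × Rd d => g p.2 := by fun_prop
  refine ⟨((stronglyMeasurable_symbolCoeff ha.smooth.continuous).mul
    ((stronglyMeasurable_oscL (fun _ => f) hf).mul
      (stronglyMeasurable_oscR (fun _ => g) hg))).aestronglyMeasurable, ?_⟩
  obtain ⟨C, hC, h⟩ := exists_lintegral_osc_mul_le d 0
  obtain ⟨C', -, h'⟩ := exists_norm_fourier_localSymbol_le d (symbolOrder d 0)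
  obtain ⟨B, -, hB⟩ := ha.exists_symbolBound (symbolOrder d 0)
  refine lt_of_le_of_lt (h (fun _ => f) (fun _ => g) hf hg (fun x => ‖f x‖ₑ) (fun x => ‖g x‖ₑ)
    (by fun_prop) (by fun_prop) (by simp) (by simp) (C' * B) (symbolCoeff a) (fun τ => ?_) 1
    one_pos) ?_
  · rw [norm_symbolCoeff]
    have := h' a ha.smooth B 0 0 le_rfl zero_le_one hB (τ.2.1, τ.1) τ.2.2
    rwa [weight_zero, mul_one] at this
  · have hfin : ∀ u : 𝓢(Rd d, ℂ), ∫⁻ x, ‖u x‖ₑ ^ 2 ≠ ⊤ := by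
      intro u
      have := ((u.memLp 2 volume).integrable_norm_pow two_ne_zero).lintegral_lt_top.ne
      simpa [ENNReal.ofReal_pow, ofReal_norm] using this
    have h1 := hfin f
    have h2 := hfin g
    exact (ENNReal.mul_ne_top (ENNReal.mul_ne_top hC ENNReal.ofReal_ne_top)
      (ENNReal.add_ne_top.2 ⟨ENNReal.mul_ne_top ENNReal.ofReal_ne_top h1,
        ENNReal.mul_ne_top ENNReal.ofReal_ne_top h2⟩)).lt_top

/-- The integrand of the coherent state representation in the variables
`((ξ, (x', x)), (z, ζ))`, for a fixed frequency `η`. -/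
def coherentIntegrand (a : Rd d × Rd d → ℝ) (f g : 𝓢(Rd d, ℂ)) (η : Rd d)
    (X : (Rd d × Rd d × Rd d) × (Rd d × Phase d)) : ℂ :=
  Complex.exp (Complex.I * ((inner ℝ X.1.1 (X.1.2.2 - X.1.2.1) : ℝ) : ℂ)) *
    (f X.1.2.2 * g X.1.2.1) * 𝓕 (localSymbol a (X.2.1, η)) X.2.2 *
    Complex.exp (Complex.I * ((2 * Real.pi *
      (inner ℝ X.2.2.fst ((1 / 2 : ℝ) • (X.1.2.2 + X.1.2.1) - X.2.1) +
        inner ℝ X.2.2.snd (X.1.1 - η)) : ℝ) : ℂ)) *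
    ((Real.exp (-1 * ‖(1 / 2 : ℝ) • (X.1.2.2 + X.1.2.1) - X.2.1‖ ^ 2) *
      Real.exp (-1 * ‖X.1.1 - η‖ ^ 2) : ℝ) : ℂ)

theorem stronglyMeasurable_coherentIntegrand {a : Rd d × Rd d → ℝ} (ha : Continuous a)
    (f g : 𝓢(Rd d, ℂ)) (η : Rd d) : StronglyMeasurable (coherentIntegrand a f g η) := by
  have h1 : Continuous fun X : (Rd d × Rd d × Rd d) × (Rd d × Phase d) => X.2.2.fst :=
    continuous_phase_fst.comp (by fun_prop)
  have h2 : Continuous fun X : (Rd d × Rd d × Rd d) × (Rd d × Phase d) => X.2.2.snd :=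
    continuous_phase_snd.comp (by fun_prop)
  have h3 : StronglyMeasurable fun X : (Rd d × Rd d × Rd d) × (Rd d × Phase d) =>
      𝓕 (localSymbol a (X.2.1, η)) X.2.2 := by
    have h0 := (stronglyMeasurable_fourier_localSymbol ha).comp_measurable
      (by fun_prop : Measurable fun X : (Rd d × Rd d × Rd d) × (Rd d × Phase d) =>
        (η, X.2.1, X.2.2))
    simpa only [Function.comp_def] using h0
  have h4 : Continuous fun X : (Rd d × Rd d × Rd d) × (Rd d × Phase d) =>
      (inner ℝ X.1.1 (X.1.2.2 - X.1.2.1) : ℝ) := Continuous.inner (by fun_prop) (by fun_prop)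
  have h5 : Continuous fun X : (Rd d × Rd d × Rd d) × (Rd d × Phase d) =>
      (inner ℝ X.2.2.fst ((1 / 2 : ℝ) • (X.1.2.2 + X.1.2.1) - X.2.1) : ℝ) :=
    Continuous.inner (by fun_prop) (by fun_prop)
  have h6 : Continuous fun X : (Rd d × Rd d × Rd d) × (Rd d × Phase d) =>
      (inner ℝ X.2.2.snd (X.1.1 - η) : ℝ) := Continuous.inner (by fun_prop) (by fun_prop)
  refine StronglyMeasurable.mul (StronglyMeasurable.mul (StronglyMeasurable.mul ?_ h3) ?_) ?_
  · exact Continuous.stronglyMeasurable (by fun_prop)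
  · exact Continuous.stronglyMeasurable (by fun_prop)
  · exact Continuous.stronglyMeasurable (by fun_prop)

theorem integrable_gauss (c : ℝ) (hc : 0 < c) :
    Integrable fun x : Rd d => Real.exp (-c * ‖x‖ ^ 2) :=
  (gaussianSchwartz (W := Rd d) c hc).integrable

/-- The Fubini majorant at fixed `η`: Gaussian in `ξ - η` and in the distance from the midpoint to
`z`, Schwartz in `(x', x)`, and `β` in `ζ`. The order `2d + 1` makes `β` integrable on the
`2d`-dimensional phase space. -/
theorem exists_integrable_bound_coherentIntegrand {a : Rd d × Rd d → ℝ} (ha : IsSymbolS00 a) :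
    ∃ β : Phase d → ℝ, Integrable β ∧ (∀ ζ, 0 ≤ β ζ) ∧
      (∀ w ζ, ‖𝓕 (localSymbol a w) ζ‖ ≤ β ζ) ∧
      ∀ (f g : 𝓢(Rd d, ℂ)) (η : Rd d) (X : (Rd d × Rd d × Rd d) × (Rd d × Phase d)),
        ‖coherentIntegrand a f g η X‖ ≤ (Real.exp (-1 * ‖X.1.1 - η‖ ^ 2) *
          ‖f X.1.2.2 * g X.1.2.1‖) *
          (Real.exp (-1 * ‖(1 / 2 : ℝ) • (X.1.2.2 + X.1.2.1) - X.2.1‖ ^ 2) * β X.2.2) := by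
  obtain ⟨C', hC', h'⟩ := exists_norm_fourier_localSymbol_le d (2 * d + 1)
  obtain ⟨B, hB0, hB⟩ := ha.exists_symbolBound (2 * d + 1)
  have hβ : ∀ w ζ, ‖𝓕 (localSymbol a w) ζ‖ ≤
      C' * B * (1 + ‖ζ‖) ^ (-((2 * d + 1 : ℕ) : ℝ)) := by
    intro w ζ
    have := h' a ha.smooth B 0 0 le_rfl zero_le_one hB w ζ
    rw [weight_zero, mul_one] at this
    rwa [Real.rpow_neg (by positivity), Real.rpow_natCast, ← div_eq_mul_inv,
      le_div_iff₀ (by positivity), mul_comm]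
  refine ⟨fun ζ => C' * B * (1 + ‖ζ‖) ^ (-((2 * d + 1 : ℕ) : ℝ)), ?_, fun ζ => by positivity, hβ, ?_⟩
  · refine Integrable.const_mul (integrable_one_add_norm ?_) _
    have : Module.finrank ℝ (Phase d) = d + d := by
      rw [(WithLp.prodContinuousLinearEquiv 2 ℝ (Rd d) (Rd d)).toLinearEquiv.finrank_eq]
      simp
    rw [this]
    exact_mod_cast (by omega : d + d < 2 * d + 1)
  · intro f g η X
    unfold coherentIntegrand
    rw [norm_mul, norm_mul, norm_mul, norm_mul, norm_cexp_I_mul_ofReal, norm_cexp_I_mul_ofReal,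
      Complex.norm_real, Real.norm_of_nonneg (by positivity), one_mul, mul_one]
    have := hβ (X.2.1, η) X.2.2
    calc _ ≤ ‖f X.1.2.2 * g X.1.2.1‖ * (C' * B * (1 + ‖X.2.2‖) ^ (-((2 * d + 1 : ℕ) : ℝ))) * _ := by
          gcongr
      _ = _ := by ring

theorem integrable_coherentIntegrand {a : Rd d × Rd d → ℝ} (ha : IsSymbolS00 a)
    (f g : 𝓢(Rd d, ℂ)) (η : Rd d) : Integrable (coherentIntegrand a f g η) (volume.prod volume) := by
  obtain ⟨β, hβ, hβ0, -, hbd⟩ := exists_integrable_bound_coherentIntegrand ha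
  refine Integrable.mono' ?_
    (stronglyMeasurable_coherentIntegrand ha.smooth.continuous f g η).aestronglyMeasurable
    (Filter.Eventually.of_forall (hbd f g η))
  have hF : Integrable fun x : Rd d × Rd d × Rd d =>
      Real.exp (-1 * ‖x.1 - η‖ ^ 2) * ‖f x.2.2 * g x.2.1‖ :=
    ((integrable_gauss 1 one_pos).comp_sub_right η).mul_prod (integrable_schwartz_mul f g).norm
  have hG : ∀ m : Rd d, Integrable (fun y : Rd d × Phase d =>
      Real.exp (-1 * ‖m - y.1‖ ^ 2) * β y.2) (volume.prod volume) := fun m =>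
    ((integrable_gauss 1 one_pos).comp_sub_left m).mul_prod hβ
  rw [integrable_prod_iff]
  · refine ⟨Filter.Eventually.of_forall fun x =>
      (hG ((1 / 2 : ℝ) • (x.2.2 + x.2.1))).const_mul
        (Real.exp (-1 * ‖x.1 - η‖ ^ 2) * ‖f x.2.2 * g x.2.1‖), ?_⟩
    refine (hF.mul_const ((∫ x : Rd d, Real.exp (-1 * ‖x‖ ^ 2)) * ∫ ζ, β ζ)).congr
      (Filter.Eventually.of_forall fun x => ?_)
    have h1 : ∀ y : Rd d × Phase d, ‖Real.exp (-1 * ‖x.1 - η‖ ^ 2) * ‖f x.2.2 * g x.2.1‖ *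
        (Real.exp (-1 * ‖(1 / 2 : ℝ) • (x.2.2 + x.2.1) - y.1‖ ^ 2) * β y.2)‖ =
        Real.exp (-1 * ‖x.1 - η‖ ^ 2) * ‖f x.2.2 * g x.2.1‖ *
        (Real.exp (-1 * ‖(1 / 2 : ℝ) • (x.2.2 + x.2.1) - y.1‖ ^ 2) * β y.2) := fun y =>
      Real.norm_of_nonneg (by have := hβ0 y.2; positivity)
    simp only [h1]
    rw [integral_const_mul, Measure.volume_eq_prod, integral_prod_mul
      (fun z => Real.exp (-1 * ‖(1 / 2 : ℝ) • (x.2.2 + x.2.1) - z‖ ^ 2)) β,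
      integral_sub_left_eq_self (fun z : Rd d => Real.exp (-1 * ‖z‖ ^ 2))]
  · have h1 : AEStronglyMeasurable (fun X : (Rd d × Rd d × Rd d) × (Rd d × Phase d) => β X.2.2)
        (volume.prod volume) := by
      have := (hβ.aestronglyMeasurable.comp_snd (μ := (volume : Measure (Rd d))))
      exact this.comp_snd
    have h2 : Continuous fun X : (Rd d × Rd d × Rd d) × (Rd d × Phase d) =>
      Real.exp (-1 * ‖X.1.1 - η‖ ^ 2) * ‖f X.1.2.2 * g X.1.2.1‖ := by fun_prop
    have h3 : Continuous fun X : (Rd d × Rd d × Rd d) × (Rd d × Phase d) =>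
      Real.exp (-1 * ‖(1 / 2 : ℝ) • (X.1.2.2 + X.1.2.1) - X.2.1‖ ^ 2) := by fun_prop
    exact h2.aestronglyMeasurable.mul (h3.aestronglyMeasurable.mul h1)

theorem fourier_inversion_localSymbol {a : Rd d × Rd d → ℝ} (ha : IsSymbolS00 a)
    (w : Rd d × Rd d) (v : Phase d) :
    ∫ ζ, 𝓕 (localSymbol a w) ζ * Complex.exp (Complex.I *
      ((2 * Real.pi * (inner ℝ ζ.fst v.fst + inner ℝ ζ.snd v.snd) : ℝ) : ℂ)) =
      localSymbol a w v := by
  obtain ⟨β, hβ, hβ0, hb, -⟩ := exists_integrable_bound_coherentIntegrand ha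
  obtain ⟨B, -, hB⟩ := ha.exists_symbolBound 0
  obtain ⟨D, hD, h⟩ := exists_norm_iteratedFDeriv_localSymbol_le d 0
  have hcont := (contDiff_localSymbol ha.smooth w).continuous
  have h1 : Integrable (localSymbol a w) := by
    refine (hD.const_mul (B * weight 0 0 w.1)).mono' hcont.aestronglyMeasurable
      (Filter.Eventually.of_forall fun v => ?_)
    simpa using h a ha.smooth B 0 0 le_rfl zero_le_one hB 0 le_rfl w v
  have h2 : Integrable (𝓕 (localSymbol a w)) := by
    refine hβ.mono' ?_ (Filter.Eventually.of_forall (hb w))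
    exact ((stronglyMeasurable_fourier_localSymbol ha.smooth.continuous).comp_measurable
      (by fun_prop : Measurable fun ζ : Phase d => (w.2, w.1, ζ))).aestronglyMeasurable
  have h3 := congrFun (hcont.fourierInv_fourier_eq h1 h2) v
  rw [Real.fourierInv_eq'] at h3
  rw [← h3]
  congr 1; ext ζ
  rw [smul_eq_mul, mul_comm, WithLp.prod_inner_apply, mul_comm Complex.I]
  rfl

/-- The mass of the squared window. -/
def windowMass (d : ℕ) : ℝ := ∫ x : Rd d, Real.exp (-2 * ‖x‖ ^ 2)

theorem windowMass_pos (d : ℕ) : 0 < windowMass d := by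
  unfold windowMass
  rw [integral_pos_iff_support_of_nonneg (fun x => (Real.exp_pos _).le) (integrable_gauss 2 two_pos)]
  have : Function.support (fun x : Rd d => Real.exp (-2 * ‖x‖ ^ 2)) = univ := by
    ext x; simp
  rw [this]
  exact isOpen_univ.measure_pos volume univ_nonempty

/-- Fourier inversion in `ζ` returns the symbol times a Gaussian, which combines with the explicit
Gaussian to give `exp(-2‖·‖²)` in both phase space variables. The `z`-integral of the position
factor is `windowMass d`. -/
theorem integral_coherentIntegrand_right {a : Rd d × Rd d → ℝ} (ha : IsSymbolS00 a)
    (f g : 𝓢(Rd d, ℂ)) (η : Rd d) (x : Rd d × Rd d × Rd d) :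
    ∫ y, coherentIntegrand a f g η (x, y) = windowMass d *
      (Real.exp (-2 * ‖x.1 - η‖ ^ 2) *
      (Complex.exp (Complex.I * ((inner ℝ x.1 (x.2.2 - x.2.1) : ℝ) : ℂ)) *
    ((a ((1 / 2 : ℝ) • (x.2.2 + x.2.1), x.1) : ℝ) : ℂ) * f x.2.2 * g x.2.1)) := by
  obtain ⟨β, hβ, hβ0, -, hbd⟩ := exists_integrable_bound_coherentIntegrand ha
  set m : Rd d := (1 / 2 : ℝ) • (x.2.2 + x.2.1) with hm
  have hI : Integrable (fun y => coherentIntegrand a f g η (x, y)) (volume.prod volume) := by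
    refine Integrable.mono' ((((integrable_gauss 1 one_pos).comp_sub_left m).mul_prod hβ).const_mul
      (Real.exp (-1 * ‖x.1 - η‖ ^ 2) * ‖f x.2.2 * g x.2.1‖)) ?_
      (Filter.Eventually.of_forall fun y => hbd f g η (x, y))
    exact ((stronglyMeasurable_coherentIntegrand ha.smooth.continuous f g η).comp_measurable
      (by fun_prop : Measurable fun y : Rd d × Phase d => (x, y))).aestronglyMeasurable
  rw [Measure.volume_eq_prod, integral_prod _ hI]
  have h1 : ∀ z, ∫ ζ, coherentIntegrand a f g η (x, (z, ζ)) =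
      ((Real.exp (-2 * ‖m - z‖ ^ 2) : ℝ) : ℂ) * (Real.exp (-2 * ‖x.1 - η‖ ^ 2) *
      (Complex.exp (Complex.I * ((inner ℝ x.1 (x.2.2 - x.2.1) : ℝ) : ℂ)) *
        ((a (m, x.1) : ℝ) : ℂ) * f x.2.2 * g x.2.1)) := by
    intro z
    have h2 := fourier_inversion_localSymbol ha (z, η) (WithLp.toLp 2 (m - z, x.1 - η))
    have h3 : localSymbol a (z, η) (WithLp.toLp 2 (m - z, x.1 - η)) =
        ((a (m, x.1) : ℝ) : ℂ) * ((Real.exp (-1 * ‖m - z‖ ^ 2) *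
          Real.exp (-1 * ‖x.1 - η‖ ^ 2) : ℝ) : ℂ) := by
      rw [localSymbol, WithLp.prod_norm_sq_eq_of_L2, ← Real.exp_add]
      push_cast
      simp [mul_add]
    have h4 : ∀ ζ : Phase d, coherentIntegrand a f g η (x, (z, ζ)) =
        (Complex.exp (Complex.I * ((inner ℝ x.1 (x.2.2 - x.2.1) : ℝ) : ℂ)) *
          (f x.2.2 * g x.2.1) * ((Real.exp (-1 * ‖m - z‖ ^ 2) *
          Real.exp (-1 * ‖x.1 - η‖ ^ 2) : ℝ) : ℂ)) *
        (𝓕 (localSymbol a (z, η)) ζ * Complex.exp (Complex.I *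
          ((2 * Real.pi * (inner ℝ ζ.fst (m - z) + inner ℝ ζ.snd (x.1 - η)) : ℝ) : ℂ))) := by
      intro ζ
      simp only [coherentIntegrand, ← hm]
      ring
    simp_rw [h4]
    rw [integral_const_mul]
    refine (congrArg _ (h2.trans h3)).trans ?_
    have h5 : ∀ r : ℝ, Real.exp (-2 * r) = Real.exp (-1 * r) * Real.exp (-1 * r) := fun r => by
      rw [← Real.exp_add]; ring_nf
    rw [h5, h5]
    push_cast
    ring
  simp_rw [h1]
  rw [integral_mul_const, integral_complex_ofReal,
    integral_sub_left_eq_self (fun z : Rd d => Real.exp (-2 * ‖z‖ ^ 2))]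
  rfl

/-- The constant `π^{d/2}` of the Gaussian Fourier integral. -/
def gaussConst (d : ℕ) : ℂ := ((Real.pi : ℂ) / 1) ^ ((Module.finrank ℝ (Rd d) : ℂ) / 2)

theorem integral_osc_gauss (t q η : Rd d) :
    ∫ ξ, Complex.exp (Complex.I * ((inner ℝ ξ t : ℝ) : ℂ)) *
      Complex.exp (Complex.I * ((2 * Real.pi * inner ℝ q (ξ - η) : ℝ) : ℂ)) *
      ((Real.exp (-1 * ‖ξ - η‖ ^ 2) : ℝ) : ℂ) =
    gaussConst d * (Complex.exp (Complex.I * ((inner ℝ η t : ℝ) : ℂ)) *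
      ((Real.exp (-(1 / 4) * ‖t + (2 * Real.pi) • q‖ ^ 2) : ℝ) : ℂ)) := by
  have h1 : ∀ ξ, Complex.exp (Complex.I * ((inner ℝ ξ t : ℝ) : ℂ)) *
      Complex.exp (Complex.I * ((2 * Real.pi * inner ℝ q (ξ - η) : ℝ) : ℂ)) *
      ((Real.exp (-1 * ‖ξ - η‖ ^ 2) : ℝ) : ℂ) =
      Complex.exp (Complex.I * ((inner ℝ η t : ℝ) : ℂ)) *
      (fun v : Rd d => Complex.exp (-(1 : ℂ) * ‖v‖ ^ 2 + Complex.I *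
        ((inner ℝ (t + (2 * Real.pi) • q) v : ℝ) : ℂ))) (ξ - η) := by
    intro ξ
    dsimp only
    rw [Complex.ofReal_exp, ← Complex.exp_add, ← Complex.exp_add, ← Complex.exp_add]
    congr 1
    have : (inner ℝ ξ t : ℝ) = inner ℝ η t + inner ℝ t (ξ - η) := by
      rw [inner_sub_right, real_inner_comm t ξ, real_inner_comm t η]; ring
    rw [this, inner_add_left, real_inner_smul_left]
    push_cast
    ring
  simp_rw [h1]
  rw [integral_const_mul, integral_sub_right_eq_self (fun v : Rd d => Complex.exp
      (-(1 : ℂ) * ‖v‖ ^ 2 + Complex.I * ((inner ℝ (t + (2 * Real.pi) • q) v : ℝ) : ℂ))),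
    GaussianFourier.integral_cexp_neg_mul_sq_norm_add (by simp)]
  rw [gaussConst]
  have : Complex.exp (Complex.I ^ 2 * (‖t + (2 * Real.pi) • q‖ : ℂ) ^ 2 / (4 * 1)) =
      ((Real.exp (-(1 / 4) * ‖t + (2 * Real.pi) • q‖ ^ 2) : ℝ) : ℂ) := by
    rw [Complex.ofReal_exp, Complex.I_sq]
    push_cast
    ring_nf
  rw [this]
  ring

/-- The `ξ`-integral turns the Gaussian in `ξ - η` into one in `x - x' + 2πq`. Together with the
Gaussian of the midpoint it splits into a window in `x` times a window in `x'`, so the remaining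
integral is a product. -/
theorem integral_coherentIntegrand_left {a : Rd d × Rd d → ℝ} (ha : IsSymbolS00 a)
    (f g : 𝓢(Rd d, ℂ)) (η : Rd d) (y : Rd d × Phase d) :
    ∫ x, coherentIntegrand a f g η (x, y) = gaussConst d * (symbolCoeff a (η, y) *
      (oscL (fun _ => f) (η, y) * oscR (fun _ => g) (η, y))) := by
  obtain ⟨β, hβ, hβ0, -, hbd⟩ := exists_integrable_bound_coherentIntegrand ha
  obtain ⟨z, ζ⟩ := y
  set p := ζ.fst with hp
  set q := ζ.snd with hq
  have hI : Integrable (fun x => coherentIntegrand a f g η (x, (z, ζ))) (volume.prod volume) := by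
    refine Integrable.mono' ((((integrable_gauss 1 one_pos).comp_sub_right η).mul_prod
      (integrable_schwartz_mul f g).norm).mul_const (β ζ)) ?_
      (Filter.Eventually.of_forall fun x => ?_)
    · exact ((stronglyMeasurable_coherentIntegrand ha.smooth.continuous f g η).comp_measurable
        (by fun_prop : Measurable fun x : Rd d × Rd d × Rd d =>
          (x, ((z, ζ) : Rd d × Phase d)))).aestronglyMeasurable
    · refine (hbd f g η (x, (z, ζ))).trans ?_
      gcongr
      refine mul_le_of_le_one_left (hβ0 ζ) (Real.exp_le_one_iff.2 ?_)
      nlinarith [sq_nonneg ‖(1 / 2 : ℝ) • (x.2.2 + x.2.1) - z‖]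
  rw [Measure.volume_eq_prod, integral_prod_symm _ hI]
  have h1 : ∀ P : Rd d × Rd d, ∫ ξ, coherentIntegrand a f g η ((ξ, P), (z, ζ)) =
      (gaussConst d * symbolCoeff a (η, (z, ζ))) *
      ((Complex.exp (Complex.I * ((inner ℝ (Real.pi • p - η) P.1 : ℝ) : ℂ)) *
        windowed (z + Real.pi • q) g P.1) *
      (Complex.exp (Complex.I * ((inner ℝ (η + Real.pi • p) P.2 : ℝ) : ℂ)) *
        windowed (z + -(Real.pi • q)) f P.2)) := by
    rintro ⟨x', x⟩
    set m : Rd d := (1 / 2 : ℝ) • (x + x') with hm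
    have h2 : ∀ ξ, coherentIntegrand a f g η ((ξ, (x', x)), (z, ζ)) =
        ((f x * g x') * 𝓕 (localSymbol a (z, η)) ζ *
        Complex.exp (Complex.I * ((2 * Real.pi * inner ℝ p (m - z) : ℝ) : ℂ)) *
        ((Real.exp (-1 * ‖m - z‖ ^ 2) : ℝ) : ℂ)) *
        (Complex.exp (Complex.I * ((inner ℝ ξ (x - x') : ℝ) : ℂ)) *
          Complex.exp (Complex.I * ((2 * Real.pi * inner ℝ q (ξ - η) : ℝ) : ℂ)) *
          ((Real.exp (-1 * ‖ξ - η‖ ^ 2) : ℝ) : ℂ)) := by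
      intro ξ
      simp only [coherentIntegrand, ← hm, ← hp, ← hq, mul_add, Complex.ofReal_add,
        Complex.ofReal_mul, Complex.exp_add]
      ring
    simp_rw [h2]
    rw [integral_const_mul, integral_osc_gauss, windowed_apply, windowed_apply, symbolCoeff]
    simp only [← hp]
    have hphase : Complex.exp (Complex.I * ((2 * Real.pi * inner ℝ p (m - z) : ℝ) : ℂ)) *
        Complex.exp (Complex.I * ((inner ℝ η (x - x') : ℝ) : ℂ)) =
        Complex.exp (Complex.I * ((-(2 * Real.pi * inner ℝ p z) : ℝ) : ℂ)) *
        (Complex.exp (Complex.I * ((inner ℝ (Real.pi • p - η) x' : ℝ) : ℂ)) *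
        Complex.exp (Complex.I * ((inner ℝ (η + Real.pi • p) x : ℝ) : ℂ))) := by
      rw [← Complex.exp_add, ← Complex.exp_add, ← Complex.exp_add]
      congr 1
      rw [hm]
      simp only [inner_sub_right, inner_add_right, inner_sub_left, inner_add_left,
        real_inner_smul_left, real_inner_smul_right]
      push_cast
      ring
    -- With `u`, `u'` the displacements from the two window centres, the exponents involve `u + u'`
    -- and `u - u'`, and the parallelogram law leaves `(‖u‖² + ‖u'‖²)/2`.
    have hgauss : Real.exp (-1 * ‖m - z‖ ^ 2) *
        Real.exp (-(1 / 4) * ‖x - x' + (2 * Real.pi) • q‖ ^ 2) =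
        window (z + Real.pi • q) x' * window (z + -(Real.pi • q)) x := by
      unfold window
      rw [← Real.exp_add, ← Real.exp_add]
      congr 1
      set u := x - (z + -(Real.pi • q)) with hu
      set u' := x' - (z + Real.pi • q) with hu'
      have e1 : m - z = (1 / 2 : ℝ) • (u + u') := by rw [hm, hu, hu']; module
      have e2 : x - x' + (2 * Real.pi) • q = u - u' := by rw [hu, hu']; module
      have e3 := parallelogram_law_with_norm ℝ u u'
      rw [e1, e2, norm_smul, Real.norm_of_nonneg (by norm_num)]
      nlinarith
    have hgauss' := congrArg (fun r : ℝ => (r : ℂ)) hgauss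
    simp only [Complex.ofReal_mul] at hgauss'
    calc _ = gaussConst d * (f x * g x') * 𝓕 (localSymbol a (z, η)) ζ *
        (Complex.exp (Complex.I * ((2 * Real.pi * inner ℝ p (m - z) : ℝ) : ℂ)) *
        Complex.exp (Complex.I * ((inner ℝ η (x - x') : ℝ) : ℂ))) *
        (((Real.exp (-1 * ‖m - z‖ ^ 2) : ℝ) : ℂ) *
          ((Real.exp (-(1 / 4) * ‖x - x' + (2 * Real.pi) • q‖ ^ 2) : ℝ) : ℂ)) := by ring
      _ = _ := by
        rw [hphase, hgauss']
        ring
  simp_rw [h1]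
  rw [integral_const_mul, Measure.volume_eq_prod, integral_prod_mul
    (fun x' => Complex.exp (Complex.I * ((inner ℝ (Real.pi • p - η) x' : ℝ) : ℂ)) *
        windowed (z + Real.pi • q) g x')
    (fun x => Complex.exp (Complex.I * ((inner ℝ (η + Real.pi • p) x : ℝ) : ℂ)) *
        windowed (z + -(Real.pi • q)) f x)]
  simp only [oscL, oscR, osc, ← hp, ← hq]
  ring

/-- The coherent state representation of the Weyl form. -/
theorem integral_weylInner_eq {a : Rd d × Rd d → ℝ} (ha : IsSymbolS00 a) (f g : 𝓢(Rd d, ℂ)) :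
    (windowMass d : ℂ) * (windowMass d * ∫ ξ, weylInner a f g ξ) =
      gaussConst d * ∫ τ, symbolCoeff a τ * (oscL (fun _ => f) τ * oscR (fun _ => g) τ) := by
  obtain ⟨M, hM⟩ := ha.exists_abs_le
  have hJ := integrable_weylInner ha.smooth.continuous hM f g
  -- The exchange is made at fixed `η`, since the majorant is not integrable jointly in `ξ` and `η`.
  -- The `η`-integral is taken afterwards, using integrability of `weylInner` in `ξ`, and
  -- contributes the second factor `windowMass d`.
  have hη : ∀ η, (windowMass d : ℂ) * ∫ ξ, weylInner a f g ξ *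
      ((Real.exp (-2 * ‖η - ξ‖ ^ 2) : ℝ) : ℂ) = gaussConst d * ∫ y, symbolCoeff a (η, y) *
        (oscL (fun _ => f) (η, y) * oscR (fun _ => g) (η, y)) := by
    intro η
    have hK := integrable_coherentIntegrand ha f g η
    have hsw := integral_integral_swap (f := fun x y => coherentIntegrand a f g η (x, y)) hK
    simp_rw [integral_coherentIntegrand_left ha, integral_coherentIntegrand_right ha] at hsw
    rw [integral_const_mul, integral_const_mul] at hsw
    rw [← hsw]
    congr 1
    have hL := hK.integral_prod_left
    simp_rw [integral_coherentIntegrand_right ha] at hL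
    have hL' : Integrable (fun x : Rd d × Rd d × Rd d => ((Real.exp (-2 * ‖x.1 - η‖ ^ 2) : ℝ) : ℂ) *
      (Complex.exp (Complex.I * ((inner ℝ x.1 (x.2.2 - x.2.1) : ℝ) : ℂ)) *
      ((a ((1 / 2 : ℝ) • (x.2.2 + x.2.1), x.1) : ℝ) : ℂ) * f x.2.2 * g x.2.1))
        (volume.prod volume) := by
      have h0 : (windowMass d : ℂ) ≠ 0 := by exact_mod_cast (windowMass_pos d).ne'
      have := hL.const_mul (windowMass d : ℂ)⁻¹
      refine this.congr (Filter.Eventually.of_forall fun x => ?_)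
      dsimp only
      rw [← mul_assoc, inv_mul_cancel₀ h0, one_mul]
    rw [Measure.volume_eq_prod, integral_prod _ hL']
    congr 1; ext ξ
    dsimp only
    rw [integral_const_mul, mul_comm, norm_sub_rev]
    rfl
  have hcI : Integrable (fun p : Rd d × Rd d => weylInner a f g p.2 *
      ((Real.exp (-2 * ‖p.1 - p.2‖ ^ 2) : ℝ) : ℂ)) (volume.prod volume) :=
    Integrable.convolution_integrand (ContinuousLinearMap.mul ℂ ℂ) hJ
      ((integrable_gauss 2 two_pos).ofReal (𝕜 := ℂ))
  have h1 := integral_integral_swap (f := fun η ξ : Rd d => weylInner a f g ξ *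
      ((Real.exp (-2 * ‖η - ξ‖ ^ 2) : ℝ) : ℂ)) hcI
  have h2 : ∀ ξ : Rd d, ∫ η, weylInner a f g ξ * ((Real.exp (-2 * ‖η - ξ‖ ^ 2) : ℝ) : ℂ) =
      weylInner a f g ξ * windowMass d := by
    intro ξ
    rw [integral_const_mul, integral_complex_ofReal,
      integral_sub_right_eq_self (fun η : Rd d => Real.exp (-2 * ‖η‖ ^ 2))]
    rfl
  simp_rw [h2] at h1
  rw [integral_mul_const] at h1
  have hτ := integrable_symbolCoeff_mul_osc ha f g
  rw [Measure.volume_eq_prod] at hτ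
  rw [Measure.volume_eq_prod, integral_prod _ hτ]
  refine Eq.trans ?_ ((integral_congr_ae (ae_of_all _ fun η => hη η)).trans
    (integral_const_mul _ _))
  rw [integral_const_mul, h1, mul_comm (∫ ξ, weylInner a f g ξ)]

end Representation

/-! ### Weighted boundedness and commutators with cutoffs. -/

section Estimates

variable {d : ℕ}

/-- The normalisation constant of the coherent state representation. -/
def weylConst (d : ℕ) : ℂ :=
  (((2 * Real.pi) ^ d)⁻¹ : ℝ) * (gaussConst d / ((windowMass d : ℂ) * windowMass d))

theorem weylForm_eq_coherent {a : Rd d × Rd d → ℝ} (ha : IsSymbolS00 a) (ψ φ : 𝓢(Rd d, ℂ)) :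
    weylForm a ψ φ = weylConst d * ∫ τ, symbolCoeff a τ *
      (oscL (fun _ => conjSchwartz ψ) τ * oscR (fun _ => φ) τ) := by
  have h0 : (windowMass d : ℂ) ≠ 0 := by exact_mod_cast (windowMass_pos d).ne'
  have h := integral_weylInner_eq ha (conjSchwartz ψ) φ
  rw [weylForm_eq_integral_weylInner, weylConst, mul_assoc, div_mul_eq_mul_div, ← h, ← mul_assoc,
    mul_div_cancel_left₀ _ (mul_ne_zero h0 h0)]

theorem enorm_weylConst_mul_le (d : ℕ) {C0 : ℝ≥0∞} (hC0 : C0 ≠ ⊤) {C' B : ℝ} (hC' : 0 ≤ C')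
    (X : ℝ≥0∞) : ‖weylConst d‖ₑ * (C0 * ENNReal.ofReal (C' * B) * X) ≤
      ENNReal.ofReal ((‖weylConst d‖ * C0.toReal * C') * B) * X := by
  rw [← ofReal_norm, ← ENNReal.ofReal_toReal hC0, ENNReal.ofReal_mul hC',
    ENNReal.ofReal_mul (by positivity), ENNReal.ofReal_mul (by positivity),
    ENNReal.ofReal_mul (by positivity), ENNReal.toReal_ofReal (by positivity)]
  exact le_of_eq (by ring)

theorem enorm_ofReal_of_nonneg {r : ℝ} (hr : 0 ≤ r) : ‖(r : ℂ)‖ₑ = ENNReal.ofReal r := by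
  rw [← ofReal_norm, Complex.norm_real, Real.norm_of_nonneg hr]

theorem osc_smul (c : ℂ) (f : 𝓢(Rd d, ℂ)) (y η : Rd d) :
    osc (windowed y (c • f)) η = c * osc (windowed y f) η := by
  rw [osc, osc, ← integral_const_mul]
  congr 1; ext x
  simp only [windowed_apply, smul_apply, smul_eq_mul]
  ring

theorem integrable_osc (f : 𝓢(Rd d, ℂ)) (η : Rd d) :
    Integrable fun x => Complex.exp (Complex.I * ((inner ℝ η x : ℝ) : ℂ)) * f x := by
  refine (f.integrable (μ := volume)).norm.mono' ?_ (ae_of_all _ fun x => ?_)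
  · exact Continuous.aestronglyMeasurable (by fun_prop)
  · rw [norm_mul, norm_cexp_I_mul_ofReal, one_mul]

theorem osc_sub (f g : 𝓢(Rd d, ℂ)) (y η : Rd d) :
    osc (windowed y (f - g)) η = osc (windowed y f) η - osc (windowed y g) η := by
  rw [osc, osc, osc, ← integral_sub (integrable_osc _ _) (integrable_osc _ _)]
  congr 1; ext x
  simp only [windowed_apply, sub_apply]
  ring

theorem continuous_weight (s : ℝ) (c : Rd d) : Continuous (weight s c) := by
  unfold weight; fun_prop

/-- Boundedness of Weyl forms, with a weight. -/
theorem exists_enorm_weylForm_le (d : ℕ) :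
    ∃ C : ℝ, 0 < C ∧ ∀ a : Rd d × Rd d → ℝ, IsSymbolS00 a → ∀ (B s : ℝ) (c : Rd d),
      0 ≤ s → s ≤ 1 → SymbolBound a (symbolOrder d 1) B s c → 0 ≤ B →
      ∀ (ψ φ : 𝓢(Rd d, ℂ)) (t : ℝ), 0 < t →
      ‖weylForm a ψ φ‖ₑ ≤ ENNReal.ofReal (C * B) * (ENNReal.ofReal t * (∫⁻ x, ‖ψ x‖ₑ ^ 2) +
        ENNReal.ofReal t⁻¹ * ∫⁻ x, (ENNReal.ofReal (weight s c x) * ‖φ x‖ₑ) ^ 2) := by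
  obtain ⟨C0, hC0, h0⟩ := exists_lintegral_osc_mul_le d 1
  obtain ⟨C', hC', h'⟩ := exists_norm_fourier_localSymbol_le d (symbolOrder d 1)
  refine ⟨‖weylConst d‖ * C0.toReal * C' + 1, by positivity, ?_⟩
  intro a ha B s c hs hs1 hB hB0 ψ φ t ht
  have hw := weight_pos (d := d) hs c
  have hcont := continuous_weight (d := d) s c
  have hcw : ∀ z, ((weight s c z : ℝ) : ℂ) ≠ 0 := fun z => by exact_mod_cast (hw z).ne'
  rw [weylForm_eq_coherent ha, enorm_mul]
  -- Multiply and divide by the weight at the window centre. The quotient makes the coefficient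
  -- uniformly bounded; the factor goes to `φ`, where slow variation replaces it by the weight at
  -- `x` at the price of one power of `1 + ‖x - z‖`, hence `K = 1`.
  have hI : ∀ τ, symbolCoeff a τ * (oscL (fun _ => conjSchwartz ψ) τ * oscR (fun _ => φ) τ) =
      (symbolCoeff a τ * ((weight s c τ.2.1 : ℝ) : ℂ)⁻¹) * (oscL (fun _ => conjSchwartz ψ) τ *
        oscR (fun z => ((weight s c z : ℝ) : ℂ) • φ) τ) := by
    intro τ
    rw [show oscR (fun z => ((weight s c z : ℝ) : ℂ) • φ) τ =
      ((weight s c τ.2.1 : ℝ) : ℂ) * oscR (fun _ => φ) τ from osc_smul _ _ _ _]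
    field_simp [hcw τ.2.1]
  have hmain := h0 (fun _ => conjSchwartz ψ) (fun z => ((weight s c z : ℝ) : ℂ) • φ)
    (by fun_prop) (by simp only [smul_apply]; fun_prop) (fun x => ‖ψ x‖ₑ)
    (fun x => ENNReal.ofReal (weight s c x) * ‖φ x‖ₑ) (by fun_prop)
    (by have := hcont.measurable; fun_prop) (fun z x => ?_) (fun z x => ?_) (C' * B)
    (fun τ => symbolCoeff a τ * ((weight s c τ.2.1 : ℝ) : ℂ)⁻¹) (fun τ => ?_) t ht
  · calc _ ≤ ‖weylConst d‖ₑ * _ := by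
          gcongr
          refine (enorm_integral_le_lintegral_enorm _).trans ?_
          simp_rw [hI]
          exact hmain
      _ ≤ _ := enorm_weylConst_mul_le d hC0 hC' _
      _ ≤ _ := by
          gcongr
          linarith
  · rw [conjSchwartz_apply, RCLike.enorm_conj]
    refine le_mul_of_one_le_left zero_le ?_
    rw [← ENNReal.ofReal_one]
    refine ENNReal.ofReal_le_ofReal ?_
    linarith [norm_nonneg (x - z), pow_one (1 + ‖x - z‖)]
  · rw [smul_apply, enorm_smul, enorm_ofReal_of_nonneg (hw z).le, ← mul_assoc,
      ← ENNReal.ofReal_mul (by positivity)]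
    gcongr
    rw [pow_one, mul_comm, norm_sub_rev]
    exact weight_le_mul hs hs1 c z x
  · have := h' a ha.smooth B s c hs hs1 hB (τ.2.1, τ.1) τ.2.2
    rw [norm_mul, norm_symbolCoeff, norm_inv, Complex.norm_real, Real.norm_of_nonneg (hw _).le,
      ← mul_assoc, ← div_eq_mul_inv, div_le_iff₀ (hw _)]
    calc _ ≤ _ := this
      _ = _ := by ring

/-- A smooth bump function. -/
def bump (d : ℕ) : ContDiffBump (0 : Rd d) := ⟨1, 2, one_pos, one_lt_two⟩

/-- The bump function at scale `s⁻¹` around `c`. -/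
def cutoff (s : ℝ) (c x : Rd d) : ℝ := bump d (s • (x - c))

theorem cutoff_hasTemperateGrowth (s : ℝ) (c : Rd d) :
    (fun x : Rd d => ((cutoff s c x : ℝ) : ℂ)).HasTemperateGrowth := by
  have h1 : (bump d : Rd d → ℝ).HasTemperateGrowth :=
    (bump d).hasCompactSupport.hasTemperateGrowth (bump d).contDiff
  have h2 : (fun x : Rd d => s • (x - c)).HasTemperateGrowth := by fun_prop
  exact Function.HasTemperateGrowth.comp Function.Complex.hasTemperateGrowth_ofReal (h1.comp h2)

/-- Multiplication of a Schwartz function by a cutoff. -/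
def cutoffMul (s : ℝ) (c : Rd d) (φ : 𝓢(Rd d, ℂ)) : 𝓢(Rd d, ℂ) :=
  SchwartzMap.smulLeftCLM ℂ (fun x : Rd d => ((cutoff s c x : ℝ) : ℂ)) φ

@[simp] theorem cutoffMul_apply (s : ℝ) (c : Rd d) (φ : 𝓢(Rd d, ℂ)) (x : Rd d) :
    cutoffMul s c φ x = cutoff s c x * φ x := by
  rw [cutoffMul, SchwartzMap.smulLeftCLM_apply_apply (cutoff_hasTemperateGrowth s c), smul_eq_mul]

theorem conjSchwartz_cutoffMul (s : ℝ) (c : Rd d) (φ : 𝓢(Rd d, ℂ)) :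
    conjSchwartz (cutoffMul s c φ) = cutoffMul s c (conjSchwartz φ) := by
  ext x; simp

theorem continuous_cutoff (s : ℝ) (c : Rd d) : Continuous (cutoff s c) := by
  have := (bump d).continuous
  unfold cutoff; fun_prop

theorem weight_le_three_of_cutoff_ne_zero {s : ℝ} (hs : 0 ≤ s) {c x : Rd d}
    (h : cutoff s c x ≠ 0) : weight s c x ≤ 3 := by
  have h1 : s • (x - c) ∈ Function.support (bump d) := h
  rw [(bump d).support_eq, mem_ball_zero_iff, norm_smul, Real.norm_of_nonneg hs] at h1
  have h2 : (bump d).rOut = 2 := rfl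
  rw [h2] at h1
  unfold weight
  linarith

/-- The Lipschitz constant of the bump supplies the factor `s`. The difference vanishes unless `x`
or `y` lies in the support, where the weight is at most 3; slow variation then bounds the weight at
`x` by `3(1 + ‖x - y‖)`. -/
theorem exists_cutoff_sub_le (d n : ℕ) : ∃ A : ℝ, 0 < A ∧ ∀ (s : ℝ) (c x y : Rd d), 0 ≤ s → s ≤ 1 →
    weight s c x ^ n * |cutoff s c x - cutoff s c y| ≤ s * A * (1 + ‖x - y‖) ^ (n + 1) := by
  obtain ⟨L, hL⟩ := ContDiff.lipschitzWith_of_hasCompactSupport (bump d).hasCompactSupport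
    ((bump d).contDiff (n := 1)) one_ne_zero
  refine ⟨3 ^ n * (L + 1), by positivity, fun s c x y hs hs1 => ?_⟩
  have hL' : |cutoff s c x - cutoff s c y| ≤ (L + 1) * (s * ‖x - y‖) := by
    have h1 := hL.dist_le_mul (s • (x - c)) (s • (y - c))
    rw [Real.dist_eq, dist_eq_norm, ← smul_sub, norm_smul, Real.norm_of_nonneg hs,
      sub_sub_sub_cancel_right] at h1
    refine h1.trans ?_
    gcongr
    linarith
  have hxy : 1 ≤ 1 + ‖x - y‖ := by linarith [norm_nonneg (x - y)]
  have key : weight s c x ^ n ≤ (3 * (1 + ‖x - y‖)) ^ n →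
      weight s c x ^ n * |cutoff s c x - cutoff s c y| ≤
        s * (3 ^ n * (L + 1)) * (1 + ‖x - y‖) ^ (n + 1) := by
    intro hw
    calc _ ≤ (3 * (1 + ‖x - y‖)) ^ n * ((L + 1) * (s * (1 + ‖x - y‖))) := by
          refine mul_le_mul hw (hL'.trans ?_) (abs_nonneg _) (by positivity)
          gcongr
          linarith
      _ = _ := by rw [mul_pow, pow_succ]; ring
  have hw0 := (weight_pos hs c x).le
  by_cases hx : cutoff s c x = 0
  · by_cases hy : cutoff s c y = 0
    · rw [hx, hy, sub_zero, abs_zero, mul_zero]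
      positivity
    · refine key (pow_le_pow_left₀ hw0 ?_ n)
      refine (weight_le_mul hs hs1 c x y).trans ?_
      gcongr
      exact weight_le_three_of_cutoff_ne_zero hs hy
  · refine key (pow_le_pow_left₀ hw0 ?_ n)
    have := weight_le_three_of_cutoff_ne_zero hs hx
    nlinarith

/-- Almost locality of Weyl forms: the commutator with a cutoff at scale `s⁻¹` is of order `s`
and localised. -/
theorem exists_enorm_weylForm_commutator_le (d n : ℕ) :
    ∃ C A : ℝ, 0 < C ∧ 0 < A ∧ ∀ a : Rd d × Rd d → ℝ, IsSymbolS00 a → ∀ B : ℝ,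
      SymbolBound a (symbolOrder d (n + 1)) B 0 0 → 0 ≤ B →
      ∀ (s : ℝ) (c : Rd d), 0 < s → s ≤ 1 → ∀ (ψ φ : 𝓢(Rd d, ℂ)) (t : ℝ), 0 < t →
      ‖weylForm a ψ (cutoffMul s c φ) - weylForm a (cutoffMul s c ψ) φ‖ₑ ≤
        ENNReal.ofReal (C * B) * (ENNReal.ofReal t * (∫⁻ x, ‖ψ x‖ₑ ^ 2) +
        ENNReal.ofReal t⁻¹ * ∫⁻ x, (ENNReal.ofReal (s * A * (weight s c x ^ n)⁻¹) *
          ‖φ x‖ₑ) ^ 2) := by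
  obtain ⟨C0, hC0, h0⟩ := exists_lintegral_osc_mul_le d (n + 1)
  obtain ⟨C', hC', h'⟩ := exists_norm_fourier_localSymbol_le d (symbolOrder d (n + 1))
  obtain ⟨A, hA, hcut⟩ := exists_cutoff_sub_le d n
  refine ⟨2 * (‖weylConst d‖ * C0.toReal * C') + 1, A, by positivity, hA, ?_⟩
  intro a ha B hB hB0 s c hs hs1 ψ φ t ht
  have hw := weight_pos (d := d) hs.le c
  have hcw := continuous_weight (d := d) s c
  have hcc := continuous_cutoff (d := d) s c
  have hwn : ∀ z, weight s c z ^ n ≠ 0 := fun z => (pow_pos (hw z) n).ne'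
  set f := conjSchwartz ψ with hf
  -- When the cutoff difference falls on `ψ`, its smallness and decay, frozen at `z`, are
  -- transferred to `φ`: `P2` is multiplied by `r z` and `R2` by its inverse. Both error terms then
  -- have the same majorants.
  set r : Rd d → ℂ := fun z => ((weight s c z ^ n / (s * A) : ℝ) : ℂ) with hr
  have hr0 : ∀ z, r z ≠ 0 := fun z => by
    simp only [hr]
    exact_mod_cast div_ne_zero (hwn z) (by positivity)
  set R1 : Rd d → 𝓢(Rd d, ℂ) := fun z => cutoffMul s c φ - (cutoff s c z : ℂ) • φ with hR1
  set P2 : Rd d → 𝓢(Rd d, ℂ) := fun z => r z • (cutoffMul s c f - (cutoff s c z : ℂ) • f) with hP2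
  set R2 : Rd d → 𝓢(Rd d, ℂ) := fun z => (r z)⁻¹ • φ with hR2
  have hb : ∀ τ, (1 + ‖τ.2.2‖) ^ symbolOrder d (n + 1) * ‖symbolCoeff a τ‖ ≤ C' * B := by
    intro τ
    rw [norm_symbolCoeff]
    have := h' a ha.smooth B 0 0 le_rfl zero_le_one hB (τ.2.1, τ.1) τ.2.2
    rwa [weight_zero, mul_one] at this
  have hrc : Continuous r := by
    simp only [hr]
    fun_prop
  have hv : Measurable fun x => ENNReal.ofReal (s * A * (weight s c x ^ n)⁻¹) * ‖φ x‖ₑ := by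
    have := hcw.measurable
    fun_prop
  have hone : ∀ y : ℝ, 0 ≤ y → ∀ k : ℕ, 1 ≤ ENNReal.ofReal ((1 + y) ^ k) := fun y hy k => by
    rw [← ENNReal.ofReal_one]
    exact ENNReal.ofReal_le_ofReal (one_le_pow₀ (by linarith))
  have hdiff : ∀ (z x : Rd d) (h : 𝓢(Rd d, ℂ)),
      (cutoffMul s c h - (cutoff s c z : ℂ) • h) x = ((cutoff s c x - cutoff s c z : ℝ) : ℂ) * h x := by
    intro z x h
    simp only [sub_apply, smul_apply, cutoffMul_apply, smul_eq_mul]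
    push_cast; ring
  have hm1 := h0 (fun _ => f) R1 (by fun_prop)
    (by simp only [hR1, hdiff]; fun_prop) (fun x => ‖ψ x‖ₑ)
    (fun x => ENNReal.ofReal (s * A * (weight s c x ^ n)⁻¹) * ‖φ x‖ₑ) (by fun_prop) hv
    (fun z x => ?_) (fun z x => ?_) (C' * B) (symbolCoeff a) hb t ht
  · have hm2 := h0 P2 R2
      (by simp only [hP2, smul_apply, hdiff]; fun_prop)
      (by simp only [hR2, smul_apply]
          exact ((hrc.comp continuous_fst).inv₀ fun p => hr0 _).smul
            (φ.continuous.comp continuous_snd))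
      (fun x => ‖ψ x‖ₑ)
      (fun x => ENNReal.ofReal (s * A * (weight s c x ^ n)⁻¹) * ‖φ x‖ₑ) (by fun_prop) hv
      (fun z x => ?_) (fun z x => ?_) (C' * B) (symbolCoeff a) hb t ht
    · rw [weylForm_eq_coherent ha, weylForm_eq_coherent ha, conjSchwartz_cutoffMul, ← hf,
        ← mul_sub, ← integral_sub (integrable_symbolCoeff_mul_osc ha _ _)
          (integrable_symbolCoeff_mul_osc ha _ _), enorm_mul]
      -- The value of the cutoff at the common window centre is subtracted on both sides; these
      -- scalar terms cancel, so only differences of the cutoff remain.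
      have hI : ∀ τ, symbolCoeff a τ * (oscL (fun _ => f) τ * oscR (fun _ => cutoffMul s c φ) τ) -
          symbolCoeff a τ * (oscL (fun _ => cutoffMul s c f) τ * oscR (fun _ => φ) τ) =
          symbolCoeff a τ * (oscL (fun _ => f) τ * oscR R1 τ) -
          symbolCoeff a τ * (oscL P2 τ * oscR R2 τ) := by
        intro τ
        have e1 : oscR R1 τ = oscR (fun _ => cutoffMul s c φ) τ -
            (cutoff s c τ.2.1 : ℂ) * oscR (fun _ => φ) τ := by
          simp only [oscR, hR1, osc_sub, osc_smul]
        have e2 : oscL P2 τ = r τ.2.1 * (oscL (fun _ => cutoffMul s c f) τ -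
            (cutoff s c τ.2.1 : ℂ) * oscL (fun _ => f) τ) := by
          simp only [oscL, hP2, osc_sub, osc_smul]
        have e3 : oscR R2 τ = (r τ.2.1)⁻¹ * oscR (fun _ => φ) τ := by
          simp only [oscR, hR2, osc_smul]
        rw [e1, e2, e3]
        field_simp [hr0 τ.2.1]
        ring
      simp_rw [hI]
      set X := ENNReal.ofReal t * (∫⁻ x, ‖ψ x‖ₑ ^ 2) +
        ENNReal.ofReal t⁻¹ * ∫⁻ x, (ENNReal.ofReal (s * A * (weight s c x ^ n)⁻¹) * ‖φ x‖ₑ) ^ 2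
      have hmeas : Measurable fun τ => ‖symbolCoeff a τ * (oscL (fun _ => f) τ * oscR R1 τ)‖ₑ := by
        refine ((stronglyMeasurable_symbolCoeff ha.smooth.continuous).mul
          ((stronglyMeasurable_oscL _ (by fun_prop)).mul
            (stronglyMeasurable_oscR _ ?_))).measurable.enorm
        simp only [hR1, hdiff]; fun_prop
      calc _ ≤ ‖weylConst d‖ₑ * ∫⁻ τ, (‖symbolCoeff a τ * (oscL (fun _ => f) τ * oscR R1 τ)‖ₑ +
            ‖symbolCoeff a τ * (oscL P2 τ * oscR R2 τ)‖ₑ) := by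
            gcongr
            exact (enorm_integral_le_lintegral_enorm _).trans
              (lintegral_mono fun τ => enorm_sub_le)
        _ ≤ ‖weylConst d‖ₑ * (C0 * ENNReal.ofReal (C' * B) * X) +
            ‖weylConst d‖ₑ * (C0 * ENNReal.ofReal (C' * B) * X) := by
            rw [lintegral_add_left hmeas, mul_add]
            gcongr
        _ ≤ ENNReal.ofReal ((‖weylConst d‖ * C0.toReal * C') * B) * X +
            ENNReal.ofReal ((‖weylConst d‖ * C0.toReal * C') * B) * X := by
            exact add_le_add (enorm_weylConst_mul_le d hC0 hC' _)
              (enorm_weylConst_mul_le d hC0 hC' _)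
        _ ≤ _ := by
            rw [← add_mul, ← ENNReal.ofReal_add (by positivity) (by positivity)]
            gcongr
            nlinarith
    · simp only [hP2]
      rw [smul_apply, hdiff, enorm_smul, enorm_mul, hf, conjSchwartz_apply,
        RCLike.enorm_conj, ← mul_assoc]
      gcongr
      rw [← ofReal_norm, ← ofReal_norm, ← ENNReal.ofReal_mul (norm_nonneg _)]
      refine ENNReal.ofReal_le_ofReal ?_
      simp only [hr]
      rw [Complex.norm_real, Complex.norm_real, Real.norm_eq_abs, Real.norm_eq_abs, abs_div,
        abs_of_pos (by positivity : 0 < s * A), abs_of_pos (pow_pos (hw z) n), div_mul_eq_mul_div,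
        div_le_iff₀ (by positivity), abs_sub_comm, norm_sub_rev]
      have := hcut s c z x hs.le hs1
      linarith
    · simp only [hR2]
      rw [smul_apply, enorm_smul, ← mul_assoc]
      gcongr
      rw [← ofReal_norm, ← ENNReal.ofReal_mul (by positivity)]
      refine ENNReal.ofReal_le_ofReal ?_
      simp only [hr]
      rw [norm_inv, Complex.norm_real, Real.norm_eq_abs, abs_div,
        abs_of_pos (by positivity : 0 < s * A), abs_of_pos (pow_pos (hw z) n), inv_div]
      have h1 : weight s c x ^ n ≤ weight s c z ^ n * (1 + ‖x - z‖) ^ (n + 1) := by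
        calc _ ≤ (weight s c z * (1 + ‖x - z‖)) ^ n :=
              pow_le_pow_left₀ (hw x).le (weight_le_mul hs.le hs1 c x z) n
          _ ≤ _ := by
              rw [mul_pow]
              have := pow_le_pow_right₀ (by linarith [norm_nonneg (x - z)] : 1 ≤ 1 + ‖x - z‖)
                (Nat.le_succ n)
              have := (pow_pos (hw z) n).le
              gcongr
      rw [div_le_iff₀ (pow_pos (hw z) n)]
      have h2 := pow_pos (hw x) n
      calc s * A = s * A * (weight s c x ^ n)⁻¹ * weight s c x ^ n := by field_simp
        _ ≤ s * A * (weight s c x ^ n)⁻¹ * (weight s c z ^ n * (1 + ‖x - z‖) ^ (n + 1)) := by gcongr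
        _ = _ := by ring
  · rw [hf, conjSchwartz_apply, RCLike.enorm_conj]
    exact le_mul_of_one_le_left zero_le (hone _ (norm_nonneg _) _)
  · simp only [hR1]
    rw [hdiff, enorm_mul, ← mul_assoc]
    gcongr
    rw [← ofReal_norm, ← ENNReal.ofReal_mul (by positivity), Complex.norm_real, Real.norm_eq_abs]
    refine ENNReal.ofReal_le_ofReal ?_
    have h1 := hcut s c x z hs.le hs1
    have h2 := pow_pos (hw x) n
    calc |cutoff s c x - cutoff s c z|
        = (weight s c x ^ n)⁻¹ * (weight s c x ^ n * |cutoff s c x - cutoff s c z|) := by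
          field_simp
      _ ≤ (weight s c x ^ n)⁻¹ * (s * A * (1 + ‖x - z‖) ^ (n + 1)) := by gcongr
      _ = _ := by ring

end Estimates

/-! ### From Weyl forms to bounded self-adjoint operators. -/

section Operators

variable {d : ℕ}

theorem IsSymbolS00.sub {a b : Rd d × Rd d → ℝ} (ha : IsSymbolS00 a) (hb : IsSymbolS00 b) :
    IsSymbolS00 (a - b) where
  smooth := ha.smooth.sub hb.smooth
  bounded n := by
    obtain ⟨A, hA⟩ := ha.bounded n
    obtain ⟨B, hB⟩ := hb.bounded n
    refine ⟨A + B, fun p => ?_⟩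
    rw [iteratedFDeriv_sub_apply
      ((ha.smooth.of_le (by exact_mod_cast le_top)).contDiffAt)
      ((hb.smooth.of_le (by exact_mod_cast le_top)).contDiffAt)]
    exact (norm_sub_le _ _).trans (add_le_add (hA p) (hB p))

theorem lintegral_enorm_sq_eq_toLp (ψ : 𝓢(Rd d, ℂ)) :
    ∫⁻ x, ‖ψ x‖ₑ ^ 2 = ‖ψ.toLp 2 volume‖ₑ ^ 2 := by
  have h := lintegral_rpow_enorm_eq_rpow_eLpNorm' (μ := volume) (f := (ψ : Rd d → ℂ))
    (q := 2) (by norm_num)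
  have h2 : ‖ψ.toLp 2 volume‖ₑ = eLpNorm ψ 2 volume := by
    rw [SchwartzMap.toLp, Lp.enorm_toLp]
  rw [h2, eLpNorm_eq_eLpNorm' (by norm_num) (by norm_num)]
  simpa using h

/-- The symbol is real and the midpoint is symmetric, so conjugation only exchanges `x` and `x'`. -/
theorem conj_weylForm (a : Rd d × Rd d → ℝ) (ψ φ : 𝓢(Rd d, ℂ)) :
    conj (weylForm a φ ψ) = weylForm a ψ φ := by
  unfold weylForm
  rw [map_mul, Complex.conj_ofReal, ← integral_conj]
  congr 2
  ext ξ
  rw [← integral_conj, Measure.volume_eq_prod, ← integral_prod_swap]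
  congr 1
  ext p
  simp only [Prod.fst_swap, Prod.snd_swap, map_mul, ← Complex.exp_conj, Complex.conj_ofReal,
    Complex.conj_conj, Complex.conj_I]
  have h1 : -Complex.I * ((inner ℝ ξ (p.1 - p.2) : ℝ) : ℂ) =
      Complex.I * ((inner ℝ ξ (p.2 - p.1) : ℝ) : ℂ) := by
    rw [← neg_sub p.2 p.1, inner_neg_right]; push_cast; ring
  rw [h1, add_comm p.1 p.2]
  ring

theorem weylForm_add_right {a : Rd d × Rd d → ℝ} (ha : IsSymbolS00 a) (ψ φ φ' : 𝓢(Rd d, ℂ)) :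
    weylForm a ψ (φ + φ') = weylForm a ψ φ + weylForm a ψ φ' := by
  obtain ⟨M, hM⟩ := ha.exists_abs_le
  have hc := ha.smooth.continuous
  simp only [weylForm_eq_integral_weylInner]
  rw [← mul_add, ← integral_add (integrable_weylInner hc hM _ _) (integrable_weylInner hc hM _ _)]
  congr 2
  ext ξ
  unfold weylInner
  rw [← integral_add (integrable_weyl_integrand hc hM _ _ ξ) (integrable_weyl_integrand hc hM _ _ ξ)]
  congr 1
  ext p
  simp only [add_apply]
  ring

theorem weylForm_smul_right (a : Rd d × Rd d → ℝ) (c : ℂ) (ψ φ : 𝓢(Rd d, ℂ)) :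
    weylForm a ψ (c • φ) = c * weylForm a ψ φ := by
  simp only [weylForm_eq_integral_weylInner]
  rw [mul_left_comm]
  congr 1
  rw [← integral_const_mul]
  congr 1
  ext ξ
  unfold weylInner
  rw [← integral_const_mul]
  congr 1
  ext p
  simp only [smul_apply, smul_eq_mul]
  ring

theorem weylForm_sub_symbol {a b : Rd d × Rd d → ℝ} (ha : IsSymbolS00 a) (hb : IsSymbolS00 b)
    (ψ φ : 𝓢(Rd d, ℂ)) : weylForm (a - b) ψ φ = weylForm a ψ φ - weylForm b ψ φ := by
  obtain ⟨M, hM⟩ := ha.exists_abs_le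
  obtain ⟨M', hM'⟩ := hb.exists_abs_le
  have hc := ha.smooth.continuous
  have hc' := hb.smooth.continuous
  simp only [weylForm_eq_integral_weylInner]
  rw [← mul_sub, ← integral_sub (integrable_weylInner hc hM _ _) (integrable_weylInner hc' hM' _ _)]
  congr 2
  ext ξ
  unfold weylInner
  rw [← integral_sub (integrable_weyl_integrand hc hM _ _ ξ)
    (integrable_weyl_integrand hc' hM' _ _ ξ)]
  congr 1
  ext p
  simp only [Pi.sub_apply]
  push_cast
  ring

/-- Shifting both position variables by `v` moves the midpoint by `v` and leaves the phase
unchanged. -/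
theorem weylForm_translate (a : Rd d × Rd d → ℝ) (v : Rd d) (ψ φ : 𝓢(Rd d, ℂ)) :
    weylForm (fun p => a (p.1 + v, p.2)) ψ φ =
      weylForm a (SchwartzMap.compSubConstCLM ℂ v ψ) (SchwartzMap.compSubConstCLM ℂ v φ) := by
  unfold weylForm
  congr 2
  ext ξ
  have : (volume : Measure (Rd d × Rd d)).IsAddRightInvariant := by
    rw [Measure.volume_eq_prod]; infer_instance
  conv_rhs => rw [← integral_add_right_eq_self _ ((v, v) : Rd d × Rd d)]
  congr 1
  ext p
  have h1 : (1 / 2 : ℝ) • (p.2 + v + (p.1 + v)) = (1 / 2 : ℝ) • (p.2 + p.1) + v := by module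
  simp only [Prod.fst_add, Prod.snd_add, h1, SchwartzMap.compSubConstCLM_apply,
    add_sub_cancel_right, add_sub_add_right_eq_sub]

/-- Optimisation at `t = v/u`, with both norms perturbed by a small `e` to cover the cases where one
of them vanishes. -/
theorem le_two_mul_of_forall_pos {x c u v : ℝ} (hc : 0 ≤ c) (hu : 0 ≤ u) (hv : 0 ≤ v)
    (h : ∀ t : ℝ, 0 < t → x ≤ c * (t * u ^ 2 + t⁻¹ * v ^ 2)) : x ≤ 2 * c * u * v := by
  refine le_of_forall_pos_le_add fun ε hε => ?_
  obtain ⟨e, he, hle⟩ : ∃ e : ℝ, 0 < e ∧ c * e * (u + v) ≤ ε := by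
    refine ⟨ε / (c * (u + v) + 1), by positivity, ?_⟩
    rw [show c * (ε / (c * (u + v) + 1)) * (u + v) = ε * (c * (u + v)) / (c * (u + v) + 1) by ring,
      div_le_iff₀ (by positivity)]
    nlinarith
  have ht := h ((v + e) / (u + e)) (by positivity)
  have h1 : (v + e) / (u + e) * u ^ 2 ≤ (v + e) * u := by
    rw [div_mul_eq_mul_div, div_le_iff₀ (by positivity)]
    nlinarith [mul_nonneg hu he.le, mul_nonneg (mul_nonneg hu he.le) (add_nonneg hv he.le)]
  have h2 : ((v + e) / (u + e))⁻¹ * v ^ 2 ≤ (u + e) * v := by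
    rw [inv_div, div_mul_eq_mul_div, div_le_iff₀ (by positivity)]
    nlinarith [mul_nonneg hv he.le, mul_nonneg (mul_nonneg hv he.le) (add_nonneg hu he.le)]
  calc x ≤ c * ((v + e) * u + (u + e) * v) := ht.trans (by gcongr)
    _ = 2 * c * u * v + c * e * (u + v) := by ring
    _ ≤ _ := by gcongr

/-- Calderón–Vaillancourt bound for the Weyl form. -/
theorem exists_norm_weylForm_le (d : ℕ) :
    ∃ C : ℝ, 0 < C ∧ ∀ a : Rd d × Rd d → ℝ, IsSymbolS00 a → ∀ B : ℝ, 0 ≤ B →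
      SymbolBound a (symbolOrder d 1) B 0 0 → ∀ ψ φ : 𝓢(Rd d, ℂ),
        ‖weylForm a ψ φ‖ ≤ C * B * ‖ψ.toLp 2 volume‖ * ‖φ.toLp 2 volume‖ := by
  obtain ⟨C, hC, h⟩ := exists_enorm_weylForm_le d
  refine ⟨2 * C, by positivity, fun a ha B hB hab ψ φ => ?_⟩
  have := le_two_mul_of_forall_pos (x := ‖weylForm a ψ φ‖) (c := C * B) (by positivity)
    (norm_nonneg (ψ.toLp 2 volume)) (norm_nonneg (φ.toLp 2 volume)) fun t ht => ?_
  · linarith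
  · have h1 := h a ha B 0 0 le_rfl zero_le_one hab hB ψ φ t ht
    simp only [weight_zero, ENNReal.ofReal_one, one_mul, lintegral_enorm_sq_eq_toLp] at h1
    simp only [← ofReal_norm] at h1
    rw [← ENNReal.ofReal_pow (norm_nonneg _), ← ENNReal.ofReal_pow (norm_nonneg _),
      ← ENNReal.ofReal_mul ht.le, ← ENNReal.ofReal_mul (by positivity),
      ← ENNReal.ofReal_add (by positivity) (by positivity), ← ENNReal.ofReal_mul (by positivity)] at h1
    exact (ENNReal.ofReal_le_ofReal_iff (by positivity)).1 h1

theorem denseRange_toLp : DenseRange (fun f : 𝓢(Rd d, ℂ) => (f.toLp 2 volume : L2Rd d)) :=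
  SchwartzMap.denseRange_toLpCLM (by simp)

/-- For fixed `φ`, the linear functional `ψ ↦ weylForm a φ ψ` extends to `L²` and is represented by
a vector `g φ`. Hermitian symmetry makes `g φ` linear in `φ` and gives it the required matrix
elements; a second extension by density produces the operator. -/
theorem exists_isWeylQuantization_of_bound {a : Rd d × Rd d → ℝ} (ha : IsSymbolS00 a) {N : ℝ}
    (hN : 0 ≤ N)
    (h : ∀ ψ φ : 𝓢(Rd d, ℂ), ‖weylForm a ψ φ‖ ≤ N * ‖ψ.toLp 2 volume‖ * ‖φ.toLp 2 volume‖) :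
    ∃ T : L2Rd d →L[ℂ] L2Rd d, IsWeylQuantization a T ∧ ‖T‖ ≤ N := by
  set e : 𝓢(Rd d, ℂ) →ₗ[ℂ] L2Rd d := (SchwartzMap.toLpCLM ℂ ℂ 2 volume).toLinearMap with he
  have hd : DenseRange e := denseRange_toLp
  let f (φ : 𝓢(Rd d, ℂ)) : 𝓢(Rd d, ℂ) →ₗ[ℂ] ℂ :=
    { toFun := fun ψ => weylForm a φ ψ
      map_add' := weylForm_add_right ha φ
      map_smul' := fun c ψ => weylForm_smul_right a c φ ψ }
  have hf : ∀ φ ψ, ‖f φ ψ‖ ≤ (N * ‖φ.toLp 2 volume‖) * ‖e ψ‖ := fun φ ψ => h φ ψ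
  let l (φ : 𝓢(Rd d, ℂ)) : L2Rd d →L[ℂ] ℂ := (f φ).extendOfNorm e
  have hl : ∀ φ ψ, l φ (e ψ) = weylForm a φ ψ := fun φ ψ =>
    LinearMap.extendOfNorm_eq hd ⟨_, hf φ⟩ ψ
  let g (φ : 𝓢(Rd d, ℂ)) : L2Rd d := (InnerProductSpace.toDual ℂ (L2Rd d)).symm (l φ)
  have hg : ∀ φ ψ : 𝓢(Rd d, ℂ), inner ℂ (e ψ) (g φ) = weylForm a ψ φ := fun φ ψ => by
    rw [← inner_conj_symm, InnerProductSpace.toDual_symm_apply, hl, conj_weylForm]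
  have hext : ∀ x y : L2Rd d, (∀ ψ : 𝓢(Rd d, ℂ), inner ℂ (e ψ) x = inner ℂ (e ψ) y) → x = y := by
    intro x y hxy
    refine ext_inner_left ℂ fun z => ?_
    exact congrFun (hd.equalizer (g := fun z : L2Rd d => inner ℂ z x)
      (h := fun z : L2Rd d => inner ℂ z y) (by fun_prop) (by fun_prop) (funext hxy)) z
  let G : 𝓢(Rd d, ℂ) →ₗ[ℂ] L2Rd d :=
    { toFun := g
      map_add' := fun φ φ' => hext _ _ fun ψ => by
        rw [inner_add_right, hg, hg, hg, weylForm_add_right ha]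
      map_smul' := fun c φ => hext _ _ fun ψ => by
        rw [RingHom.id_apply, inner_smul_right, hg, hg, weylForm_smul_right] }
  have hG : ∀ φ, ‖G φ‖ ≤ N * ‖e φ‖ := fun φ => by
    have h1 : ‖G φ‖ = ‖l φ‖ := (InnerProductSpace.toDual ℂ (L2Rd d)).symm.norm_map (l φ)
    rw [h1]
    exact LinearMap.opNorm_extendOfNorm_le hd (by positivity) (hf φ)
  refine ⟨G.extendOfNorm e, fun ψ φ => ?_, LinearMap.opNorm_extendOfNorm_le hd hN hG⟩
  have h2 : G.extendOfNorm e (e φ) = G φ := LinearMap.extendOfNorm_eq hd ⟨N, hG⟩ φ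
  exact (congrArg _ h2).trans (hg φ ψ)

theorem IsWeylQuantization.isSelfAdjoint {a : Rd d × Rd d → ℝ} {T : L2Rd d →L[ℂ] L2Rd d}
    (hT : IsWeylQuantization a T) : IsSelfAdjoint T := by
  refine IsWeylQuantization.unique (a := a) (fun ψ φ => ?_) hT
  rw [ContinuousLinearMap.star_eq_adjoint, ContinuousLinearMap.adjoint_inner_right,
    ← inner_conj_symm, hT, conj_weylForm]

theorem IsSymbolS00.isWeylQuantization_weylOp {a : Rd d × Rd d → ℝ} (ha : IsSymbolS00 a) :
    IsWeylQuantization a (weylOp a) := by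
  obtain ⟨C, hC, h⟩ := exists_norm_weylForm_le d
  obtain ⟨B, hB, hab⟩ := ha.exists_symbolBound (symbolOrder d 1)
  obtain ⟨T, hT, -⟩ := exists_isWeylQuantization_of_bound ha (by positivity) (h a ha B hB hab)
  rwa [hT.weylOp_eq]

theorem exists_norm_weylOp_le (d : ℕ) :
    ∃ C : ℝ, 0 < C ∧ ∀ a : Rd d × Rd d → ℝ, IsSymbolS00 a → ∀ B : ℝ, 0 ≤ B →
      SymbolBound a (symbolOrder d 1) B 0 0 → ‖weylOp a‖ ≤ C * B := by
  obtain ⟨C, hC, h⟩ := exists_norm_weylForm_le d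
  refine ⟨C, hC, fun a ha B hB hab => ?_⟩
  obtain ⟨T, hT, hTn⟩ := exists_isWeylQuantization_of_bound ha (by positivity) (h a ha B hB hab)
  rwa [hT.weylOp_eq]

theorem exists_toLp_ne_zero : ∃ ψ : 𝓢(Rd d, ℂ), ψ.toLp 2 volume ≠ 0 := by
  let ψ : 𝓢(Rd d, ℂ) := SchwartzMap.postcompCLM Complex.ofRealCLM
    (gaussianSchwartz (W := Rd d) 1 one_pos)
  refine ⟨ψ, fun h => ?_⟩
  have h3 : ψ = 0 := SchwartzMap.injective_toLp 2 volume h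
  have h4 : ψ 0 = 0 := by rw [h3]; rfl
  simp [ψ] at h4

theorem norm_le_of_forall_inner_le {h : L2Rd d} {N : ℝ}
    (hh : ∀ ψ : 𝓢(Rd d, ℂ), ‖inner ℂ (ψ.toLp 2 volume) h‖ ≤ N * ‖ψ.toLp 2 volume‖) : ‖h‖ ≤ N := by
  have h1 : ∀ g : L2Rd d, ‖inner ℂ g h‖ ≤ N * ‖g‖ := fun g => by
    refine denseRange_toLp.induction_on (p := fun g : L2Rd d => ‖inner ℂ g h‖ ≤ N * ‖g‖) g
      (isClosed_le (by fun_prop) (by fun_prop)) hh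
  have h2 := h1 h
  rw [inner_self_eq_norm_sq_to_K, norm_pow, RCLike.norm_ofReal, abs_norm, sq] at h2
  rcases (norm_nonneg h).eq_or_lt with h0 | h0
  · rw [← h0]
    obtain ⟨ψ, hψ⟩ := exists_toLp_ne_zero (d := d)
    exact nonneg_of_mul_nonneg_left ((norm_nonneg _).trans (hh ψ)) (norm_pos_iff.2 hψ)
  · exact le_of_mul_le_mul_right h2 h0

/-- By density the bound may be tested on `h` itself; with `t = 1/(2c)` half of `‖h‖²` is absorbed
on the left. -/
theorem enorm_sq_le_of_forall_inner_le {h : L2Rd d} {c : ℝ} (hc : 0 < c) {Y : ℝ≥0∞}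
    (hh : ∀ (ψ : 𝓢(Rd d, ℂ)) (t : ℝ), 0 < t → ‖inner ℂ (ψ.toLp 2 volume) h‖ₑ ≤
      ENNReal.ofReal c * (ENNReal.ofReal t * ‖ψ.toLp 2 volume‖ₑ ^ 2 + ENNReal.ofReal t⁻¹ * Y)) :
    ‖h‖ₑ ^ 2 ≤ ENNReal.ofReal (4 * c ^ 2) * Y := by
  rcases eq_or_ne Y ⊤ with rfl | hY
  · rw [ENNReal.mul_top (by simpa using hc.ne')]; exact le_top
  lift Y to NNReal using hY
  have h0 : ∀ (ψ : 𝓢(Rd d, ℂ)) (t : ℝ), 0 < t → ‖inner ℂ (ψ.toLp 2 volume) h‖ ≤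
      c * (t * ‖ψ.toLp 2 volume‖ ^ 2 + t⁻¹ * Y) := fun ψ t ht => by
    have h1 := hh ψ t ht
    simp only [← ofReal_norm] at h1
    rw [← ENNReal.ofReal_coe_nnreal, ← ENNReal.ofReal_pow (norm_nonneg _),
      ← ENNReal.ofReal_mul ht.le, ← ENNReal.ofReal_mul (by positivity),
      ← ENNReal.ofReal_add (by positivity) (by positivity), ← ENNReal.ofReal_mul (by positivity)] at h1
    exact (ENNReal.ofReal_le_ofReal_iff (by positivity)).1 h1
  have h1 : ∀ g : L2Rd d, ‖inner ℂ g h‖ ≤ c * ((2 * c)⁻¹ * ‖g‖ ^ 2 + (2 * c)⁻¹⁻¹ * Y) := fun g => by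
    refine denseRange_toLp.induction_on
      (p := fun g : L2Rd d => ‖inner ℂ g h‖ ≤ c * ((2 * c)⁻¹ * ‖g‖ ^ 2 + (2 * c)⁻¹⁻¹ * Y)) g
      (isClosed_le (by fun_prop) (by fun_prop)) fun ψ => h0 ψ _ (by positivity)
  have h2 := h1 h
  rw [inner_self_eq_norm_sq_to_K, norm_pow, RCLike.norm_ofReal, abs_norm] at h2
  have h3 : c * ((2 * c)⁻¹ * ‖h‖ ^ 2 + (2 * c)⁻¹⁻¹ * Y) = ‖h‖ ^ 2 / 2 + 2 * c ^ 2 * Y := by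
    field_simp
  rw [h3] at h2
  rw [← ofReal_norm, ← ENNReal.ofReal_coe_nnreal, ← ENNReal.ofReal_pow (norm_nonneg _),
    ← ENNReal.ofReal_mul (by positivity)]
  exact ENNReal.ofReal_le_ofReal (by linarith)

theorem norm_toLp_compSubConst (v : Rd d) (ψ : 𝓢(Rd d, ℂ)) :
    ‖(SchwartzMap.compSubConstCLM ℂ v ψ).toLp 2 volume‖ = ‖ψ.toLp 2 volume‖ := by
  have h := lintegral_enorm_sq_eq_toLp (SchwartzMap.compSubConstCLM ℂ v ψ)
  simp only [SchwartzMap.compSubConstCLM_apply] at h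
  rw [lintegral_sub_right_eq_self (fun x => ‖ψ x‖ₑ ^ 2) v, lintegral_enorm_sq_eq_toLp] at h
  have h2 := (ENNReal.pow_right_strictMono two_ne_zero).injective h
  rw [← toReal_enorm, ← toReal_enorm, h2]

theorem inner_toLp_sub_smul {a : Rd d × Rd d → ℝ} {T : L2Rd d →L[ℂ] L2Rd d}
    (hT : IsWeylQuantization a T) (z : ℂ) (ψ φ : 𝓢(Rd d, ℂ)) :
    inner ℂ (ψ.toLp 2 volume) (T (φ.toLp 2 volume) - z • φ.toLp 2 volume) =
      weylForm a ψ φ - z * inner ℂ (ψ.toLp 2 volume) (φ.toLp 2 volume) := by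
  rw [inner_sub_right, inner_smul_right, hT]

theorem inner_toLp_compSubConst (v : Rd d) (ψ φ : 𝓢(Rd d, ℂ)) :
    inner ℂ ((SchwartzMap.compSubConstCLM ℂ v ψ).toLp 2 volume)
      ((SchwartzMap.compSubConstCLM ℂ v φ).toLp 2 volume) =
      inner ℂ (ψ.toLp 2 volume) (φ.toLp 2 volume) := by
  rw [SchwartzMap.inner_toL2_toL2_eq _ _ volume, SchwartzMap.inner_toL2_toL2_eq _ _ volume]
  exact integral_sub_right_eq_self (fun x => inner ℂ (ψ x) (φ x)) v

/-- A lower bound for `T - z` passes to the quantizations of the translated symbols. -/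
theorem IsWeylQuantization.le_norm_translate {a : Rd d × Rd d → ℝ} {S T : L2Rd d →L[ℂ] L2Rd d}
    {v : Rd d} (hT : IsWeylQuantization a T)
    (hS : IsWeylQuantization (fun p => a (p.1 + v, p.2)) S) {z : ℂ} {r : ℝ}
    (hr : ∀ f, r * ‖f‖ ≤ ‖T f - z • f‖) (φ : 𝓢(Rd d, ℂ)) :
    r * ‖φ.toLp 2 volume‖ ≤ ‖S (φ.toLp 2 volume) - z • φ.toLp 2 volume‖ := by
  rw [← norm_toLp_compSubConst v]
  refine (hr _).trans (norm_le_of_forall_inner_le fun ψ => ?_)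
  have h1 : ψ = SchwartzMap.compSubConstCLM ℂ v (SchwartzMap.compSubConstCLM ℂ (-v) ψ) := by
    ext x; simp
  set η := SchwartzMap.compSubConstCLM ℂ (-v) ψ
  rw [h1, inner_toLp_sub_smul hT, ← weylForm_translate, inner_toLp_compSubConst,
    ← inner_toLp_sub_smul hS, norm_toLp_compSubConst, mul_comm]
  exact norm_inner_le_norm _ _

end Operators

/-! ### Derivative bounds for deformed symbols. -/

section SymbolEstimates

theorem norm_iteratedFDeriv_id_le {X : Type*} [NormedAddCommGroup X] [NormedSpace ℝ X] {j : ℕ}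
    (hj : 1 ≤ j) (x : X) : ‖iteratedFDeriv ℝ j (fun x : X => x) x‖ ≤ 1 := by
  obtain ⟨k, rfl⟩ := Nat.exists_eq_add_of_le' hj
  rw [← norm_iteratedFDeriv_fderiv]
  have h1 : fderiv ℝ (fun x : X => x) = fun _ => ContinuousLinearMap.id ℝ X := by
    ext1 x; exact fderiv_fun_id
  rw [h1]
  rcases k with - | k
  · rw [norm_iteratedFDeriv_zero]; exact ContinuousLinearMap.norm_id_le
  · rw [iteratedFDeriv_succ_const]; simp

/-- The constant must not depend on the spaces, because the bound is also applied to `fderiv ℝ f`,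
whose target is a different space. -/
theorem exists_norm_iteratedFDeriv_comp_le (n : ℕ) (M : ℝ) (hM : 1 ≤ M) :
    ∃ K : ℝ, 0 ≤ K ∧ ∀ (X G : Type) [NormedAddCommGroup X] [NormedSpace ℝ X]
      [NormedAddCommGroup G] [NormedSpace ℝ G] (f : X → G) (Φ : X → X) (x : X),
      ContDiff ℝ ∞ f → ContDiff ℝ ∞ Φ →
      (∀ j ≤ n, ∀ y, ‖iteratedFDeriv ℝ j f y‖ ≤ M) →
      (∀ j, 1 ≤ j → j ≤ n → ‖iteratedFDeriv ℝ j Φ x‖ ≤ M) →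
      ∀ j ≤ n, ‖iteratedFDeriv ℝ j (fun y => f (Φ y)) x‖ ≤ K := by
  refine ⟨n.factorial * M * M ^ n, by positivity, ?_⟩
  intro X G _ _ _ _ f Φ x hf hΦ hfb hΦb j hj
  refine (norm_iteratedFDeriv_comp_le hf hΦ (n := j) (by exact_mod_cast le_top) x
    (fun i hi => hfb i (hi.trans hj) _)
    (fun i hi hij => (hΦb i hi (hij.trans hj)).trans (le_self_pow₀ hM (by omega)))).trans ?_
  gcongr

set_option maxSynthPendingDepth 3 in
/-- Compositions with two maps that are close, with all derivatives, at a point. -/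
theorem exists_norm_iteratedFDeriv_comp_sub_le (n : ℕ) (M : ℝ) (hM : 1 ≤ M) :
    ∃ K : ℝ, 0 ≤ K ∧ ∀ (X G : Type) [NormedAddCommGroup X] [NormedSpace ℝ X]
      [NormedAddCommGroup G] [NormedSpace ℝ G] (f : X → G) (Φ Ψ : X → X) (x : X) (ε : ℝ),
      ContDiff ℝ ∞ f → ContDiff ℝ ∞ Φ → ContDiff ℝ ∞ Ψ → 0 ≤ ε →
      (∀ j ≤ n + 1, ∀ y, ‖iteratedFDeriv ℝ j f y‖ ≤ M) →
      (∀ j, 1 ≤ j → j ≤ n → ‖iteratedFDeriv ℝ j Φ x‖ ≤ M) →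
      (∀ j, 1 ≤ j → j ≤ n → ‖iteratedFDeriv ℝ j Ψ x‖ ≤ M) →
      (∀ j ≤ n, ‖iteratedFDeriv ℝ j (fun y => Φ y - Ψ y) x‖ ≤ ε) →
      ∀ j ≤ n, ‖iteratedFDeriv ℝ j (fun y => f (Φ y) - f (Ψ y)) x‖ ≤ K * ε := by
  induction n with
  | zero =>
    refine ⟨M, by positivity, ?_⟩
    intro X G _ _ _ _ f Φ Ψ x ε hf hΦ hΨ hε hfb hΦb hΨb hd j hj
    obtain rfl : j = 0 := by omega
    have h0 := hd 0 le_rfl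
    rw [norm_iteratedFDeriv_zero] at h0 ⊢
    refine (Convex.norm_image_sub_le_of_norm_fderiv_le (𝕜 := ℝ) (s := Set.univ) (C := M)
      (fun y _ => hf.differentiable (by simp) y) (fun y _ => ?_) convex_univ (mem_univ _)
      (mem_univ _)).trans (by gcongr)
    rw [← norm_iteratedFDeriv_one]
    exact hfb 1 le_rfl y
  | succ n ih =>
    obtain ⟨K, hK, ih⟩ := ih
    obtain ⟨K', hK', hcomp⟩ := exists_norm_iteratedFDeriv_comp_le n M hM
    refine ⟨K + (2 ^ n * (K * M) + 2 ^ n * K'), by positivity, ?_⟩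
    intro X G _ _ _ _ f Φ Ψ x ε hf hΦ hΨ hε hfb hΦb hΨb hd j hj
    rcases hj.lt_or_eq with hj | rfl
    · refine (ih X G f Φ Ψ x ε hf hΦ hΨ hε (fun j hj => hfb j (by omega))
        (fun j h1 hj => hΦb j h1 (by omega)) (fun j h1 hj => hΨb j h1 (by omega))
        (fun j hj => hd j (by omega)) j (by omega)).trans ?_
      gcongr
      have : 0 ≤ 2 ^ n * (K * M) + 2 ^ n * K' := by positivity
      linarith
    have hf' : ContDiff ℝ ∞ (fderiv ℝ f) := hf.fderiv_right (by exact_mod_cast le_top)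
    have hΦ' : ContDiff ℝ ∞ (fderiv ℝ Φ) := hΦ.fderiv_right (by exact_mod_cast le_top)
    have hΨ' : ContDiff ℝ ∞ (fderiv ℝ Ψ) := hΨ.fderiv_right (by exact_mod_cast le_top)
    have hdiff : ContDiff ℝ ∞ fun y => Φ y - Ψ y := hΦ.sub hΨ
    have hdiff' : ContDiff ℝ ∞ (fderiv ℝ fun y => Φ y - Ψ y) :=
      hdiff.fderiv_right (by exact_mod_cast le_top)
    let B := ContinuousLinearMap.compL ℝ X X G
    have hB : ‖B‖ ≤ 1 := ContinuousLinearMap.norm_compL_le ℝ X X G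
    -- The chain rule difference is `(f'(Φ) - f'(Ψ))Φ' + f'(Ψ)(Φ - Ψ)'`. The induction hypothesis
    -- for `f'` handles the first term; in the second the factor `ε` comes from the derivative of `Φ
    -- - Ψ`.
    have hD : fderiv ℝ (fun y => f (Φ y) - f (Ψ y)) =
        (fun y => B (fderiv ℝ f (Φ y) - fderiv ℝ f (Ψ y)) (fderiv ℝ Φ y)) +
        (fun y => B (fderiv ℝ f (Ψ y)) (fderiv ℝ (fun y => Φ y - Ψ y) y)) := by
      ext1 y
      have hfd := hf.differentiable (by simp)
      have h1 := ((hfd (Φ y)).hasFDerivAt.comp y (hΦ.differentiable (by simp) y).hasFDerivAt)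
      have h2 := ((hfd (Ψ y)).hasFDerivAt.comp y (hΨ.differentiable (by simp) y).hasFDerivAt)
      have h3 := (hΦ.differentiable (by simp) y).hasFDerivAt.fun_sub
        (hΨ.differentiable (by simp) y).hasFDerivAt
      rw [Pi.add_apply, h3.fderiv]
      refine (h1.sub h2).fderiv.trans ?_
      ext z
      simp [B]
    have hu : ContDiff ℝ ∞ fun y => fderiv ℝ f (Φ y) - fderiv ℝ f (Ψ y) :=
      (hf'.comp hΦ).sub (hf'.comp hΨ)
    have hc1 : ContDiff ℝ ∞ fun y => B (fderiv ℝ f (Φ y) - fderiv ℝ f (Ψ y)) (fderiv ℝ Φ y) :=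
      (B.contDiff.comp hu).clm_apply hΦ'
    have hc2 : ContDiff ℝ ∞ fun y => B (fderiv ℝ f (Ψ y)) (fderiv ℝ (fun y => Φ y - Ψ y) y) :=
      (B.contDiff.comp (hf'.comp hΨ)).clm_apply hdiff'
    rw [← norm_iteratedFDeriv_fderiv, hD, iteratedFDeriv_add_apply
      (hc1.of_le (by exact_mod_cast le_top)).contDiffAt
      (hc2.of_le (by exact_mod_cast le_top)).contDiffAt]
    have hfb' : ∀ j ≤ n + 1, ∀ y, ‖iteratedFDeriv ℝ j (fderiv ℝ f) y‖ ≤ M := fun j hj y => by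
      rw [norm_iteratedFDeriv_fderiv]; exact hfb _ (by omega) y
    have hsum : ∀ R : ℝ, ∑ i ∈ Finset.range (n + 1), (n.choose i : ℝ) * R = 2 ^ n * R := fun R => by
      rw [← Finset.sum_mul]; congr 1; exact_mod_cast Nat.sum_range_choose n
    have h1 : ‖iteratedFDeriv ℝ n (fun y => B (fderiv ℝ f (Φ y) - fderiv ℝ f (Ψ y))
        (fderiv ℝ Φ y)) x‖ ≤ 2 ^ n * (K * ε * M) := by
      refine (B.norm_iteratedFDeriv_le_of_bilinear_of_le_one hu hΦ' x
        (by exact_mod_cast le_top) hB).trans ?_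
      rw [← hsum]
      refine Finset.sum_le_sum fun i hi => ?_
      have hi' := Finset.mem_range.1 hi
      have h2 := ih X (X →L[ℝ] G) (fderiv ℝ f) Φ Ψ x ε hf' hΦ hΨ hε hfb'
        (fun j h1 hj => hΦb j h1 (by omega)) (fun j h1 hj => hΨb j h1 (by omega))
        (fun j hj => hd j (by omega)) i (by omega)
      have h3 : ‖iteratedFDeriv ℝ (n - i) (fderiv ℝ Φ) x‖ ≤ M := by
        rw [norm_iteratedFDeriv_fderiv]; exact hΦb _ (by omega) (by omega)
      rw [mul_assoc]
      gcongr
    have h2 : ‖iteratedFDeriv ℝ n (fun y => B (fderiv ℝ f (Ψ y))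
        (fderiv ℝ (fun y => Φ y - Ψ y) y)) x‖ ≤ 2 ^ n * (K' * ε) := by
      refine (B.norm_iteratedFDeriv_le_of_bilinear_of_le_one (hf'.comp hΨ) hdiff' x
        (by exact_mod_cast le_top) hB).trans ?_
      rw [← hsum]
      refine Finset.sum_le_sum fun i hi => ?_
      have hi' := Finset.mem_range.1 hi
      have h2 := hcomp X (X →L[ℝ] G) (fderiv ℝ f) Ψ x hf' hΨ (fun j hj => hfb' j (by omega))
        (fun j h1 hj => hΨb j h1 (by omega)) i (by omega)
      have h3 : ‖iteratedFDeriv ℝ (n - i) (fderiv ℝ (fun y => Φ y - Ψ y)) x‖ ≤ ε := by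
        rw [norm_iteratedFDeriv_fderiv]; exact hd _ (by omega)
      rw [mul_assoc]
      gcongr
      exact h2
    refine (norm_add_le _ _).trans ((add_le_add h1 h2).trans ?_)
    have : 0 ≤ K * ε := by positivity
    linarith

variable {d : ℕ}

theorem IsAdmissibleField.exists_bound {F : Rd d → Rd d} (hF : IsAdmissibleField F) (L : ℕ) :
    ∃ M : ℝ, 1 ≤ M ∧ ∀ j, 1 ≤ j → j ≤ L → ∀ x, ‖iteratedFDeriv ℝ j F x‖ ≤ M := by
  have h : ∀ j, ∃ M : ℝ, 0 ≤ M ∧ (1 ≤ j → ∀ x, ‖iteratedFDeriv ℝ j F x‖ ≤ M) := fun j => by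
    by_cases hj : 1 ≤ j
    · obtain ⟨M, hM⟩ := hF.bounded j hj
      exact ⟨M, (norm_nonneg _).trans (hM 0), fun _ => hM⟩
    · exact ⟨0, le_rfl, fun h => absurd h hj⟩
  choose M hM0 hM using h
  refine ⟨1 + ∑ j ∈ Finset.range (L + 1), M j, le_add_of_nonneg_right
    (Finset.sum_nonneg fun j _ => hM0 j), fun j h1 hj x => ?_⟩
  have := Finset.single_le_sum (f := M) (fun i _ => hM0 i)
    (Finset.mem_range.2 (Nat.lt_succ_of_le hj))
  linarith [hM j h1 x]

/-- The displacement `p ↦ (u + F (δ x + c), 0)`. -/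
def displacement (F : Rd d → Rd d) (δ : ℝ) (u c : Rd d) (p : Rd d × Rd d) : Rd d × Rd d :=
  (u + F (δ • p.1 + c), 0)

theorem contDiff_displacement {F : Rd d → Rd d} (hF : IsAdmissibleField F) (δ : ℝ) (u c : Rd d) :
    ContDiff ℝ ∞ (displacement F δ u c) := by
  have := hF.smooth
  unfold displacement
  fun_prop

theorem norm_iteratedFDeriv_displacement_le {F : Rd d → Rd d} (hF : IsAdmissibleField F) (δ : ℝ)
    (u c : Rd d) {j : ℕ} (hj : 1 ≤ j) (p : Rd d × Rd d) :
    ‖iteratedFDeriv ℝ j (displacement F δ u c) p‖ ≤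
      |δ| ^ j * ‖iteratedFDeriv ℝ j F (δ • p.1 + c)‖ := by
  set T : Rd d × Rd d →L[ℝ] Rd d := δ • ContinuousLinearMap.fst ℝ (Rd d) (Rd d) with hT
  have hs : ContDiff ℝ ∞ fun y => F (y + c) := hF.smooth.comp (by fun_prop)
  have e : displacement F δ u c = (ContinuousLinearMap.inl ℝ (Rd d) (Rd d)) ∘
      ((fun _ => u) + ((fun y => F (y + c)) ∘ T)) := by
    ext1 p; simp [displacement, hT]
  have hst : ContDiff ℝ ∞ ((fun y => F (y + c)) ∘ T) := hs.comp T.contDiff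
  rw [e]
  have hsum : ContDiff ℝ ∞ ((fun _ => u) + ((fun y => F (y + c)) ∘ T)) := contDiff_const.add hst
  refine ((ContinuousLinearMap.inl ℝ (Rd d) (Rd d)).norm_iteratedFDeriv_comp_left
    hsum.contDiffAt (n := j) (by exact_mod_cast le_top)).trans ?_
  refine (mul_le_of_le_one_left (norm_nonneg _)
    (ContinuousLinearMap.norm_inl_le_one ℝ _ _)).trans ?_
  rw [iteratedFDeriv_add_apply (f := fun _ => u) contDiffAt_const
    (hst.of_le (by exact_mod_cast le_top)).contDiffAt,
    iteratedFDeriv_const_of_ne (by omega), Pi.zero_apply, zero_add,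
    T.iteratedFDeriv_comp_right hs p (i := j) (by exact_mod_cast le_top),
    iteratedFDeriv_comp_add_right]
  refine (ContinuousMultilinearMap.norm_compContinuousLinearMap_le _ _).trans ?_
  rw [Finset.prod_const, Finset.card_univ, Fintype.card_fin, mul_comm]
  have h2 : ‖T‖ ≤ |δ| := by
    rw [hT, norm_smul, Real.norm_eq_abs]
    exact mul_le_of_le_one_right (abs_nonneg _) (ContinuousLinearMap.norm_fst_le ℝ _ _)
  have h3 : T p + c = δ • p.1 + c := rfl
  rw [h3]
  gcongr

/-- The symbol `(x, ξ) ↦ a (x + u + F (δ x + c), ξ)`. -/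
def deformedSymbol (a : Rd d × Rd d → ℝ) (F : Rd d → Rd d) (δ : ℝ) (u c : Rd d)
    (p : Rd d × Rd d) : ℝ :=
  a (p + displacement F δ u c p)

theorem contDiff_deformation {F : Rd d → Rd d} (hF : IsAdmissibleField F) (δ : ℝ) (u c : Rd d) :
    ContDiff ℝ ∞ fun p => p + displacement F δ u c p :=
  contDiff_id.add (contDiff_displacement hF δ u c)

theorem norm_iteratedFDeriv_deformation_le {F : Rd d → Rd d} (hF : IsAdmissibleField F) {δ R : ℝ}
    (hR : 1 ≤ R) (hδ : |δ| ≤ R) {L : ℕ} {M : ℝ}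
    (hM : ∀ j, 1 ≤ j → j ≤ L → ∀ x, ‖iteratedFDeriv ℝ j F x‖ ≤ M) (u c : Rd d) {j : ℕ}
    (hj : 1 ≤ j) (hjL : j ≤ L) (p : Rd d × Rd d) :
    ‖iteratedFDeriv ℝ j (fun p => p + displacement F δ u c p) p‖ ≤ 1 + R ^ L * M := by
  have h1 : ‖iteratedFDeriv ℝ j (displacement F δ u c) p‖ ≤ R ^ L * M := by
    refine (norm_iteratedFDeriv_displacement_le hF δ u c hj p).trans ?_
    have h3 : |δ| ^ j ≤ R ^ L := (pow_le_pow_left₀ (abs_nonneg _) hδ j).trans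
      (pow_le_pow_right₀ hR hjL)
    exact mul_le_mul h3 (hM j hj hjL _) (norm_nonneg _) (by positivity)
  have h2 : (fun p => p + displacement F δ u c p) = (fun p => p) + displacement F δ u c := rfl
  rw [h2, iteratedFDeriv_add_apply (f := fun p => p) contDiffAt_id
    ((contDiff_displacement hF δ u c).of_le (by exact_mod_cast le_top)).contDiffAt]
  exact (norm_add_le _ _).trans (add_le_add (norm_iteratedFDeriv_id_le hj p) h1)

theorem exists_symbolBound_deformedSymbol {a : Rd d × Rd d → ℝ} (ha : IsSymbolS00 a)
    {F : Rd d → Rd d} (hF : IsAdmissibleField F) {R : ℝ} (hR : 1 ≤ R) (L : ℕ) :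
    ∃ B : ℝ, 0 ≤ B ∧ ∀ δ : ℝ, |δ| ≤ R → ∀ u c, SymbolBound (deformedSymbol a F δ u c) L B 0 0 := by
  obtain ⟨A, hA0, hA⟩ := ha.exists_symbolBound L
  obtain ⟨M, hM0, hM⟩ := hF.exists_bound L
  have hRM : 0 ≤ R ^ L * M := by positivity
  obtain ⟨K, hK, h⟩ := exists_norm_iteratedFDeriv_comp_le L (1 + R ^ L * M + A) (by linarith)
  refine ⟨K, hK, fun δ hδ u c j hj p => ?_⟩
  rw [weight_zero, mul_one]
  refine h _ _ a _ p ha.smooth (contDiff_deformation hF δ u c) (fun j hj y => ?_)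
    (fun j h1 hj => ?_) j hj
  · have := hA j hj y
    rw [weight_zero, mul_one] at this
    linarith
  · linarith [norm_iteratedFDeriv_deformation_le hF hR hδ hM u c h1 hj p]

theorem isSymbolS00_deformedSymbol {a : Rd d × Rd d → ℝ} (ha : IsSymbolS00 a)
    {F : Rd d → Rd d} (hF : IsAdmissibleField F) (δ : ℝ) (u c : Rd d) :
    IsSymbolS00 (deformedSymbol a F δ u c) where
  smooth := ha.smooth.comp (contDiff_deformation hF δ u c)
  bounded n := by
    obtain ⟨B, -, h⟩ := exists_symbolBound_deformedSymbol ha hF (R := 1 + |δ|)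
      (by linarith [abs_nonneg δ]) n
    refine ⟨B, fun p => ?_⟩
    simpa [weight_zero] using h δ (by linarith) u c n le_rfl p

/-- The deformed symbol is close, near `y`, to the symbol deformed by a constant displacement. -/
theorem exists_symbolBound_deformedSymbol_sub {a : Rd d × Rd d → ℝ} (ha : IsSymbolS00 a)
    {F : Rd d → Rd d} (hF : IsAdmissibleField F) (L : ℕ) :
    ∃ B : ℝ, 0 ≤ B ∧ ∀ s : ℝ, 0 ≤ s → s ≤ 1 → ∀ δ : ℝ, |δ| ≤ s ^ 2 → ∀ u c y : Rd d,
      SymbolBound (deformedSymbol a F δ u c - deformedSymbol a F 0 u (δ • y + c)) L (B * s) s y := by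
  obtain ⟨A, hA0, hA⟩ := ha.exists_symbolBound (L + 1)
  obtain ⟨M, hM0, hM⟩ := hF.exists_bound (L + 1)
  obtain ⟨K, hK, h⟩ := exists_norm_iteratedFDeriv_comp_sub_le L (1 + 1 ^ L * M + A)
    (by rw [one_pow]; linarith)
  refine ⟨K * M, by positivity, fun s hs hs1 δ hδ u c y j hj p => ?_⟩
  have hδ1 : |δ| ≤ 1 := hδ.trans (pow_le_one₀ hs hs1)
  have hw := (weight_pos hs y p.1).le
  have hw1 := one_le_weight hs y p.1
  have hM' : ∀ j, 1 ≤ j → j ≤ L → ∀ x, ‖iteratedFDeriv ℝ j F x‖ ≤ M :=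
    fun j h1 hj => hM j h1 (by omega)
  -- The comparison of compositions is pointwise in its base point, so its `ε` may be chosen
  -- proportional to the weight at `p`.
  refine (h _ _ a (fun p => p + displacement F δ u c p)
    (fun p => p + displacement F 0 u (δ • y + c) p) p (M * s * weight s y p.1) ha.smooth
    (contDiff_deformation hF _ _ _) (contDiff_deformation hF _ _ _) (by positivity)
    (fun j hj y => ?_) (fun j h1 hj => ?_) (fun j h1 hj => ?_) (fun j hj => ?_) j hj).trans
    (le_of_eq (by ring))
  · have := hA j hj y
    rw [weight_zero, mul_one] at this
    rw [one_pow]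
    linarith
  · linarith [norm_iteratedFDeriv_deformation_le hF le_rfl hδ1 hM' u c h1 hj p]
  · linarith [norm_iteratedFDeriv_deformation_le hF le_rfl (δ := 0) (by simp) hM' u
      (δ • y + c) h1 hj p]
  · have e : (fun p => p + displacement F δ u c p - (p + displacement F 0 u (δ • y + c) p)) =
        displacement F δ (-F (δ • y + c)) c := by
      ext1 p
      simp only [displacement, zero_smul, zero_add, Prod.ext_iff, Prod.fst_sub,
        Prod.fst_add, Prod.snd_sub, Prod.snd_add, add_zero, sub_self, and_true]
      abel
    rw [e]
    -- In order zero, the Lipschitz bound and `|δ| ≤ s²` give `|δ|‖x - y‖ ≤ s · (s‖x - y‖)`. In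
    -- higher orders each derivative brings a factor `δ`, so the bound is of order `s` without any
    -- growth.
    rcases Nat.eq_zero_or_pos j with rfl | hj0
    · rw [norm_iteratedFDeriv_zero]
      have h1 : ‖F (δ • p.1 + c) - F (δ • y + c)‖ ≤ M * ‖(δ • p.1 + c) - (δ • y + c)‖ :=
        Convex.norm_image_sub_le_of_norm_fderiv_le (𝕜 := ℝ) (s := Set.univ)
          (fun z _ => hF.smooth.differentiable (by simp) z)
          (fun z _ => by
            rw [← norm_iteratedFDeriv_one]; exact hM 1 le_rfl (by omega) z)
          convex_univ (mem_univ _) (mem_univ _)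
      have h2 : (δ • p.1 + c) - (δ • y + c) = δ • (p.1 - y) := by module
      have h3 : ‖displacement F δ (-F (δ • y + c)) c p‖ = ‖F (δ • p.1 + c) - F (δ • y + c)‖ := by
        simp [displacement, Prod.norm_def, ← sub_eq_neg_add]
      rw [h3]
      rw [h2, norm_smul, Real.norm_eq_abs] at h1
      refine h1.trans ?_
      rw [mul_assoc]
      refine mul_le_mul_of_nonneg_left ?_ (by positivity)
      calc |δ| * ‖p.1 - y‖ ≤ s ^ 2 * ‖p.1 - y‖ := by gcongr
        _ = s * (s * ‖p.1 - y‖) := by ring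
        _ ≤ s * weight s y p.1 := by gcongr; simp [weight]
    · refine (norm_iteratedFDeriv_displacement_le hF _ _ _ hj0 p).trans ?_
      have h1 : |δ| ^ j ≤ s := calc
        |δ| ^ j ≤ |δ| := pow_le_of_le_one (abs_nonneg _) hδ1 (by omega)
        _ ≤ s ^ 2 := hδ
        _ ≤ s := pow_le_of_le_one hs hs1 two_ne_zero
      calc |δ| ^ j * ‖iteratedFDeriv ℝ j F (δ • p.1 + c)‖ ≤ s * M :=
            mul_le_mul h1 (hM j hj0 (by omega) _) (norm_nonneg _) hs
        _ = M * s := mul_comm _ _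
        _ ≤ M * s * weight s y p.1 := le_mul_of_one_le_right (by positivity) hw1

theorem SymbolBound.neg {a : Rd d × Rd d → ℝ} {L : ℕ} {B s : ℝ} {c : Rd d}
    (h : SymbolBound a L B s c) : SymbolBound (-a) L B s c := fun j hj p => by
  rw [iteratedFDeriv_neg_apply, norm_neg]
  exact h j hj p

end SymbolEstimates

/-! ### Gluing lower bounds from local models. -/

section Localization

variable {d : ℕ}

/-- Averaging over the centres `y` replaces a partition of unity. The power of `s` is the same for
every kernel `k`, so it cancels when main and error terms are compared. -/
theorem lintegral_lintegral_scaled {s : ℝ} (hs : 0 < s) {k h : Rd d → ℝ≥0∞} (hk : Measurable k)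
    (hh : Measurable h) :
    ∫⁻ y, ∫⁻ x, (k (s • (x - y)) * h x) ^ 2 =
      ENNReal.ofReal |(s ^ Module.finrank ℝ (Rd d))⁻¹| * ((∫⁻ z, k z ^ 2) * ∫⁻ x, h x ^ 2) := by
  rw [lintegral_lintegral_swap (Measurable.aemeasurable (by fun_prop))]
  have h1 : ∀ x, ∫⁻ y, (k (s • (x - y)) * h x) ^ 2 =
      ENNReal.ofReal |(s ^ Module.finrank ℝ (Rd d))⁻¹| * (∫⁻ z, k z ^ 2) * h x ^ 2 := fun x => by
    simp_rw [mul_pow]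
    rw [lintegral_mul_const _ (by fun_prop),
      lintegral_sub_left_eq_self (fun y : Rd d => k (s • y) ^ 2) x,
      ← lintegral_map (f := fun y => k y ^ 2) (g := fun y : Rd d => s • y) (by fun_prop)
        (by fun_prop), Measure.map_addHaar_smul _ hs.ne', lintegral_smul_measure, smul_eq_mul]
  simp_rw [h1]
  rw [lintegral_const_mul _ (by fun_prop), mul_assoc]

/-- The squared `L²` norm of the bump function. -/
def bumpMass (d : ℕ) : ℝ≥0∞ := ∫⁻ z : Rd d, ‖((bump d z : ℝ) : ℂ)‖ₑ ^ 2

theorem bumpMass_ne_top (d : ℕ) : bumpMass d ≠ ⊤ := by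
  have h1 : MemLp (bump d) 2 (volume : Measure (Rd d)) :=
    (bump d).continuous.memLp_of_hasCompactSupport (bump d).hasCompactSupport
  have h2 := h1.integrable_sq.2.ne
  refine ne_of_eq_of_ne ?_ h2
  refine lintegral_congr fun z => ?_
  rw [enorm_pow, ← ofReal_norm, ← ofReal_norm, Complex.norm_real]

theorem bumpMass_ne_zero (d : ℕ) : bumpMass d ≠ 0 := by
  have hc : Continuous fun z : Rd d => ‖((bump d z : ℝ) : ℂ)‖ₑ ^ 2 := by
    have := (bump d).continuous; fun_prop
  have h1 : bump d 0 = 1 := (bump d).one_of_mem_closedBall (by simp [(bump d).rIn_pos.le])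
  exact ((lintegral_pos_iff_support hc.measurable).2
    (hc.isOpen_support.measure_pos volume ⟨0, by simp [h1]⟩)).ne'

/-- The squared `L²` norm of `(1 + |z|)^{-(d+1)}`. -/
def tailMass (d : ℕ) : ℝ≥0∞ := ∫⁻ z : Rd d, ENNReal.ofReal (((1 + ‖z‖) ^ (d + 1))⁻¹) ^ 2

theorem tailMass_ne_top (d : ℕ) : tailMass d ≠ ⊤ := by
  have h1 := finite_integral_one_add_norm (E := Rd d) (μ := volume) (r := (d + 1 : ℕ)) (by simp)
  refine (lt_of_le_of_lt (lintegral_mono fun z => ?_) h1).ne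
  rw [Real.rpow_neg (by positivity), Real.rpow_natCast]
  refine pow_le_of_le_one zero_le ?_ two_ne_zero
  rw [ENNReal.ofReal_le_one]
  exact inv_le_one_of_one_le₀ (one_le_pow₀ (by linarith [norm_nonneg z]))

theorem enorm_inner_cutoffMul_le (s : ℝ) (y : Rd d) (η : 𝓢(Rd d, ℂ)) (g : L2Rd d) {t : ℝ}
    (ht : 0 < t) : ‖inner ℂ ((cutoffMul s y η).toLp 2 volume) g‖ₑ ≤
      ENNReal.ofReal t * (∫⁻ x, ‖η x‖ₑ ^ 2) +
        ENNReal.ofReal t⁻¹ * ∫⁻ x, (‖((cutoff s y x : ℝ) : ℂ)‖ₑ * ‖g x‖ₑ) ^ 2 := by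
  have hc := continuous_cutoff s y
  have hg := (Lp.stronglyMeasurable g).measurable
  rw [L2.inner_def]
  refine (enorm_integral_le_lintegral_enorm _).trans ?_
  rw [← lintegral_const_mul' _ _ ENNReal.ofReal_ne_top,
    ← lintegral_const_mul' _ _ ENNReal.ofReal_ne_top, ← lintegral_add_left (by fun_prop)]
  refine lintegral_mono_ae ?_
  filter_upwards [(cutoffMul s y η).coeFn_toLp 2 volume] with x hx
  rw [hx, cutoffMul_apply, ← enorm_mul]
  refine le_trans (le_of_eq ?_) (enorm_mul_le_sq_add_sq _ _ ht)
  rw [← ofReal_norm, ← ofReal_norm]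
  simp
  ring

/-- Localisation of the lower bound: from the local models `b y` to the cut off functions. -/
theorem exists_cutoff_lower_bound (d : ℕ) {M : ℝ} (hM : 0 ≤ M) :
    ∃ c A : ℝ, 0 < c ∧ 0 < A ∧ ∀ (a b : Rd d × Rd d → ℝ), IsSymbolS00 a → IsSymbolS00 b →
      SymbolBound a (symbolOrder d (d + 2)) M 0 0 → ∀ (s : ℝ) (y : Rd d), 0 < s → s ≤ 1 →
      SymbolBound (b - a) (symbolOrder d 1) (M * s) s y →
      ∀ (S T : L2Rd d →L[ℂ] L2Rd d), IsWeylQuantization a T → IsWeylQuantization b S →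
      ∀ z r : ℝ, 0 ≤ r → (∀ φ : 𝓢(Rd d, ℂ),
        r * ‖φ.toLp 2 volume‖ ≤ ‖S (φ.toLp 2 volume) - (z : ℂ) • φ.toLp 2 volume‖) →
      ∀ ψ : 𝓢(Rd d, ℂ),
      ENNReal.ofReal (r ^ 2) * ∫⁻ x, (‖((cutoff s y x : ℝ) : ℂ)‖ₑ * ‖ψ x‖ₑ) ^ 2 ≤
        ENNReal.ofReal (4 * c ^ 2) * ((∫⁻ x, (‖((cutoff s y x : ℝ) : ℂ)‖ₑ *
            ‖(T (ψ.toLp 2 volume) - (z : ℂ) • ψ.toLp 2 volume : L2Rd d) x‖ₑ) ^ 2) +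
          ENNReal.ofReal ((s * A) ^ 2) *
            (∫⁻ x, (ENNReal.ofReal ((weight s y x ^ (d + 1))⁻¹) * ‖ψ x‖ₑ) ^ 2) +
          ENNReal.ofReal ((3 * s) ^ 2) *
            ∫⁻ x, (‖((cutoff s y x : ℝ) : ℂ)‖ₑ * ‖ψ x‖ₑ) ^ 2) := by
  obtain ⟨C1, hC1, h1⟩ := exists_enorm_weylForm_le d
  -- The decay exponent `d + 1` makes the tail of the commutator square integrable over the centres
  -- (`tailMass_ne_top`); it accounts for the order `symbolOrder d (d + 2)`.
  obtain ⟨C2, A, hC2, hA, h2⟩ := exists_enorm_weylForm_commutator_le d (d + 1)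
  refine ⟨1 + C2 * M + C1 * M, A, by positivity, hA, ?_⟩
  intro a b ha hb hab s y hs hs1 hba S T hT hS z r hr hlow ψ
  set χψ := cutoffMul s y ψ with hχ
  set g : L2Rd d := T (ψ.toLp 2 volume) - (z : ℂ) • ψ.toLp 2 volume with hg
  set Y1 := ∫⁻ x, (‖((cutoff s y x : ℝ) : ℂ)‖ₑ * ‖g x‖ₑ) ^ 2
  set Y2 := ENNReal.ofReal ((s * A) ^ 2) *
    ∫⁻ x, (ENNReal.ofReal ((weight s y x ^ (d + 1))⁻¹) * ‖ψ x‖ₑ) ^ 2 with hY2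
  set Y3 := ENNReal.ofReal ((3 * s) ^ 2) *
    ∫⁻ x, (‖((cutoff s y x : ℝ) : ℂ)‖ₑ * ‖ψ x‖ₑ) ^ 2 with hY3
  have hχe : ∫⁻ x, (‖((cutoff s y x : ℝ) : ℂ)‖ₑ * ‖ψ x‖ₑ) ^ 2 = ‖χψ.toLp 2 volume‖ₑ ^ 2 := by
    rw [← lintegral_enorm_sq_eq_toLp]
    simp [χψ, enorm_mul]
  have hw := weight_pos (d := d) hs.le y
  have key : ‖S (χψ.toLp 2 volume) - (z : ℂ) • χψ.toLp 2 volume‖ₑ ^ 2 ≤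
      ENNReal.ofReal (4 * (1 + C2 * M + C1 * M) ^ 2) * (Y1 + Y2 + Y3) := by
    refine enorm_sq_le_of_forall_inner_le (by positivity) fun η t ht => ?_
    -- This is `(S - z)χψ = χ(T - z)ψ + [T, χ]ψ + (S - T)χψ`, tested against `η`.
    have e1 : inner ℂ (η.toLp 2 volume) (S (χψ.toLp 2 volume) - (z : ℂ) • χψ.toLp 2 volume) =
        inner ℂ ((cutoffMul s y η).toLp 2 volume) g +
        (weylForm a η (cutoffMul s y ψ) - weylForm a (cutoffMul s y η) ψ) +
        weylForm (b - a) η χψ := by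
      have e2 : inner ℂ (η.toLp 2 volume) (χψ.toLp 2 volume) =
          inner ℂ ((cutoffMul s y η).toLp 2 volume) (ψ.toLp 2 volume) := by
        rw [SchwartzMap.inner_toL2_toL2_eq _ _ volume, SchwartzMap.inner_toL2_toL2_eq _ _ volume]
        congr 1; ext x
        simp [χψ]; ring
      rw [inner_toLp_sub_smul hS, hg, inner_toLp_sub_smul hT, weylForm_sub_symbol hb ha, e2]
      ring
    have t1 := enorm_inner_cutoffMul_le s y η g ht
    have t2 := h2 a ha M hab hM s y hs hs1 η ψ t ht
    -- With parameter `t / s` the factor `s` of the symbol bound moves entirely to the `ψ` side,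
    -- where it becomes `s²`. There the weight is at most 3 on the support of the cutoff.
    have t3 := h1 (b - a) (hb.sub ha) (M * s) s y hs.le hs1 hba (by positivity) η χψ (t / s)
      (by positivity)
    rw [lintegral_enorm_sq_eq_toLp] at t1 t2 t3
    have i2 : ∫⁻ x, (ENNReal.ofReal (s * A * (weight s y x ^ (d + 1))⁻¹) * ‖ψ x‖ₑ) ^ 2 = Y2 := by
      rw [hY2, ← lintegral_const_mul' _ _ ENNReal.ofReal_ne_top]
      refine lintegral_congr fun x => ?_
      rw [ENNReal.ofReal_mul (by positivity), ENNReal.ofReal_pow (by positivity)]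
      ring
    have i3 : ENNReal.ofReal (s ^ 2) * ∫⁻ x, (ENNReal.ofReal (weight s y x) * ‖χψ x‖ₑ) ^ 2 ≤ Y3 := by
      rw [hY3, ← lintegral_const_mul' _ _ ENNReal.ofReal_ne_top,
        ← lintegral_const_mul' _ _ ENNReal.ofReal_ne_top]
      refine lintegral_mono fun x => ?_
      have h0 : χψ x = cutoff s y x * ψ x := cutoffMul_apply s y ψ x
      rw [h0, enorm_mul]
      by_cases hx : cutoff s y x = 0
      · simp [hx]
      · have h3 := weight_le_three_of_cutoff_ne_zero hs.le hx
        calc _ = ENNReal.ofReal ((weight s y x * s) ^ 2) *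
              (‖((cutoff s y x : ℝ) : ℂ)‖ₑ * ‖ψ x‖ₑ) ^ 2 := by
              rw [ENNReal.ofReal_pow hs.le, ENNReal.ofReal_pow (by have := hw x; positivity),
                ENNReal.ofReal_mul (hw x).le]
              ring
          _ ≤ _ := by
              have := (hw x).le
              gcongr
    rw [i2] at t2
    have t3' : ‖weylForm (b - a) η χψ‖ₑ ≤ ENNReal.ofReal (C1 * M) *
        (ENNReal.ofReal t * ‖η.toLp 2 volume‖ₑ ^ 2 + ENNReal.ofReal t⁻¹ * Y3) := by
      refine t3.trans ?_
      calc _ = ENNReal.ofReal (C1 * M) * ((ENNReal.ofReal s * ENNReal.ofReal (t / s)) *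
              ‖η.toLp 2 volume‖ₑ ^ 2 + (ENNReal.ofReal s * ENNReal.ofReal (t / s)⁻¹) *
              ∫⁻ x, (ENNReal.ofReal (weight s y x) * ‖χψ x‖ₑ) ^ 2) := by
            rw [← mul_assoc C1, ENNReal.ofReal_mul (by positivity)]; ring
        _ = ENNReal.ofReal (C1 * M) * (ENNReal.ofReal t *
              ‖η.toLp 2 volume‖ₑ ^ 2 + ENNReal.ofReal t⁻¹ * (ENNReal.ofReal (s ^ 2) *
              ∫⁻ x, (ENNReal.ofReal (weight s y x) * ‖χψ x‖ₑ) ^ 2)) := by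
            have q1 : s * (t / s) = t := by field_simp
            have q2 : s * (t / s)⁻¹ = t⁻¹ * s ^ 2 := by field_simp
            rw [← ENNReal.ofReal_mul hs.le, ← ENNReal.ofReal_mul hs.le, ← mul_assoc
              (ENNReal.ofReal t⁻¹), ← ENNReal.ofReal_mul (by positivity), q1, q2]
        _ ≤ _ := by gcongr
    rw [e1]
    set U := ‖η.toLp 2 volume‖ₑ ^ 2
    calc _ ≤ (ENNReal.ofReal t * U + ENNReal.ofReal t⁻¹ * Y1) +
          ENNReal.ofReal (C2 * M) * (ENNReal.ofReal t * U + ENNReal.ofReal t⁻¹ * Y2) +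
          ENNReal.ofReal (C1 * M) * (ENNReal.ofReal t * U + ENNReal.ofReal t⁻¹ * Y3) :=
          (enorm_add_le _ _).trans (add_le_add ((enorm_add_le _ _).trans (add_le_add t1 t2)) t3')
      _ ≤ (ENNReal.ofReal t * U + ENNReal.ofReal t⁻¹ * (Y1 + Y2 + Y3)) +
          ENNReal.ofReal (C2 * M) * (ENNReal.ofReal t * U + ENNReal.ofReal t⁻¹ * (Y1 + Y2 + Y3)) +
          ENNReal.ofReal (C1 * M) * (ENNReal.ofReal t * U + ENNReal.ofReal t⁻¹ * (Y1 + Y2 + Y3)) := by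
          gcongr
          · rw [add_assoc]; exact le_self_add
          · exact le_add_right le_add_self
          · exact le_add_self
      _ = _ := by
          rw [ENNReal.ofReal_add (by positivity) (by positivity),
            ENNReal.ofReal_add (by positivity) (by positivity), ENNReal.ofReal_one]
          ring
  refine le_trans ?_ key
  rw [hχe, ENNReal.ofReal_pow hr, ← mul_pow, ← ofReal_norm, ← ofReal_norm,
    ← ENNReal.ofReal_mul hr]
  gcongr
  exact hlow χψ

/-- A lower bound for all local models gives a lower bound for the operator. -/
theorem exists_lower_bound_of_local (d : ℕ) {M : ℝ} (hM : 0 ≤ M) :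
    ∃ C : ℝ, 0 < C ∧ ∀ (a : Rd d × Rd d → ℝ) (b : Rd d → Rd d × Rd d → ℝ), IsSymbolS00 a →
      (∀ y, IsSymbolS00 (b y)) → SymbolBound a (symbolOrder d (d + 2)) M 0 0 →
      ∀ s : ℝ, 0 < s → s ≤ 1 →
      (∀ y, SymbolBound (b y - a) (symbolOrder d 1) (M * s) s y) →
      ∀ z r : ℝ, C * s ≤ r → (∀ y (φ : 𝓢(Rd d, ℂ)), r * ‖φ.toLp 2 volume‖ ≤
        ‖weylOp (b y) (φ.toLp 2 volume) - (z : ℂ) • φ.toLp 2 volume‖) →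
      ∀ f : L2Rd d, r * ‖f‖ ≤ C * ‖weylOp a f - (z : ℂ) • f‖ := by
  obtain ⟨c, A, hc, hA, h⟩ := exists_cutoff_lower_bound d hM
  set I := (bumpMass d).toReal with hI
  set J := (tailMass d).toReal with hJ
  have hIpos : 0 < I := ENNReal.toReal_pos (bumpMass_ne_zero d) (bumpMass_ne_top d)
  have hJ0 : 0 ≤ J := ENNReal.toReal_nonneg
  -- `N s²` is the total relative error: `A² J / I` comes from the commutator tail and `9 = 3²` from
  -- the weight on the cutoff support. The constant below is chosen so that `C s ≤ r` implies `2 N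
  -- s² ≤ r²`, and the error is absorbed by half of the left side.
  set N := 4 * c ^ 2 * (A ^ 2 * J / I + 9) with hN
  refine ⟨8 * c ^ 2 + 2 * N + 1, by positivity, ?_⟩
  intro a b ha hb hab s hs hs1 hba z r hr hlow f
  have hr0 : 0 ≤ r := le_trans (by positivity) hr
  have hdense := denseRange_toLp (d := d)
  refine hdense.induction_on
    (p := fun f : L2Rd d => r * ‖f‖ ≤ (8 * c ^ 2 + 2 * N + 1) * ‖weylOp a f - (z : ℂ) • f‖) f
    (isClosed_le (by fun_prop) (by fun_prop)) fun ψ => ?_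
  set g : L2Rd d := weylOp a (ψ.toLp 2 volume) - (z : ℂ) • ψ.toLp 2 volume with hg
  set σ := ENNReal.ofReal |(s ^ Module.finrank ℝ (Rd d))⁻¹| with hσ
  have hσ0 : σ ≠ 0 := by
    have : 0 < |(s ^ Module.finrank ℝ (Rd d))⁻¹| := by positivity
    exact (ENNReal.ofReal_pos.2 this).ne'
  have hbm : Measurable fun z : Rd d => ‖((bump d z : ℝ) : ℂ)‖ₑ := by
    have := (bump d).continuous
    exact Continuous.measurable (by fun_prop)
  have hψm : Measurable fun x => ‖ψ x‖ₑ := by have := ψ.continuous; fun_prop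
  have hgm : Measurable fun x => ‖g x‖ₑ := (Lp.stronglyMeasurable g).measurable.enorm
  have hg2 : ∫⁻ x, ‖g x‖ₑ ^ 2 = ‖g‖ₑ ^ 2 := by
    have h1 := lintegral_rpow_enorm_eq_rpow_eLpNorm' (μ := volume) (f := (g : Rd d → ℂ))
      (q := 2) (by norm_num)
    rw [Lp.enorm_def, eLpNorm_eq_eLpNorm' (by norm_num) (by norm_num)]
    simpa using h1
  have k1 := lintegral_lintegral_scaled hs hbm hψm
  have k2 := lintegral_lintegral_scaled hs hbm hgm
  have k3 := lintegral_lintegral_scaled hs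
    (k := fun z : Rd d => ENNReal.ofReal (((1 + ‖z‖) ^ (d + 1))⁻¹)) (by fun_prop) hψm
  rw [lintegral_enorm_sq_eq_toLp] at k1 k3
  rw [hg2] at k2
  have m1 : Measurable fun q : Rd d × Rd d => (‖((cutoff s q.1 q.2 : ℝ) : ℂ)‖ₑ * ‖ψ q.2‖ₑ) ^ 2 :=
    ((hbm.comp (by fun_prop : Measurable fun q : Rd d × Rd d => s • (q.2 - q.1))).mul
      (hψm.comp measurable_snd)).pow_const 2
  have m2 : Measurable fun q : Rd d × Rd d => (‖((cutoff s q.1 q.2 : ℝ) : ℂ)‖ₑ * ‖g q.2‖ₑ) ^ 2 :=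
    ((hbm.comp (by fun_prop : Measurable fun q : Rd d × Rd d => s • (q.2 - q.1))).mul
      (hgm.comp measurable_snd)).pow_const 2
  have hint := lintegral_mono (μ := (volume : Measure (Rd d))) fun y => h a (b y) ha (hb y) hab s y hs hs1 (hba y) _ _
    ha.isWeylQuantization_weylOp (hb y).isWeylQuantization_weylOp z r hr0 (hlow y) ψ
  have hwt : ∀ x y : Rd d, weight s y x = 1 + ‖s • (x - y)‖ := fun x y => by
    rw [weight, norm_smul, Real.norm_of_nonneg hs.le]
  simp only [hwt] at hint
  rw [lintegral_const_mul' _ _ ENNReal.ofReal_ne_top,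
    lintegral_const_mul' _ _ ENNReal.ofReal_ne_top,
    lintegral_add_right _ (m1.lintegral_prod_right'.const_mul _),
    lintegral_add_left m2.lintegral_prod_right',
    lintegral_const_mul' _ _ ENNReal.ofReal_ne_top,
    lintegral_const_mul' _ _ ENNReal.ofReal_ne_top] at hint
  change ENNReal.ofReal (r ^ 2) * (∫⁻ y, ∫⁻ x, (‖((bump d (s • (x - y)) : ℝ) : ℂ)‖ₑ *
    ‖ψ x‖ₑ) ^ 2) ≤ ENNReal.ofReal (4 * c ^ 2) * ((∫⁻ y, ∫⁻ x,
      (‖((bump d (s • (x - y)) : ℝ) : ℂ)‖ₑ * ‖g x‖ₑ) ^ 2) + _ + _ *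
      (∫⁻ y, ∫⁻ x, (‖((bump d (s • (x - y)) : ℝ) : ℂ)‖ₑ * ‖ψ x‖ₑ) ^ 2)) at hint
  rw [k1, k2, k3] at hint
  change ENNReal.ofReal (r ^ 2) * (σ * (bumpMass d * _)) ≤ _ * (σ * (bumpMass d * _) +
    _ * (σ * (tailMass d * _)) + _ * (σ * (bumpMass d * _))) at hint
  have hint2 : σ * (ENNReal.ofReal (r ^ 2) * (bumpMass d * ‖ψ.toLp 2 volume‖ₑ ^ 2)) ≤
      σ * (ENNReal.ofReal (4 * c ^ 2) * (bumpMass d * ‖g‖ₑ ^ 2 +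
        ENNReal.ofReal ((s * A) ^ 2) * (tailMass d * ‖ψ.toLp 2 volume‖ₑ ^ 2) +
        ENNReal.ofReal ((3 * s) ^ 2) * (bumpMass d * ‖ψ.toLp 2 volume‖ₑ ^ 2))) := by
    refine le_trans (le_of_eq ?_) (hint.trans (le_of_eq ?_)) <;> ring
  rw [ENNReal.mul_le_mul_iff_right hσ0 ENNReal.ofReal_ne_top,
    ← ENNReal.ofReal_toReal (bumpMass_ne_top d), ← ENNReal.ofReal_toReal (tailMass_ne_top d),
    ← hI, ← hJ, ← ofReal_norm, ← ofReal_norm] at hint2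
  set u := ‖ψ.toLp 2 volume‖ with hu
  have hu0 : 0 ≤ u := norm_nonneg _
  set v := ‖g‖ with hv
  have hv0 : 0 ≤ v := norm_nonneg _
  have hreal : r ^ 2 * (I * u ^ 2) ≤ 4 * c ^ 2 * (I * v ^ 2 + (s * A) ^ 2 * (J * u ^ 2) +
      (3 * s) ^ 2 * (I * u ^ 2)) := by
    rw [← ENNReal.ofReal_pow hu0, ← ENNReal.ofReal_pow hv0, ← ENNReal.ofReal_mul hIpos.le,
      ← ENNReal.ofReal_mul hIpos.le, ← ENNReal.ofReal_mul hJ0, ← ENNReal.ofReal_mul (by positivity),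
      ← ENNReal.ofReal_mul (by positivity), ← ENNReal.ofReal_mul (by positivity),
      ← ENNReal.ofReal_add (by positivity) (by positivity),
      ← ENNReal.ofReal_add (by positivity) (by positivity),
      ← ENNReal.ofReal_mul (by positivity)] at hint2
    exact (ENNReal.ofReal_le_ofReal_iff (by positivity)).1 hint2
  have hreal2 : r ^ 2 * u ^ 2 ≤ 4 * c ^ 2 * v ^ 2 + N * s ^ 2 * u ^ 2 := by
    refine le_of_mul_le_mul_left (le_trans (le_of_eq ?_) (hreal.trans (le_of_eq ?_))) hIpos
    · ring
    · rw [hN]; field_simp; ring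
  have hN0 : 0 < N := by positivity
  set C := 8 * c ^ 2 + 2 * N + 1 with hC
  have hC1 : 1 ≤ C := by
    have : 0 < c ^ 2 := by positivity
    linarith
  have h5 : 2 * N * s ^ 2 ≤ r ^ 2 := calc
    2 * N * s ^ 2 ≤ C * s ^ 2 := by
      have : 0 < c ^ 2 := by positivity
      gcongr
      linarith
    _ ≤ C ^ 2 * s ^ 2 := by gcongr; exact le_self_pow₀ hC1 two_ne_zero
    _ = (C * s) ^ 2 := by ring
    _ ≤ r ^ 2 := by gcongr
  have h6 : (r * u) ^ 2 ≤ (C * v) ^ 2 := by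
    have h7 : 8 * c ^ 2 ≤ C ^ 2 := le_trans (by linarith) (le_self_pow₀ hC1 two_ne_zero)
    have h8 := mul_le_mul_of_nonneg_right h5 (sq_nonneg u)
    have h9 := mul_le_mul_of_nonneg_right h7 (sq_nonneg v)
    rw [mul_pow, mul_pow]
    linarith
  exact (pow_le_pow_iff_left₀ (by positivity) (by positivity) two_ne_zero).1 h6

end Localization

/-! ### Stability of lower bounds and of the spectrum. -/

section SpectralStability

/-- For the self-adjoint `S = z - T`, the lower bound says that `S²` is coercive, hence invertible;
a factor of an invertible product of commuting operators is invertible. -/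
theorem IsSelfAdjoint.notMem_spectrum_of_le_norm {H : Type*} [NormedAddCommGroup H]
    [InnerProductSpace ℂ H] [CompleteSpace H] {T : H →L[ℂ] H} (hT : IsSelfAdjoint T) {z r : ℝ}
    (hr : 0 < r) (h : ∀ f, r * ‖f‖ ≤ ‖T f - (z : ℂ) • f‖) : z ∉ spectrum ℝ T := by
  rw [spectrum.notMem_iff]
  set S := algebraMap ℝ (H →L[ℂ] H) z - T with hS
  have hSapp : ∀ f, S f = (z : ℂ) • f - T f := fun f => by
    simp [hS, Algebra.algebraMap_eq_smul_one]
  have hSsa : IsSelfAdjoint S := (IsSelfAdjoint.algebraMap _ (IsSelfAdjoint.all z)).sub hT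
  have h1 : IsUnit (S * S) := by
    refine ContinuousLinearMap.isUnit_of_forall_le_norm_inner_map (S * S)
      (c := (r ^ 2).toNNReal) (by simpa using pow_pos hr 2) fun x => ?_
    have h2 : inner ℂ ((S * S) x) x = inner ℂ (S x) (S x) := by
      rw [mul_apply_eq_comp, ← ContinuousLinearMap.adjoint_inner_right,
        ← ContinuousLinearMap.star_eq_adjoint, hSsa.star_eq]
    rw [h2, inner_self_eq_norm_sq_to_K, norm_pow, RCLike.norm_ofReal, abs_norm, hSapp,
      norm_sub_rev, Real.coe_toNNReal _ (by positivity), mul_comm, ← mul_pow]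
    have := h x
    gcongr
  exact ((Commute.refl S).isUnit_mul_iff.1 h1).1

theorem IsSelfAdjoint.spectrum_real_nonempty {H : Type*} [NormedAddCommGroup H]
    [InnerProductSpace ℂ H] [CompleteSpace H] [Nontrivial H] {T : H →L[ℂ] H}
    (hT : IsSelfAdjoint T) : (spectrum ℝ T).Nonempty :=
  ContinuousFunctionalCalculus.spectrum_nonempty T hT

/-- The function `(x - z)² - r²` is nonnegative on the spectrum, so by functional calculus `(T - z)²
≥ r²`; take the quadratic form at `f`. -/
theorem IsSelfAdjoint.le_norm_sub_smul {H : Type*} [NormedAddCommGroup H]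
    [InnerProductSpace ℂ H] [CompleteSpace H] {T : H →L[ℂ] H} (hT : IsSelfAdjoint T) {z r : ℝ}
    (hr : 0 ≤ r) (h : ∀ μ ∈ spectrum ℝ T, r ≤ |z - μ|) (f : H) :
    r * ‖f‖ ≤ ‖T f - (z : ℂ) • f‖ := by
  set S := T - algebraMap ℝ (H →L[ℂ] H) z with hS
  have hSapp : S f = T f - (z : ℂ) • f := by simp [hS, Algebra.algebraMap_eq_smul_one]
  have hSsa : IsSelfAdjoint S := hT.sub (IsSelfAdjoint.algebraMap _ (IsSelfAdjoint.all z))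
  have h1 : cfc (fun x : ℝ => (x - z) ^ 2 - r ^ 2) T = S ^ 2 - algebraMap ℝ _ (r ^ 2) := by
    rw [cfc_sub (fun x : ℝ => (x - z) ^ 2) (fun _ => r ^ 2) T, cfc_const (r ^ 2) T,
      cfc_pow (fun x : ℝ => x - z) 2 T, cfc_sub (fun x : ℝ => x) (fun _ => z) T, cfc_const z T,
      cfc_id' ℝ T]
  have h2 : 0 ≤ S ^ 2 - algebraMap ℝ (H →L[ℂ] H) (r ^ 2) := by
    rw [← h1]
    refine cfc_nonneg fun x hx => ?_
    have h3 := h x hx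
    rw [abs_sub_comm] at h3
    have h4 : r ^ 2 ≤ |x - z| ^ 2 := by gcongr
    rw [sq_abs] at h4
    linarith
  have h3 := ((ContinuousLinearMap.nonneg_iff_isPositive _).1 h2).re_inner_nonneg_left f
  have h4 : inner ℂ ((S ^ 2) f) f = inner ℂ (S f) (S f) := by
    rw [sq, mul_apply_eq_comp, ← ContinuousLinearMap.adjoint_inner_right,
      ← ContinuousLinearMap.star_eq_adjoint, hSsa.star_eq]
  have h5 : (algebraMap ℝ (H →L[ℂ] H) (r ^ 2)) f = ((r ^ 2 : ℝ) : ℂ) • f := by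
    rw [Algebra.algebraMap_eq_smul_one, Complex.coe_smul]
    rfl
  rw [sub_apply, inner_sub_left, h4, h5, inner_smul_left, Complex.conj_ofReal,
    map_sub, RCLike.re_to_complex, RCLike.re_to_complex, Complex.re_ofReal_mul,
    ← RCLike.re_to_complex, ← RCLike.re_to_complex, inner_self_eq_norm_sq, inner_self_eq_norm_sq,
    hSapp] at h3
  refine (pow_le_pow_iff_left₀ (by positivity) (norm_nonneg _) two_ne_zero).1 ?_
  rw [mul_pow]
  linarith

variable {d : ℕ}

/-- Needed for the spectra to be nonempty, which is used when `|δ|` is not small. -/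
instance nontrivial_L2Rd : Nontrivial (L2Rd d) := by
  obtain ⟨ψ, hψ⟩ := exists_toLp_ne_zero (d := d)
  exact ⟨ψ.toLp 2 volume, 0, hψ⟩

theorem perturbedSymbol_eq_deformedSymbol (a : Rd d × Rd d → ℝ) (F : Rd d → Rd d) (δ : ℝ) :
    perturbedSymbol a F δ = deformedSymbol a F δ 0 0 := by
  funext p
  simp only [perturbedSymbol, deformedSymbol, displacement, zero_add, add_zero]
  congr 1
  exact Prod.ext rfl (add_zero _).symm

theorem IsSymbolS00.perturbedSymbol {a : Rd d × Rd d → ℝ} (ha : IsSymbolS00 a)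
    {F : Rd d → Rd d} (hF : IsAdmissibleField F) (δ : ℝ) : IsSymbolS00 (perturbedSymbol a F δ) := by
  rw [perturbedSymbol_eq_deformedSymbol]
  exact isSymbolS00_deformedSymbol ha hF δ 0 0

theorem IsAdmissibleField.exists_norm_sub_le {F : Rd d → Rd d} (hF : IsAdmissibleField F) :
    ∃ M : ℝ, 1 ≤ M ∧ ∀ x y, ‖F x - F y‖ ≤ M * ‖x - y‖ := by
  obtain ⟨M, hM, h⟩ := hF.exists_bound 1
  refine ⟨M, hM, fun x y => Convex.norm_image_sub_le_of_norm_fderiv_le (𝕜 := ℝ) (s := Set.univ)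
    (fun z _ => hF.smooth.differentiable (by simp) z) (fun z _ => ?_) convex_univ (mem_univ _)
    (mem_univ _)⟩
  rw [← norm_iteratedFDeriv_one]
  exact h 1 le_rfl le_rfl z

/-- Banach's fixed point theorem. Translating `K_δ` by this `v` gives the displacement `-v + F(δ(x -
v))`, which at `x = y` equals `F 0`, the displacement of `K_0`. -/
theorem exists_translation {F : Rd d → Rd d} {M : ℝ}
    (h : ∀ x y, ‖F x - F y‖ ≤ M * ‖x - y‖) {δ : ℝ} (hδ : |δ| * M ≤ 1 / 2) (y : Rd d) :
    ∃ v, v = F (δ • (y - v)) - F 0 := by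
  have hc : ContractingWith (1 / 2) fun v => F (δ • (y - v)) - F 0 := by
    refine ⟨by rw [← NNReal.coe_lt_coe]; norm_num, LipschitzWith.of_dist_le_mul fun v w => ?_⟩
    rw [dist_eq_norm, dist_eq_norm, sub_sub_sub_cancel_right]
    refine (h _ _).trans ?_
    have e : δ • (y - v) - δ • (y - w) = δ • (w - v) := by module
    rw [e, norm_smul, Real.norm_eq_abs, norm_sub_rev, ← mul_assoc, mul_comm M]
    push_cast
    gcongr
  exact ⟨hc.fixedPoint _, hc.fixedPoint_isFixedPt.symm⟩

/-- Quantitative stability of lower bounds in both directions, for small `δ`. -/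
theorem exists_lower_bound_stability {a : Rd d × Rd d → ℝ} (ha : IsSymbolS00 a)
    {F : Rd d → Rd d} (hF : IsAdmissibleField F) :
    ∃ C δ₀ : ℝ, 0 < C ∧ 0 < δ₀ ∧ δ₀ ≤ 1 ∧ ∀ δ : ℝ, δ ≠ 0 → |δ| ≤ δ₀ → ∀ z r : ℝ, C * √|δ| ≤ r →
      ((∀ f, r * ‖f‖ ≤ ‖perturbedOp a F 0 f - (z : ℂ) • f‖) →
        ∀ f, r * ‖f‖ ≤ C * ‖perturbedOp a F δ f - (z : ℂ) • f‖) ∧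
      ((∀ f, r * ‖f‖ ≤ ‖perturbedOp a F δ f - (z : ℂ) • f‖) →
        ∀ f, r * ‖f‖ ≤ C * ‖perturbedOp a F 0 f - (z : ℂ) • f‖) := by
  obtain ⟨M₁, hM₁, hlip⟩ := hF.exists_norm_sub_le
  obtain ⟨B₁, hB₁, h1⟩ := exists_symbolBound_deformedSymbol ha hF le_rfl (symbolOrder d (d + 2))
  obtain ⟨B₂, hB₂, h2⟩ := exists_symbolBound_deformedSymbol_sub ha hF (symbolOrder d 1)
  obtain ⟨C, hC, hcore⟩ := exists_lower_bound_of_local d (add_nonneg hB₁ hB₂)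
  have hδ₀ : 0 < 1 / (2 * M₁) := by positivity
  refine ⟨C, 1 / (2 * M₁), hC, hδ₀, ?_, ?_⟩
  · rw [div_le_one (by positivity)]; linarith
  intro δ hδ hδ' z r hr
  have hδM : |δ| * M₁ ≤ 1 / 2 := by
    rw [le_div_iff₀ (by positivity)] at hδ'
    linarith
  have hδ1 : |δ| ≤ 1 := by nlinarith [abs_nonneg δ]
  set s := √|δ| with hs
  have hs0 : 0 < s := Real.sqrt_pos.2 (abs_pos.2 hδ)
  have hs1 : s ≤ 1 := by rw [hs, Real.sqrt_le_one]; exact hδ1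
  have hsq : |δ| ≤ s ^ 2 := (Real.sq_sqrt (abs_nonneg δ)).ge
  have hmono : ∀ {b : Rd d × Rd d → ℝ} {L : ℕ} {B B' t : ℝ} {c : Rd d}, 0 ≤ t → B ≤ B' →
      SymbolBound b L B t c → SymbolBound b L B' t c := fun ht hBB hb j hj p =>
    (hb j hj p).trans (mul_le_mul_of_nonneg_right hBB (weight_pos ht _ _).le)
  have hS := fun δ => ha.perturbedSymbol hF δ
  have hbd : ∀ δ, |δ| ≤ 1 → SymbolBound (perturbedSymbol a F δ) (symbolOrder d (d + 2))
      (B₁ + B₂) 0 0 := fun δ hδ => by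
    rw [perturbedSymbol_eq_deformedSymbol]
    exact hmono le_rfl (by linarith) (h1 δ hδ 0 0)
  have hB : B₂ * s ≤ (B₁ + B₂) * s := by gcongr; linarith
  constructor
  · intro hlow
    -- The model of `K_δ` near `y` has the displacement frozen at `F (δ • y)`; it is `K_0`
    -- translated by `F (δ • y) - F 0`.
    refine hcore (perturbedSymbol a F δ) (fun y => deformedSymbol a F 0 0 (δ • y + 0)) (hS δ)
      (fun y => isSymbolS00_deformedSymbol ha hF _ _ _) (hbd δ hδ1) s hs0 hs1 (fun y => ?_) z r hr
      (fun y φ => ?_)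
    · rw [← neg_sub, perturbedSymbol_eq_deformedSymbol]
      exact (hmono hs0.le hB (h2 s hs0.le hs1 δ hsq 0 0 y)).neg
    · refine IsWeylQuantization.le_norm_translate (v := F (δ • y) - F 0)
        (hS 0).isWeylQuantization_weylOp ?_ hlow φ
      have e : (fun p : Rd d × Rd d => perturbedSymbol a F 0 (p.1 + (F (δ • y) - F 0), p.2)) =
          deformedSymbol a F 0 0 (δ • y + 0) := by
        funext p
        simp only [perturbedSymbol, deformedSymbol, displacement, zero_smul, zero_add, add_zero]
        congr 1
        refine Prod.ext ?_ (add_zero _).symm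
        simp only [Prod.fst_add]
        abel
      rw [e]
      exact (isSymbolS00_deformedSymbol ha hF _ _ _).isWeylQuantization_weylOp
  · intro hlow
    -- For the converse, the models of `K_0` are translates of `K_δ`. By the choice of `v y`,
    -- freezing the displacement of the translate at `y` gives the symbol of `K_0` exactly.
    choose v hv using exists_translation hlip hδM
    refine hcore (perturbedSymbol a F 0) (fun y => deformedSymbol a F δ (-v y) (-(δ • v y))) (hS 0)
      (fun y => isSymbolS00_deformedSymbol ha hF _ _ _) (hbd 0 (by simp)) s hs0 hs1 (fun y => ?_)
      z r hr (fun y φ => ?_)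
    · have e : perturbedSymbol a F 0 =
          deformedSymbol a F 0 (-v y) (δ • y + -(δ • v y)) := by
        funext p
        simp only [perturbedSymbol, deformedSymbol, displacement, zero_smul, zero_add,
          ← sub_eq_add_neg, ← smul_sub]
        have h3 : -v y + F (δ • (y - v y)) = F 0 := by
          nth_rewrite 1 [hv y]; abel
        rw [h3]
        congr 1
        exact Prod.ext rfl (add_zero _).symm
      rw [e]
      exact hmono hs0.le hB (h2 s hs0.le hs1 δ hsq (-v y) (-(δ • v y)) y)
    · refine IsWeylQuantization.le_norm_translate (v := -v y)
        (hS δ).isWeylQuantization_weylOp ?_ hlow φ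
      have e : (fun p : Rd d × Rd d => perturbedSymbol a F δ (p.1 + -v y, p.2)) =
          deformedSymbol a F δ (-v y) (-(δ • v y)) := by
        funext p
        simp only [perturbedSymbol, deformedSymbol, displacement]
        congr 1
        refine Prod.ext ?_ (add_zero _).symm
        simp only [Prod.fst_add, smul_add, smul_neg]
        abel
      rw [e]
      exact (isSymbolS00_deformedSymbol ha hF _ _ _).isWeylQuantization_weylOp

theorem isWeylQuantization_perturbedOp {a : Rd d × Rd d → ℝ} (ha : IsSymbolS00 a)
    {F : Rd d → Rd d} (hF : IsAdmissibleField F) (δ : ℝ) :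
    IsWeylQuantization (perturbedSymbol a F δ) (perturbedOp a F δ) :=
  (ha.perturbedSymbol hF δ).isWeylQuantization_weylOp

theorem exists_norm_perturbedOp_le {a : Rd d × Rd d → ℝ} (ha : IsSymbolS00 a)
    {F : Rd d → Rd d} (hF : IsAdmissibleField F) :
    ∃ N : ℝ, 0 < N ∧ ∀ δ : ℝ, |δ| ≤ 1 → ‖perturbedOp a F δ‖ ≤ N := by
  obtain ⟨C, hC, h⟩ := exists_norm_weylOp_le d
  obtain ⟨B, hB, hB'⟩ := exists_symbolBound_deformedSymbol ha hF le_rfl (symbolOrder d 1)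
  refine ⟨C * B + 1, by positivity, fun δ hδ => ?_⟩
  have := h _ (ha.perturbedSymbol hF δ) B hB (by
    rw [perturbedSymbol_eq_deformedSymbol]; exact hB' δ hδ 0 0)
  exact this.trans (by linarith)

/-- The spectra of `K_δ` and `K_0` are `√|δ|`-close. -/
theorem exists_spectrum_stability {a : Rd d × Rd d → ℝ} (ha : IsSymbolS00 a)
    {F : Rd d → Rd d} (hF : IsAdmissibleField F) :
    ∃ C : ℝ, 0 < C ∧ ∀ δ : ℝ, |δ| ≤ 1 →
      (∀ z ∈ spectrum ℝ (perturbedOp a F δ), ∃ μ ∈ spectrum ℝ (perturbedOp a F 0),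
        |z - μ| ≤ C * √|δ|) ∧
      (∀ z ∈ spectrum ℝ (perturbedOp a F 0), ∃ μ ∈ spectrum ℝ (perturbedOp a F δ),
        |z - μ| ≤ C * √|δ|) := by
  obtain ⟨C, δ₀, hC, hδ₀, hδ₀1, hstab⟩ := exists_lower_bound_stability ha hF
  obtain ⟨N, hN, hNb⟩ := exists_norm_perturbedOp_le ha hF
  have hsa : ∀ δ, IsSelfAdjoint (perturbedOp a F δ) := fun δ =>
    (isWeylQuantization_perturbedOp ha hF δ).isSelfAdjoint
  have hne : ∀ δ, (spectrum ℝ (perturbedOp a F δ)).Nonempty := fun δ =>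
    (hsa δ).spectrum_real_nonempty
  have hs₀ : 0 < √δ₀ := Real.sqrt_pos.2 hδ₀
  -- The first term serves `|δ| ≤ δ₀`. The second serves `|δ| > δ₀`, where `√|δ|` is bounded below
  -- and any two spectral points are at distance at most `2 * N`.
  refine ⟨C + 2 * N / √δ₀, by positivity, fun δ hδ => ?_⟩
  have hle : C * √|δ| ≤ (C + 2 * N / √δ₀) * √|δ| := by
    gcongr
    have : 0 < 2 * N / √δ₀ := by positivity
    linarith
  rcases eq_or_ne δ 0 with rfl | hδ0
  · exact ⟨fun z hz => ⟨z, hz, by simp⟩, fun z hz => ⟨z, hz, by simp⟩⟩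
  have hs : 0 < √|δ| := Real.sqrt_pos.2 (abs_pos.2 hδ0)
  rcases le_or_gt |δ| δ₀ with hsmall | hlarge
  · constructor
    · intro z hz
      by_contra! hcon
      -- This is the smallest `r` that the stability result allows. Cancelling `C` afterwards leaves
      -- the positive lower bound `√|δ|` for the other operator.
      have hlow := (hsa 0).le_norm_sub_smul (z := z) (r := C * √|δ|) (by positivity)
        fun μ hμ => hle.trans (hcon μ hμ).le
      have h1 := (hstab δ hδ0 hsmall z _ le_rfl).1 hlow
      refine (hsa δ).notMem_spectrum_of_le_norm (r := √|δ|) hs (fun f => ?_) hz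
      have := h1 f
      rw [mul_assoc] at this
      exact le_of_mul_le_mul_left this hC
    · intro z hz
      by_contra! hcon
      have hlow := (hsa δ).le_norm_sub_smul (z := z) (r := C * √|δ|) (by positivity)
        fun μ hμ => hle.trans (hcon μ hμ).le
      have h1 := (hstab δ hδ0 hsmall z _ le_rfl).2 hlow
      refine (hsa 0).notMem_spectrum_of_le_norm (r := √|δ|) hs (fun f => ?_) hz
      have := h1 f
      rw [mul_assoc] at this
      exact le_of_mul_le_mul_left this hC
  · have hbig : 2 * N ≤ (C + 2 * N / √δ₀) * √|δ| := by
      have h1 : √δ₀ ≤ √|δ| := Real.sqrt_le_sqrt hlarge.le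
      calc 2 * N = 2 * N / √δ₀ * √δ₀ := by field_simp
        _ ≤ (C + 2 * N / √δ₀) * √|δ| := by gcongr; linarith
    have hspec : ∀ δ, |δ| ≤ 1 → ∀ z ∈ spectrum ℝ (perturbedOp a F δ), |z| ≤ N := fun δ hδ z hz =>
      (spectrum.norm_le_norm_of_mem hz).trans (hNb δ hδ)
    constructor
    · intro z hz
      obtain ⟨μ, hμ⟩ := hne 0
      refine ⟨μ, hμ, (abs_sub _ _).trans (le_trans ?_ hbig)⟩
      linarith [hspec δ hδ z hz, hspec 0 (by simp) μ hμ]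
    · intro z hz
      obtain ⟨μ, hμ⟩ := hne δ
      refine ⟨μ, hμ, (abs_sub _ _).trans (le_trans ?_ hbig)⟩
      linarith [hspec δ hδ μ hμ, hspec 0 (by simp) z hz]

end SpectralStability

end

/-! ### Hausdorff distance and spectral gaps. -/

theorem corollary1 (d : ℕ) (a : Rd d × Rd d → ℝ) (ha : IsSymbolS00 a)
    (F : Rd d → Rd d) (hF : IsAdmissibleField F) :
    -- `K_δ` really is a bounded self-adjoint Weyl quantization, for every real `δ`
    (∀ δ : ℝ, IsWeylQuantization (perturbedSymbol a F δ) (perturbedOp a F δ) ∧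
      IsSelfAdjoint (perturbedOp a F δ)) ∧
    ∃ C : ℝ, 0 < C ∧
      -- `C` is a constant for the Hausdorff distance bound
      (∀ δ : ℝ, |δ| ≤ 1 →
        Metric.hausdorffDist (spectrum ℝ (perturbedOp a F δ)) (spectrum ℝ (perturbedOp a F 0))
          ≤ C * √|δ|) ∧
      -- and the same `C` serves all open gaps of `K_0`
      ∀ l₀ m₀ : ℝ, l₀ < m₀ →
        l₀ ∈ spectrum ℝ (perturbedOp a F 0) → m₀ ∈ spectrum ℝ (perturbedOp a F 0) →
        Ioo l₀ m₀ ⊆ resolventSet ℝ (perturbedOp a F 0) →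
        ∀ δ : ℝ, |δ| < (m₀ - l₀) ^ 2 / (4 * C ^ 2) →
          (Icc (l₀ + C * √|δ|) (m₀ - C * √|δ|)).Nonempty ∧
          (δ ≠ 0 →
            Icc (l₀ + C * √|δ|) (m₀ - C * √|δ|) ⊆ resolventSet ℝ (perturbedOp a F δ)) ∧
          (Icc (l₀ - C * √|δ|) (l₀ + C * √|δ|) ∩ spectrum ℝ (perturbedOp a F δ)).Nonempty ∧
          (Icc (m₀ - C * √|δ|) (m₀ + C * √|δ|) ∩ spectrum ℝ (perturbedOp a F δ)).Nonempty := by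
  refine ⟨fun δ => ⟨isWeylQuantization_perturbedOp ha hF δ,
    (isWeylQuantization_perturbedOp ha hF δ).isSelfAdjoint⟩, ?_⟩
  obtain ⟨C, hC, hstab⟩ := exists_spectrum_stability ha hF
  obtain ⟨N, hN, hNb⟩ := exists_norm_perturbedOp_le ha hF
  -- The surplus `N` has two uses in the gap statement: it makes the enlargement of `C` strict, so
  -- that the closed interval, endpoints included, avoids the spectrum, and it forces `|δ| ≤ 1`
  -- under the smallness condition on `δ`.
  refine ⟨C + N, by positivity, fun δ hδ => ?_, ?_⟩
  · have hle : C * √|δ| ≤ (C + N) * √|δ| := by gcongr; linarith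
    refine Metric.hausdorffDist_le_of_mem_dist (by positivity) (fun z hz => ?_) fun z hz => ?_
    · obtain ⟨μ, hμ, h⟩ := (hstab δ hδ).1 z hz
      exact ⟨μ, hμ, h.trans hle⟩
    · obtain ⟨μ, hμ, h⟩ := (hstab δ hδ).2 z hz
      exact ⟨μ, hμ, h.trans hle⟩
  intro l₀ m₀ hlm hl hm hgap δ hδ
  have hspec : ∀ z ∈ spectrum ℝ (perturbedOp a F 0), |z| ≤ N := fun z hz =>
    (spectrum.norm_le_norm_of_mem hz).trans (hNb 0 (by simp))
  have hsq : (2 * (C + N) * √|δ|) ^ 2 < (m₀ - l₀) ^ 2 := by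
    rw [lt_div_iff₀ (by positivity)] at hδ
    rw [mul_pow, Real.sq_sqrt (abs_nonneg δ)]
    linarith
  have hwidth : 2 * (C + N) * √|δ| < m₀ - l₀ :=
    lt_of_pow_lt_pow_left₀ 2 (by linarith) hsq
  -- The gap lies within `[-N, N]`, so its width is at most `2 * N`; `√|δ| > 1` would contradict
  -- `hwidth`.
  have hδ1 : |δ| ≤ 1 := by
    have h1 := abs_le.1 (hspec l₀ hl)
    have h2 := abs_le.1 (hspec m₀ hm)
    have h3 : √|δ| ≤ 1 := by
      by_contra! h
      nlinarith
    rwa [Real.sqrt_le_one] at h3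
  have hle : C * √|δ| ≤ (C + N) * √|δ| := by gcongr; linarith
  refine ⟨⟨l₀ + (C + N) * √|δ|, le_rfl, by linarith⟩, fun hδ0 z hz => ?_, ?_, ?_⟩
  · by_contra hzs
    -- A spectral point `z` of `K_δ` in the shrunken interval has a point `μ` of the spectrum of
    -- `K_0` within `C * √|δ|`, strictly less than its distance to the gap edges, so `μ` would lie
    -- in the open gap.
    obtain ⟨μ, hμ, h⟩ := (hstab δ hδ1).1 z hzs
    have hs : 0 < √|δ| := Real.sqrt_pos.2 (abs_pos.2 hδ0)
    have hlt : C * √|δ| < (C + N) * √|δ| := by gcongr; linarith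
    have h1 := abs_le.1 h
    exact hμ (hgap ⟨by linarith [hz.1, hz.2], by linarith [hz.1, hz.2]⟩)
  · obtain ⟨μ, hμ, h⟩ := (hstab δ hδ1).2 l₀ hl
    have h1 := abs_le.1 h
    exact ⟨μ, ⟨by linarith, by linarith⟩, hμ⟩
  · obtain ⟨μ, hμ, h⟩ := (hstab δ hδ1).2 m₀ hm
    have h1 := abs_le.1 h
    exact ⟨μ, ⟨by linarith, by linarith⟩, hμ⟩
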